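/- Let $U\subset\mathbb R^3$ be an open neighbourhood of $\Lambda=0$ with Cartesian coordinates $(x,y,z)$, and let $(\rho,\varphi,z)$ be the corresponding cylindrical coordinates. Let $\tilde h$ be a smooth Riemannian metric on $U$ that off the axis $\rho=0$ has the form $$\tilde h=e^{2\kappa}\left(\rho^2e^{-2\beta}\,d\varphi^2+d\rho^2+dz^2\right),$$ where $\beta,\kappa:U\to\mathbb R$ are real-analytic and axisymmetric (functions of $(z,\rho)$ only) and $\kappa(\Lambda)=0$. Let $\tilde\phi:U\to\mathbb C$ be real-analytic and axisymmetric. (For a stationary axisymmetric asymptotically flat spacetime, $\tilde h=\Omega^2h$ is the conformally rescaled metric on the space of Killing trajectories, and $\tilde\phi=\phi/\sqrt\Omega$ is the rescaled potential.) With $\tilde D$ the Levi-Civita connection and $\tilde R_{ab}$ the Ricci tensor of $\tilde h$, let $P=\tilde\phi$ and, for $n\ge1$, $$P_{a_1\dots a_n}=C\left[\tilde D_{a_1}P_{a_2\dots a_n}-\tfrac{(n-1)(2n-3)}{2}\tilde R_{a_1a_2}P_{a_3\dots a_n}\right],$$ where $C[\cdot]$ is the totally symmetric and $\tilde h$-trace-free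 part (the last term is absent for $n=1$). The multipole moments $m_n$ are defined by $P_{a_1\dots a_n}(\Lambda)=m_n\,C[z_{a_1}\cdots z_{a_n}]$ at $\Lambda$, with $z_a=(dz)_a$. On the meridian plane with coordinates $(z,\rho)$, extended to $\rho<0$, put $\eta=\partial_z-i\partial_\rho$ and $f_n(z,\rho)=\eta^{a_1}\cdots\eta^{a_n}P_{a_1\dots a_n}$, and likewise regard $\beta$ and $\kappa$ as (even in $\rho$) functions of $(z,\rho)$. For a function $g(z,\rho)$ that is real-analytic near the origin, let $g_L(r)=g(r,-ir)$, where $g$ is continued to complex arguments by its power series. Then there is $\delta>0$ such that $\beta$, $\kappa$ and all $f_n$ extend analytically to the complex polydisc $|z|,|\rho|<\delta$, so that $\beta_L$, $\kappa_L$ and $y_n:=(f_n)_L$ are defined and analytic on $(-\delta,\delta)$. The function $$M(r)=\beta_L''-(\beta_L')^2+\frac2r\beta_L'-\kappa_L''+(\kappa_L')^2$$ extends analytically across $r=0$ to $(-\delta,\delta)$, and for all $n\ge1$, on $(-\delta,\delta)$, $$y_n=y_{n-1}'-2(n-1)\kappa_L'\,y_{n-1}-\tfrac{(n-1)(2n-3)}{2}\,M\,y_{n-2}$$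 (the last term being absent for $n=1$). Moreover, for every $n\ge0$ the moment $m_n$ exists, is unique, and $m_n=y_n(0)$. -/

import Mathlib

open scoped ContDiff

noncomputable section

namespace Multipole

/-- The coordinate space of a Cartesian chart `(x, y, z)` around `Λ = 0`;
the symmetry axis is the `z`-axis. -/
abbrev Pt : Type := Fin 3 → ℝ

/-- Components of a complex covariant tensor of rank `n` at a point. -/
abbrev Tensor (n : ℕ) : Type := (Fin n → Fin 3) → ℂ

/-- Partial derivative in the `i`-th coordinate direction. -/
def pderiv {E : Type*} [NormedAddCommGroup E] [NormedSpace ℝ E]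
    (i : Fin 3) (g : Pt → E) (p : Pt) : E :=
  fderiv ℝ g p (Pi.single i 1)

/-- A smooth Riemannian metric on `U`, given by its component matrix. -/
def IsSmoothMetricOn (U : Set Pt) (h : Pt → Matrix (Fin 3) (Fin 3) ℝ) : Prop :=
  (∀ i j, ContDiffOn ℝ ∞ (fun p => h p i j) U) ∧ ∀ p ∈ U, (h p).PosDef

/-- Christoffel symbols `Γ^k_{ij}` of the Levi-Civita connection. -/
def christoffel (h : Pt → Matrix (Fin 3) (Fin 3) ℝ) (k i j : Fin 3) (p : Pt) : ℝ :=
  (1 / 2) * ∑ l, (h p)⁻¹ k l *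
    (pderiv i (fun q => h q j l) p + pderiv j (fun q => h q i l) p
      - pderiv l (fun q => h q i j) p)

/-- Ricci tensor `R_{ij}` (positive on round spheres). -/
def ricci (h : Pt → Matrix (Fin 3) (Fin 3) ℝ) (i j : Fin 3) (p : Pt) : ℝ :=
  ∑ k, (pderiv k (christoffel h k i j) p - pderiv j (christoffel h k k i) p)
    + ∑ k, ∑ l, (christoffel h k k l p * christoffel h l i j p
        - christoffel h k j l p * christoffel h l k i p)

/-- Covariant derivative `D_{a₀} T_{a₁ … aₙ}`. -/
def covD (h : Pt → Matrix (Fin 3) (Fin 3) ℝ) {n : ℕ} (T : Pt → Tensor n) :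
    Pt → Tensor (n + 1) := fun p a =>
  pderiv (a 0) (fun q => T q (Fin.tail a)) p
    - ∑ i : Fin n, ∑ k : Fin 3,
        (christoffel h k (a 0) (Fin.tail a i) p : ℂ) *
          T p (Function.update (Fin.tail a) i k)

/-- Total symmetrization `T_{(a₁ … aₙ)}`. -/
def symm {n : ℕ} (T : Tensor n) : Tensor n := fun a =>
  ((n.factorial : ℂ))⁻¹ * ∑ σ : Equiv.Perm (Fin n), T (fun i => a (σ i))

/-- Total symmetry. -/
def IsSymm {n : ℕ} (T : Tensor n) : Prop :=
  ∀ (σ : Equiv.Perm (Fin n)) (a : Fin n → Fin 3), T (fun i => a (σ i)) = T a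

/-- All traces with respect to the metric `h` vanish. -/
def IsTraceFree {n : ℕ} (h : Matrix (Fin 3) (Fin 3) ℝ) (T : Tensor n) : Prop :=
  ∀ i j : Fin n, i ≠ j → ∀ a : Fin n → Fin 3,
    ∑ k, ∑ l, ((h⁻¹ k l : ℝ) : ℂ) * T (Function.update (Function.update a i k) j l) = 0

/-- The span of the tensors `h_{a_i a_j} U`, where `U` is a tensor in the remaining indices. -/
def traceSpan (h : Matrix (Fin 3) (Fin 3) ℝ) (n : ℕ) : Submodule ℂ (Tensor n) :=
  Submodule.span ℂ {T | ∃ i j : Fin n, i ≠ j ∧ ∃ U : Tensor n,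
    (∀ a k l, U (Function.update (Function.update a i k) j l) = U a) ∧
    ∀ a, T a = (h (a i) (a j) : ℂ) * U a}

/-- `X` is the totally symmetric and trace-free part of `T`: it is symmetric and trace-free, and
arises from the symmetrization of `T` by subtracting terms that contain a factor `h_{a_i a_j}`. -/
def IsSTFPart {n : ℕ} (h : Matrix (Fin 3) (Fin 3) ℝ) (T X : Tensor n) : Prop :=
  IsSymm X ∧ IsTraceFree h X ∧ symm T - X ∈ traceSpan h n

/-- The totally symmetric and trace-free part `C[T]` (it exists and is unique for positive
definite `h`). -/
def stf {n : ℕ} (h : Matrix (Fin 3) (Fin 3) ℝ) (T : Tensor n) : Tensor n :=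
  Classical.epsilon (fun X => IsSTFPart h T X)

/-- The Geroch–Hansen recursion
`P_{a₁…aₙ} = C[D_{a₁} P_{a₂…aₙ} - ((n-1)(2n-3)/2) R_{a₁a₂} P_{a₃…aₙ}]` with `P = φ` for `n = 0`;
the last clause is the case of rank `n + 2`. -/
def gerochHansen (h : Pt → Matrix (Fin 3) (Fin 3) ℝ) (φ : Pt → ℂ) : (n : ℕ) → Pt → Tensor n
  | 0 => fun p _ => φ p
  | 1 => fun p => stf (h p) (covD h (gerochHansen h φ 0) p)
  | n + 2 => fun p => stf (h p) (fun a =>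
      covD h (gerochHansen h φ (n + 1)) p a
        - (((n : ℂ) + 1) * (2 * (n : ℂ) + 1) / 2) * (ricci h (a 0) (a 1) p : ℂ)
          * gerochHansen h φ n p (fun i => a i.succ.succ))

/-- `m` is the `n`-th moment: `P_{a₁…aₙ}(Λ) = m C[z_{a₁} ⋯ z_{aₙ}]`, where `z_a = (dz)_a`. -/
def IsMoment (h : Pt → Matrix (Fin 3) (Fin 3) ℝ) (φ : Pt → ℂ) (n : ℕ) (m : ℂ) : Prop :=
  gerochHansen h φ n 0 = m • stf (h 0) (fun a => ∏ i, if a i = 2 then (1 : ℂ) else 0)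

/-- Distance `ρ` from the axis. -/
def rho (p : Pt) : ℝ := Real.sqrt (p 0 ^ 2 + p 1 ^ 2)

/-- Components of `dρ` off the axis. -/
def dRho (p : Pt) : Fin 3 → ℝ := ![p 0 / rho p, p 1 / rho p, 0]

/-- Components of `dφ` (the azimuth) off the axis. -/
def dPhi (p : Pt) : Fin 3 → ℝ := ![-p 1 / rho p ^ 2, p 0 / rho p ^ 2, 0]

/-- Components of `dz`. -/
def dZ : Fin 3 → ℝ := ![0, 0, 1]

/-- Off the axis, `h = e^{2κ} (ρ² e^{-2β} dφ² + dρ² + dz²)`. -/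
def HasAxisymmetricForm (U : Set Pt) (h : Pt → Matrix (Fin 3) (Fin 3) ℝ)
    (β κ : Pt → ℝ) : Prop :=
  ∀ p ∈ U, rho p ≠ 0 → ∀ i j, h p i j = Real.exp (2 * κ p) *
    (rho p ^ 2 * Real.exp (-2 * β p) * dPhi p i * dPhi p j
      + dRho p i * dRho p j + dZ i * dZ j)

/-- A function that depends on `(z, ρ)` only. -/
def IsAxisymmetricOn {E : Type*} (U : Set Pt) (g : Pt → E) : Prop :=
  ∀ p ∈ U, ∀ q ∈ U, p 2 = q 2 → rho p = rho q → g p = g q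

/-- The point of the meridian plane with coordinates `(z, ρ)`, where also `ρ < 0` is allowed. -/
def meridian (w : ℝ × ℝ) : Pt := ![w.2, 0, w.1]

/-- The null vector `η = ∂_z - i ∂_ρ` on the meridian plane. -/
def eta : Fin 3 → ℂ := ![-Complex.I, 0, 1]

/-- `f_n = η^{a₁} ⋯ η^{aₙ} P_{a₁…aₙ}` as a function of `(z, ρ)`. -/
def fFun (h : Pt → Matrix (Fin 3) (Fin 3) ℝ) (φ : Pt → ℂ) (n : ℕ) (w : ℝ × ℝ) : ℂ :=
  ∑ a : Fin n → Fin 3, (∏ i, eta (a i)) * gerochHansen h φ n (meridian w) a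

/-- `G` is the complex-analytic continuation of `g` to the polydisc of radius `δ`
(balls in products carry the maximum norm). -/
def IsComplexification (δ : ℝ) (g : ℝ × ℝ → ℂ) (G : ℂ × ℂ → ℂ) : Prop :=
  AnalyticOnNhd ℂ G (Metric.ball 0 δ) ∧
    ∀ w ∈ Metric.ball (0 : ℝ × ℝ) δ, G ((w.1 : ℂ), (w.2 : ℂ)) = g w

open Classical in
/-- The leading order function `g_L(r) = g(r, -ir)`, through the continuation of `g` to some
polydisc that contains `(r, -ir)`; its value does not depend on the continuation. -/
def leadingOrder (g : ℝ × ℝ → ℂ) (r : ℝ) : ℂ :=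
  if H : ∃ G : ℂ × ℂ → ℂ, ∃ δ : ℝ, |r| < δ ∧ IsComplexification δ g G then
    H.choose ((r : ℂ), -Complex.I * (r : ℂ))
  else 0

/-- A real function on the chart as a complex-valued function of `(z, ρ)`. -/
def onMeridian (g : Pt → ℝ) (w : ℝ × ℝ) : ℂ := (g (meridian w) : ℂ)

end Multipole

end

/-!
A tensor and its symmetric trace-free part have the same full contraction with a null vector `v`,
because the trace terms contribute multiples of `h(v, v) = 0`. Hence the recursion for the tensors
`P_{a₁…aₙ}` becomes a scalar recursion for `f_n` along the field `N = ∂_z - i ∂_ρ` of the meridian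
planes, which is null and geodesic up to scale: `D_N N = 2 N(κ) N`. The only curvature in it is
`R_{ab} N^a N^b`, and the Raychaudhuri equation computes this from the divergence of `N`, with a
single singular term, a multiple of `N(β) / ρ`.

As `h` is smooth at the axis, `β` vanishes there, so `N(β)` is divisible by `ρ` and
`R_{ab} N^a N^b` is analytic. All the `f_n` are therefore analytic on the disc on which `φ`, `β`,
`κ` and `N(β) / ρ` are, and their complexifications satisfy the recursion at `(r, -ir)`, where `N`
acts as `d/dr`.

At `Λ` a symmetric trace-free tensor is determined by its contractions with the null vectors `N` of
the meridian planes. By axisymmetry those of `P_{a₁…aₙ}` do not depend on the plane, so the tensor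
is a multiple of `C[z_{a₁} ⋯ z_{aₙ}]`, whose contractions are `1`.
-/

open scoped ContDiff Topology

noncomputable section

namespace Multipole

/-! ### Trace-free tensors and the symmetric trace-free part -/

section MultiIndex

open Function

variable {ι κ R : Type*} [Fintype ι] [DecidableEq ι] [Fintype κ] [CommSemiring R]

lemma sum_sum_update (i : ι) (F : (ι → κ) → R) :
    ∑ b, ∑ k, F (update b i k) = Fintype.card κ * ∑ b, F b := by
  have swap : ∑ x : (ι → κ) × κ, F (update x.1 i x.2) = ∑ x : (ι → κ) × κ, F x.1 :=
    Finset.sum_bij' (fun x _ => (update x.1 i x.2, x.1 i)) (fun x _ => (update x.1 i x.2, x.1 i))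
      (by simp) (by simp) (by simp) (by simp) (by simp)
  rw [Fintype.sum_prod_type, Fintype.sum_prod_type] at swap
  simp [swap, Finset.mul_sum]

lemma sum_sum_update_update_mul (i j : ι) (F : (ι → κ) → R) {W : (ι → κ) → R}
    (hW : ∀ a k l, W (update (update a i k) j l) = W a) :
    ∑ b, (∑ k, ∑ l, F (update (update b i k) j l)) * W b
      = Fintype.card κ ^ 2 * ∑ b, F b * W b := by
  rw [sq, mul_assoc, ← sum_sum_update j, ← sum_sum_update i]
  simp only [Finset.sum_mul, hW]

lemma prod_eq_mul_mul_prod_erase_erase {i j : ι} (hij : i ≠ j) (g : ι → R) :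
    ∏ m, g m = g i * g j * ∏ m ∈ (Finset.univ.erase i).erase j, g m := by
  rw [mul_assoc, Finset.mul_prod_erase _ _ (Finset.mem_erase.2 ⟨hij.symm, Finset.mem_univ j⟩),
    Finset.mul_prod_erase _ _ (Finset.mem_univ i)]

omit [Fintype κ] in
lemma prod_erase_erase_update_update (i j : ι) (g : ι → κ → R) (a : ι → κ) (k l : κ) :
    ∏ m ∈ (Finset.univ.erase i).erase j, g m (update (update a i k) j l m)
      = ∏ m ∈ (Finset.univ.erase i).erase j, g m (a m) := by
  refine Finset.prod_congr rfl fun m hm => ?_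
  simp only [Finset.mem_erase] at hm
  rw [update_of_ne hm.1, update_of_ne hm.2.1]

end MultiIndex

section Tensors

open Function Matrix

variable {n : ℕ} {g h : Matrix (Fin 3) (Fin 3) ℝ} {S T X Y : Tensor n}

lemma dotProduct_eq_zero_of_mem_traceSpan
    (hT : ∀ i j : Fin n, i ≠ j → ∀ a, ∑ k, ∑ l, (g k l : ℂ) * T (update (update a i k) j l) = 0)
    (hS : S ∈ traceSpan g n) : S ⬝ᵥ T = 0 := by
  induction hS using Submodule.span_induction with
  | mem S hS =>
    obtain ⟨i, j, hij, W, hW, hSW⟩ := hS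
    have average := sum_sum_update_update_mul i j (fun a => (g (a i) (a j) : ℂ) * T a) hW
    simp only [update_self, update_of_ne hij, hT i j hij, zero_mul, Finset.sum_const_zero,
      zero_eq_mul] at average
    simpa [dotProduct, hSW, mul_right_comm] using average
  | zero => exact zero_dotProduct T
  | add S S' _ _ hS hS' => rw [add_dotProduct, hS, hS', add_zero]
  | smul c S _ hS => rw [smul_dotProduct, hS, smul_zero]

lemma IsTraceFree.dotProduct_eq_zero (hT : IsTraceFree h T) (hS : S ∈ traceSpan h⁻¹ n) :
    S ⬝ᵥ T = 0 :=
  dotProduct_eq_zero_of_mem_traceSpan hT hS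

open scoped ComplexOrder in
lemma isTraceFree_of_dotProduct_eq_zero (hT : ∀ S ∈ traceSpan h⁻¹ n, S ⬝ᵥ T = 0) :
    IsTraceFree h T := by
  intro i j hij
  let trace : Tensor n := fun a =>
    ∑ k, ∑ l, ((h⁻¹ k l : ℝ) : ℂ) * T (update (update a i k) j l)
  have trace_update : ∀ a k l, trace (update (update a i k) j l) = trace a := fun a k l => by
    refine Finset.sum_congr rfl fun m _ => Finset.sum_congr rfl fun p _ => ?_
    rw [update_comm hij, update_idem, update_comm hij.symm, update_idem]
  have average := sum_sum_update_update_mul i j (fun a => ((h⁻¹ (a i) (a j) : ℝ) : ℂ) * T a)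
    (W := star trace) fun a k l => congrArg star (trace_update a k l)
  have orthogonal := hT (fun a => ((h⁻¹ (a i) (a j) : ℝ) : ℂ) * star trace a)
    (Submodule.subset_span ⟨i, j, hij, star trace,
      fun a k l => congrArg star (trace_update a k l), fun _ => rfl⟩)
  simp only [dotProduct, mul_right_comm _ (star trace _)] at orthogonal
  simp only [update_self, update_of_ne hij, orthogonal, mul_zero] at average
  exact congrFun (dotProduct_self_star_eq_zero.1 average)

lemma isTraceFree_iff_dotProduct_eq_zero :
    IsTraceFree h T ↔ ∀ S ∈ traceSpan h⁻¹ n, S ⬝ᵥ T = 0 :=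
  ⟨fun hT _ hS => hT.dotProduct_eq_zero hS, isTraceFree_of_dotProduct_eq_zero⟩

lemma IsTraceFree.add (hT : IsTraceFree h T) (hX : IsTraceFree h X) : IsTraceFree h (T + X) := by
  rw [isTraceFree_iff_dotProduct_eq_zero] at *
  intro S hS
  rw [dotProduct_add, hT S hS, hX S hS, add_zero]

lemma IsTraceFree.smul (hT : IsTraceFree h T) (c : ℂ) : IsTraceFree h (c • T) := by
  rw [isTraceFree_iff_dotProduct_eq_zero] at *
  intro S hS
  rw [dotProduct_smul, hT S hS, smul_zero]

/-- The tensor `a ↦ T (a ∘ σ)` obtained from `T` by permuting its indices. -/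
def permute (σ : Equiv.Perm (Fin n)) : Tensor n →ₗ[ℂ] Tensor n :=
  LinearMap.funLeft ℂ ℂ fun a i => a (σ i)

lemma isSymm_iff_permute_eq : IsSymm T ↔ ∀ σ, permute σ T = T :=
  forall_congr' fun _ => funext_iff.symm

lemma symm_eq_smul_sum_permute (T : Tensor n) :
    symm T = (n.factorial : ℂ)⁻¹ • ∑ σ, permute σ T := by
  ext a
  simp [symm, permute, LinearMap.funLeft_apply]

lemma dotProduct_permute (σ : Equiv.Perm (Fin n)) (S T : Tensor n) :
    S ⬝ᵥ permute σ T = permute σ⁻¹ S ⬝ᵥ T := by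
  refine Fintype.sum_equiv (σ.symm.arrowCongr (Equiv.refl (Fin 3))) _ _ fun a => ?_
  refine congrArg₂ (· * ·) (congrArg S ?_) (congrArg T ?_) <;> funext i
  · simp [Equiv.arrowCongr]
  · rfl

lemma permute_mem_traceSpan (hT : T ∈ traceSpan h n) (σ : Equiv.Perm (Fin n)) :
    permute σ T ∈ traceSpan h n := by
  refine (Submodule.span_le (p := (traceSpan h n).comap (permute σ))).2 ?_ hT
  rintro T ⟨i, j, hij, W, hW, hTW⟩
  refine Submodule.subset_span ⟨σ i, σ j, σ.injective.ne hij, permute σ W, fun a k l => ?_,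
    fun a => hTW _⟩
  refine Eq.trans (congrArg W ?_) (hW (fun i => a (σ i)) k l)
  ext m
  simp [update_apply, σ.injective.eq_iff]

lemma symm_mem_traceSpan (hT : T ∈ traceSpan h n) : symm T ∈ traceSpan h n := by
  rw [symm_eq_smul_sum_permute]
  exact Submodule.smul_mem _ _ <| Submodule.sum_mem _ fun σ _ => permute_mem_traceSpan hT σ

lemma dotProduct_symm (S T : Tensor n) : S ⬝ᵥ symm T = symm S ⬝ᵥ T := by
  simp only [symm_eq_smul_sum_permute, dotProduct_smul, smul_dotProduct, dotProduct_sum,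
    sum_dotProduct, dotProduct_permute]
  exact congrArg _ (Equiv.sum_comp (Equiv.inv _) fun σ => permute σ S ⬝ᵥ T)

lemma IsTraceFree.symm (hT : IsTraceFree h T) : IsTraceFree h (symm T) := by
  rw [isTraceFree_iff_dotProduct_eq_zero] at *
  exact fun S hS => (dotProduct_symm S T).trans (hT _ (symm_mem_traceSpan hS))

lemma isSymm_symm (T : Tensor n) : IsSymm (symm T) := fun σ _ =>
  congrArg ((n.factorial : ℂ)⁻¹ * ·) (Fintype.sum_equiv (Equiv.mulLeft σ) _ _ fun τ => by simp)

lemma IsSymm.symm_eq (hT : IsSymm T) : symm T = T := by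
  rw [symm_eq_smul_sum_permute, Finset.sum_congr rfl fun σ _ => isSymm_iff_permute_eq.1 hT σ]
  simp [Fintype.card_perm, ← Nat.cast_smul_eq_nsmul ℂ, n.factorial_ne_zero]

lemma symm_add (T X : Tensor n) : symm (T + X) = symm T + symm X := by
  simp only [symm_eq_smul_sum_permute, map_add, Finset.sum_add_distrib, smul_add]

lemma symm_smul (c : ℂ) (T : Tensor n) : symm (c • T) = c • symm T := by
  simp only [symm_eq_smul_sum_permute, map_smul, ← Finset.smul_sum, smul_comm c]

lemma IsSymm.add (hT : IsSymm T) (hX : IsSymm X) : IsSymm (T + X) := fun σ a =>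
  congrArg₂ (· + ·) (hT σ a) (hX σ a)

lemma IsSymm.smul (hT : IsSymm T) (c : ℂ) : IsSymm (c • T) := fun σ a =>
  congrArg (c • ·) (hT σ a)

lemma IsSTFPart.add (hX : IsSTFPart h T X) (hY : IsSTFPart h S Y) :
    IsSTFPart h (T + S) (X + Y) :=
  ⟨hX.1.add hY.1, hX.2.1.add hY.2.1, by
    rw [symm_add, add_sub_add_comm]
    exact add_mem hX.2.2 hY.2.2⟩

lemma IsSTFPart.smul (hX : IsSTFPart h T X) (c : ℂ) : IsSTFPart h (c • T) (c • X) :=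
  ⟨hX.1.smul c, hX.2.1.smul c, by
    rw [symm_smul, ← smul_sub]
    exact Submodule.smul_mem _ c hX.2.2⟩

/-- The pullback of a covariant tensor along the linear map with matrix `A`. -/
def pull (A : Matrix (Fin 3) (Fin 3) ℝ) : Tensor n →ₗ[ℂ] Tensor n :=
  (Matrix.of fun a b : Fin n → Fin 3 => ∏ i, (A (b i) (a i) : ℂ)).mulVecLin

lemma pull_apply (A : Matrix (Fin 3) (Fin 3) ℝ) (T : Tensor n) (a : Fin n → Fin 3) :
    pull A T a = ∑ b, (∏ i, (A (b i) (a i) : ℂ)) * T b := rfl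

lemma pull_one (T : Tensor n) : pull 1 T = T := by
  ext a
  rw [pull_apply, Finset.sum_eq_single a (fun b _ hb => ?_) (by simp)]
  · simp
  · obtain ⟨i, hi⟩ := ne_iff.1 hb
    rw [Finset.prod_eq_zero (Finset.mem_univ i) (by simp [one_apply_ne hi]), zero_mul]

lemma pull_pull (A B : Matrix (Fin 3) (Fin 3) ℝ) (T : Tensor n) :
    pull A (pull B T) = pull (B * A) T := by
  rw [pull, pull, pull, mulVecLin_apply, mulVecLin_apply, mulVec_mulVec, mulVecLin_apply]
  congr 1
  ext a c
  simp only [mul_apply, of_apply, ← Finset.prod_mul_distrib, Complex.ofReal_sum,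
    Complex.ofReal_mul, Fintype.prod_sum, mul_comm]

lemma dotProduct_pull (A : Matrix (Fin 3) (Fin 3) ℝ) (S T : Tensor n) :
    S ⬝ᵥ pull A T = pull Aᵀ S ⬝ᵥ T := by
  rw [pull, mulVecLin_apply, dotProduct_mulVec]
  congr 1
  ext b
  simp [pull_apply, vecMul, dotProduct, mul_comm]

lemma permute_pull (A : Matrix (Fin 3) (Fin 3) ℝ) (T : Tensor n) (σ : Equiv.Perm (Fin n)) :
    permute σ (pull A T) = pull A (permute σ T) := by
  ext a
  refine Fintype.sum_equiv (σ.arrowCongr (Equiv.refl (Fin 3))) _ _ fun b => ?_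
  refine congrArg₂ (· * ·) ?_ (congrArg T ?_)
  · exact (by simp : _ = ∏ i, _).trans (Equiv.prod_comp σ _)
  · ext i
    simp

lemma pull_symm (A : Matrix (Fin 3) (Fin 3) ℝ) (T : Tensor n) :
    pull A (symm T) = symm (pull A T) := by
  simp only [symm_eq_smul_sum_permute, map_smul, map_sum, permute_pull]

lemma IsSymm.pull (hT : IsSymm T) (A : Matrix (Fin 3) (Fin 3) ℝ) : IsSymm (pull A T) := by
  rw [isSymm_iff_permute_eq] at *
  simp only [permute_pull, hT, implies_true]

lemma pull_mem_traceSpan (hT : T ∈ traceSpan h n) (A : Matrix (Fin 3) (Fin 3) ℝ) :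
    pull A T ∈ traceSpan (Aᵀ * h * A) n := by
  refine (Submodule.span_le (p := (traceSpan (Aᵀ * h * A) n).comap (pull A))).2 ?_ hT
  rintro T ⟨i, j, hij, W, hW, hTW⟩
  let rest : (Fin n → Fin 3) → Tensor n := fun a b =>
    (∏ m ∈ (Finset.univ.erase i).erase j, (A (b m) (a m) : ℂ)) * W b
  refine Submodule.subset_span ⟨i, j, hij, fun a => (3 ^ 2 : ℂ)⁻¹ * ∑ b, rest a b,
    fun a k l => ?_, fun a => ?_⟩
  · refine congrArg _ (Finset.sum_congr rfl fun b _ => congrArg (· * W b) ?_)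
    exact prod_erase_erase_update_update i j (fun m x => (A (b m) x : ℂ)) a k l
  have average := sum_sum_update_update_mul i j (W := rest a)
    (fun b => (A (b i) (a i) : ℂ) * A (b j) (a j) * h (b i) (b j)) fun b k l => by
      simp only [rest, hW, prod_erase_erase_update_update i j fun m x => ((A x (a m) : ℝ) : ℂ)]
  have congruence : ∑ k, ∑ l, (A k (a i) : ℂ) * A l (a j) * h k l = (Aᵀ * h * A) (a i) (a j) := by
    simp only [mul_apply, transpose_apply, Finset.sum_mul, Complex.ofReal_sum,
      Complex.ofReal_mul, mul_right_comm]
    exact Finset.sum_comm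
  simp only [update_self, update_of_ne hij, congruence, ← Finset.mul_sum] at average
  rw [mul_left_comm, average, Fintype.card_fin, Nat.cast_ofNat,
    inv_mul_cancel_left₀ (by norm_num), pull_apply]
  refine Finset.sum_congr rfl fun b _ => ?_
  rw [prod_eq_mul_mul_prod_erase_erase hij, hTW]
  ring

lemma IsTraceFree.pull (hT : IsTraceFree h T) {A : Matrix (Fin 3) (Fin 3) ℝ}
    (hA : IsUnit A.det) : IsTraceFree (Aᵀ * h * A) (pull A T) := by
  refine isTraceFree_iff_dotProduct_eq_zero.2 fun S hS => ?_
  rw [dotProduct_pull]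
  refine hT.dotProduct_eq_zero ?_
  have transform : Aᵀᵀ * (Aᵀ * h * A)⁻¹ * Aᵀ = h⁻¹ := by
    rw [transpose_transpose, Matrix.mul_inv_rev, Matrix.mul_inv_rev, mul_assoc,
      mul_assoc A⁻¹, mul_nonsing_inv_cancel_left _ _ hA, mul_assoc,
      nonsing_inv_mul _ (by rwa [det_transpose]), mul_one]
  exact transform ▸ pull_mem_traceSpan hS Aᵀ

lemma IsSTFPart.pull (hX : IsSTFPart h T X) {A : Matrix (Fin 3) (Fin 3) ℝ}
    (hA : IsUnit A.det) : IsSTFPart (Aᵀ * h * A) (pull A T) (pull A X) :=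
  ⟨hX.1.pull A, hX.2.1.pull hA, by
    rw [← pull_symm, ← map_sub]
    exact pull_mem_traceSpan hX.2.2 A⟩

lemma star_mem_traceSpan (hS : S ∈ traceSpan h n) : star S ∈ traceSpan h n := by
  induction hS using Submodule.span_induction with
  | mem S hS =>
    obtain ⟨i, j, hij, W, hW, hSW⟩ := hS
    refine Submodule.subset_span ⟨i, j, hij, star W, fun a k l => congrArg star (hW a k l),
      fun a => ?_⟩
    simp [hSW]
  | zero => simp
  | add S S' _ _ hS hS' => exact star_add S S' ▸ add_mem hS hS'
  | smul c S _ hS => exact star_smul c S ▸ Submodule.smul_mem _ _ hS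

open scoped ComplexOrder in
lemma IsTraceFree.eq_zero_of_mem_traceSpan_one (hX : IsTraceFree 1 X)
    (hX' : X ∈ traceSpan 1 n) : X = 0 :=
  dotProduct_star_self_eq_zero.1 <| hX.dotProduct_eq_zero (star_mem_traceSpan (by rwa [inv_one]))

lemma exists_isSTFPart_one (T : Tensor n) : ∃ X, IsSTFPart 1 T X := by
  let e := (WithLp.linearEquiv 2 ℂ (Tensor n)).symm
  obtain ⟨_, ⟨w, hw, rfl⟩, z, hz, hwz⟩ :=
    ((traceSpan 1 n).map e.toLinearMap).exists_add_mem_mem_orthogonal (e (symm T))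
  have sum_eq : symm T = w + e.symm z := by simpa using congrArg e.symm hwz
  have traceFree : IsTraceFree 1 (e.symm z) := by
    refine isTraceFree_of_dotProduct_eq_zero fun S hS => ?_
    rw [inv_one] at hS
    have := (Submodule.mem_orthogonal _ _).1 hz (e (star S)) ⟨_, star_mem_traceSpan hS, rfl⟩
    rw [EuclideanSpace.inner_eq_star_dotProduct, dotProduct_comm] at this
    exact (congrArg (· ⬝ᵥ e.symm z) (star_star S)).symm.trans this
  refine ⟨symm (e.symm z), isSymm_symm _, traceFree.symm, ?_⟩
  rw [← (isSymm_symm T).symm_eq, sum_eq, symm_add, add_sub_cancel_right]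
  exact symm_mem_traceSpan hw

lemma IsSTFPart.eq_of_one (hX : IsSTFPart 1 T X) (hY : IsSTFPart 1 T Y) : X = Y := by
  have mem := sub_mem hY.2.2 hX.2.2
  have traceFree := hX.2.1.add (hY.2.1.smul (-1))
  rw [sub_sub_sub_cancel_left] at mem
  rw [neg_one_smul, ← sub_eq_add_neg] at traceFree
  exact sub_eq_zero.1 (traceFree.eq_zero_of_mem_traceSpan_one mem)

lemma isSTFPart_stf_one (T : Tensor n) : IsSTFPart 1 T (stf 1 T) :=
  Classical.epsilon_spec (exists_isSTFPart_one T)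

/-- The symmetric trace-free part for the flat metric, as a linear map. -/
def stfOneₗ (n : ℕ) : Tensor n →ₗ[ℂ] Tensor n where
  toFun := stf 1
  map_add' T S := (isSTFPart_stf_one _).eq_of_one
    ((isSTFPart_stf_one T).add (isSTFPart_stf_one S))
  map_smul' c T := (isSTFPart_stf_one _).eq_of_one ((isSTFPart_stf_one T).smul c)

section TransposeMul

variable {E : Matrix (Fin 3) (Fin 3) ℝ}

lemma IsSTFPart.eq_of_transpose_mul (hE : IsUnit E.det) (hX : IsSTFPart (Eᵀ * E) T X)
    (hY : IsSTFPart (Eᵀ * E) T Y) : X = Y := by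
  have hE' : IsUnit E⁻¹.det := isUnit_nonsing_inv_det E hE
  have flat : E⁻¹ᵀ * (Eᵀ * E) * E⁻¹ = 1 := by
    rw [mul_assoc, mul_assoc, mul_nonsing_inv E hE, mul_one, ← transpose_mul,
      mul_nonsing_inv E hE, transpose_one]
  have eq_flat := IsSTFPart.eq_of_one (flat ▸ hX.pull hE') (flat ▸ hY.pull hE')
  simpa only [pull_pull, nonsing_inv_mul E hE, pull_one] using congrArg (Multipole.pull E) eq_flat

lemma isSTFPart_pull_stf_one (hE : IsUnit E.det) (T : Tensor n) :
    IsSTFPart (Eᵀ * E) T (pull E (stf 1 (pull E⁻¹ T))) := by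
  simpa only [pull_pull, nonsing_inv_mul E hE, pull_one, mul_one] using
    (isSTFPart_stf_one (pull E⁻¹ T)).pull hE

lemma isSTFPart_stf_transpose_mul (hE : IsUnit E.det) (T : Tensor n) :
    IsSTFPart (Eᵀ * E) T (stf (Eᵀ * E) T) :=
  Classical.epsilon_spec (⟨_, isSTFPart_pull_stf_one hE T⟩ : ∃ X, IsSTFPart _ T X)

lemma stf_transpose_mul_eq_pull (hE : IsUnit E.det) (T : Tensor n) :
    stf (Eᵀ * E) T = pull E (stf 1 (pull E⁻¹ T)) :=
  (isSTFPart_stf_transpose_mul hE T).eq_of_transpose_mul hE (isSTFPart_pull_stf_one hE T)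

end TransposeMul

/-- The full contraction `v^{a₁} ⋯ v^{aₙ} T_{a₁…aₙ}`. -/
def contract (T : Tensor n) (v : Fin 3 → ℂ) : ℂ := ∑ a, (∏ i, v (a i)) * T a

lemma contract_eq_dotProduct (T : Tensor n) (v : Fin 3 → ℂ) :
    contract T v = T ⬝ᵥ fun a => ∏ i, v (a i) :=
  Finset.sum_congr rfl fun _ _ => mul_comm _ _

lemma contract_symm (T : Tensor n) (v : Fin 3 → ℂ) : contract (symm T) v = contract T v := by
  have isSymm_prod : IsSymm fun a : Fin n → Fin 3 => ∏ i, v (a i) := fun σ a =>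
    Equiv.prod_comp σ fun i => v (a i)
  simp only [contract_eq_dotProduct]
  rw [← dotProduct_symm, isSymm_prod.symm_eq]

lemma IsSTFPart.contract_eq (hX : IsSTFPart h T X) {v : Fin 3 → ℂ}
    (hv : ∑ k, ∑ l, (h k l : ℂ) * v k * v l = 0) : contract X v = contract T v := by
  have orthogonal : (symm T - X) ⬝ᵥ (fun a => ∏ i, v (a i)) = 0 := by
    refine dotProduct_eq_zero_of_mem_traceSpan (fun i j hij a => ?_) hX.2.2
    simp only [prod_eq_mul_mul_prod_erase_erase hij, update_self, update_of_ne hij,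
      prod_erase_erase_update_update i j fun _ => v, ← mul_assoc, ← Finset.sum_mul, hv, zero_mul]
  rw [← contract_symm T, contract_eq_dotProduct, contract_eq_dotProduct, eq_comm, ← sub_eq_zero,
    ← sub_dotProduct, orthogonal]

end Tensors

/-! ### Smoothness of the Geroch–Hansen tensors -/

section Smooth

open Matrix

variable {U : Set Pt} {n : ℕ}

lemma contDiffOn_pderiv {E : Type*} [NormedAddCommGroup E] [NormedSpace ℝ E] (hU : IsOpen U)
    {g : Pt → E} (hg : ContDiffOn ℝ ∞ g U) (i : Fin 3) : ContDiffOn ℝ ∞ (pderiv i g) U :=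
  (hg.fderiv_of_isOpen hU (m := ∞) (by simp)).clm_apply contDiffOn_const

lemma contDiffOn_ofReal {g : Pt → ℝ} (hg : ContDiffOn ℝ ∞ g U) :
    ContDiffOn ℝ ∞ (fun p => (g p : ℂ)) U :=
  Complex.ofRealCLM.contDiff.comp_contDiffOn hg

lemma contDiffOn_inv_apply {A : Pt → Matrix (Fin 3) (Fin 3) ℝ}
    (hA : ∀ i j, ContDiffOn ℝ ∞ (fun p => A p i j) U) (hdet : ∀ p ∈ U, (A p).det ≠ 0)
    (i j : Fin 3) : ContDiffOn ℝ ∞ (fun p => (A p)⁻¹ i j) U := by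
  have hd : ContDiffOn ℝ ∞ (fun p => (A p).det) U := by
    simp only [det_fin_three]
    fun_prop (disch := exact hA _ _)
  simp only [inv_def, Ring.inverse_eq_inv', Matrix.smul_apply, smul_eq_mul]
  refine (hd.inv hdet).mul ?_
  simp only [adjugate_fin_three]
  fin_cases i <;> fin_cases j <;>
    simp only [Fin.mk_one, Fin.zero_eta, Fin.reduceFinMk, of_apply, cons_val', cons_val_zero,
      cons_val_one, cons_val, cons_val_fin_one] <;>
    fun_prop (disch := exact hA _ _)

lemma contDiffOn_pull {A : Pt → Matrix (Fin 3) (Fin 3) ℝ}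
    (hA : ∀ i j, ContDiffOn ℝ ∞ (fun p => A p i j) U) {T : Pt → Tensor n}
    (hT : ∀ a, ContDiffOn ℝ ∞ (fun p => T p a) U) (a : Fin n → Fin 3) :
    ContDiffOn ℝ ∞ (fun p => pull (A p) (T p) a) U := by
  simp only [pull_apply]
  exact ContDiffOn.sum fun _ _ => (contDiffOn_prod fun _ _ => contDiffOn_ofReal (hA _ _)).mul (hT _)

/-- The Cholesky factor of a positive definite `A`: the upper triangular matrix `E` with
`Eᵀ E = A` whose diagonal is positive. -/
def cholesky (A : Matrix (Fin 3) (Fin 3) ℝ) : Matrix (Fin 3) (Fin 3) ℝ :=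
  let a := √(A 0 0)
  let d := √((A 0 0 * A 1 1 - A 0 1 ^ 2) / A 0 0)
  !![a, A 0 1 / a, A 0 2 / a;
    0, d, (A 1 2 - A 0 1 * A 0 2 / A 0 0) / d;
    0, 0, √(A.det / (A 0 0 * A 1 1 - A 0 1 ^ 2))]

lemma minor_pos_of_posDef {A : Matrix (Fin 3) (Fin 3) ℝ} (hA : A.PosDef) :
    0 < A 0 0 * A 1 1 - A 0 1 ^ 2 := by
  have := (hA.submatrix (e := ![0, 1]) (by decide)).det_pos
  have s10 : A 1 0 = A 0 1 := hA.1.apply 0 1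
  rw [det_fin_two] at this
  simpa [s10, sq] using this

lemma isUnit_det_cholesky {A : Matrix (Fin 3) (Fin 3) ℝ} (hA : A.PosDef) :
    IsUnit (cholesky A).det := by
  have := hA.diag_pos (i := 0)
  have := minor_pos_of_posDef hA
  have := hA.det_pos
  rw [isUnit_iff_ne_zero, det_fin_three]
  simp only [cholesky, of_apply, cons_val', cons_val_zero, cons_val_one, cons_val, zero_mul,
    mul_zero, sub_zero, add_zero]
  positivity

lemma cholesky_transpose_mul {A : Matrix (Fin 3) (Fin 3) ℝ} (hA : A.PosDef) :
    (cholesky A)ᵀ * cholesky A = A := by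
  have h0 := hA.diag_pos (i := 0)
  have hm := minor_pos_of_posDef hA
  have hd := hA.det_pos
  have sq_a : A 0 0 = √(A 0 0) ^ 2 := (Real.sq_sqrt h0.le).symm
  have sq_d := (eq_div_iff h0.ne').1 (Real.sq_sqrt (div_nonneg hm.le h0.le))
  have sq_f := (eq_div_iff hm.ne').1 (Real.sq_sqrt (div_nonneg hd.le hm.le))
  have a_ne : √(A 0 0) ≠ 0 := by positivity
  have d_ne : √((A 0 0 * A 1 1 - A 0 1 ^ 2) / A 0 0) ≠ 0 := by positivity
  have s10 : A 1 0 = A 0 1 := hA.1.apply 0 1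
  have s20 : A 2 0 = A 0 2 := hA.1.apply 0 2
  have s21 : A 2 1 = A 1 2 := hA.1.apply 1 2
  have det_eq := det_fin_three A
  rw [s10, s20, s21] at det_eq
  rw [cholesky]
  generalize √(A.det / (A 0 0 * A 1 1 - A 0 1 ^ 2)) = f at *
  generalize √((A 0 0 * A 1 1 - A 0 1 ^ 2) / A 0 0) = d at *
  generalize √(A 0 0) = a at *
  ext i j
  rw [mul_apply, Fin.sum_univ_three]
  fin_cases i <;> fin_cases j <;> simp [s10, s20, s21] <;> field_simp <;> grind

lemma isSTFPart_stf {A : Matrix (Fin 3) (Fin 3) ℝ} (hA : A.PosDef) (T : Tensor n) :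
    IsSTFPart A T (stf A T) := by
  simpa only [cholesky_transpose_mul hA] using
    isSTFPart_stf_transpose_mul (isUnit_det_cholesky hA) T

variable {h : Pt → Matrix (Fin 3) (Fin 3) ℝ} {T : Pt → Tensor n}

lemma contDiffOn_cholesky (hh : IsSmoothMetricOn U h) (i j : Fin 3) :
    ContDiffOn ℝ ∞ (fun p => cholesky (h p) i j) U := by
  have diag_pos : ∀ p ∈ U, 0 < h p 0 0 := fun p hp => (hh.2 p hp).diag_pos
  have minor_pos := fun p hp => minor_pos_of_posDef (hh.2 p hp)
  have det_pos := fun p hp => (hh.2 p hp).det_pos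
  have hs := hh.1
  have minor_smooth : ContDiffOn ℝ ∞ (fun p => h p 0 0 * h p 1 1 - h p 0 1 ^ 2) U := by
    fun_prop (disch := exact hs _ _)
  have det_smooth : ContDiffOn ℝ ∞ (fun p => (h p).det) U := by
    simp only [det_fin_three]
    fun_prop (disch := exact hs _ _)
  have a_smooth := (hs 0 0).sqrt fun p hp => (diag_pos p hp).ne'
  have d_smooth := (minor_smooth.div (hs 0 0) fun p hp => (diag_pos p hp).ne').sqrt
    fun p hp => (div_pos (minor_pos p hp) (diag_pos p hp)).ne'
  have f_smooth := (det_smooth.div minor_smooth fun p hp => (minor_pos p hp).ne').sqrt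
    fun p hp => (div_pos (det_pos p hp) (minor_pos p hp)).ne'
  have a_ne : ∀ p ∈ U, √(h p 0 0) ≠ 0 := fun p hp => (Real.sqrt_pos.2 (diag_pos p hp)).ne'
  have e_smooth := (((hs 1 2).sub (((hs 0 1).mul (hs 0 2)).div (hs 0 0)
    fun p hp => (diag_pos p hp).ne'))).div d_smooth
    fun p hp => (Real.sqrt_pos.2 (div_pos (minor_pos p hp) (diag_pos p hp))).ne'
  fin_cases i <;> fin_cases j
  exacts [a_smooth, (hs 0 1).div a_smooth a_ne, (hs 0 2).div a_smooth a_ne, contDiffOn_const,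
    d_smooth, e_smooth, contDiffOn_const, contDiffOn_const, f_smooth]

lemma contDiffOn_stf (hh : IsSmoothMetricOn U h) (hT : ∀ a, ContDiffOn ℝ ∞ (fun p => T p a) U)
    (a : Fin n → Fin 3) : ContDiffOn ℝ ∞ (fun p => stf (h p) (T p) a) U := by
  have hE := contDiffOn_cholesky hh
  have hE' := contDiffOn_inv_apply hE fun p hp => (isUnit_det_cholesky (hh.2 p hp)).ne_zero
  have flat : ContDiffOn ℝ ∞ (fun p => stfOneₗ n (pull (cholesky (h p))⁻¹ (T p))) U :=
    ((stfOneₗ n).toContinuousLinearMap.restrictScalars ℝ).contDiff.comp_contDiffOn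
      (contDiffOn_pi.2 (contDiffOn_pull hE' hT))
  refine (contDiffOn_pull hE (contDiffOn_pi.1 flat) a).congr fun p hp => ?_
  have := stf_transpose_mul_eq_pull (isUnit_det_cholesky (hh.2 p hp)) (T p)
  rw [cholesky_transpose_mul (hh.2 p hp)] at this
  exact congrFun this a

lemma contDiffOn_christoffel (hU : IsOpen U) (hh : IsSmoothMetricOn U h) (k i j : Fin 3) :
    ContDiffOn ℝ ∞ (christoffel h k i j) U := by
  have metric_deriv := fun i j l => contDiffOn_pderiv hU (hh.1 i j) l
  exact contDiffOn_const.mul <| ContDiffOn.sum fun l _ =>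
    (contDiffOn_inv_apply hh.1 (fun p hp => (hh.2 p hp).det_pos.ne') k l).mul <|
      ((metric_deriv _ _ _).add (metric_deriv _ _ _)).sub (metric_deriv _ _ _)

lemma contDiffOn_ricci (hU : IsOpen U) (hh : IsSmoothMetricOn U h) (i j : Fin 3) :
    ContDiffOn ℝ ∞ (ricci h i j) U := by
  have hΓ := contDiffOn_christoffel hU hh
  exact (ContDiffOn.sum fun k _ => (contDiffOn_pderiv hU (hΓ _ _ _) _).sub
    (contDiffOn_pderiv hU (hΓ _ _ _) _)).add (ContDiffOn.sum fun k _ => ContDiffOn.sum fun l _ =>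
      ((hΓ _ _ _).mul (hΓ _ _ _)).sub ((hΓ _ _ _).mul (hΓ _ _ _)))

lemma contDiffOn_covD (hU : IsOpen U) (hh : IsSmoothMetricOn U h)
    (hT : ∀ a, ContDiffOn ℝ ∞ (fun p => T p a) U) (a : Fin (n + 1) → Fin 3) :
    ContDiffOn ℝ ∞ (fun p => covD h T p a) U :=
  (contDiffOn_pderiv hU (hT _) _).sub <| ContDiffOn.sum fun _ _ => ContDiffOn.sum fun _ _ =>
    (contDiffOn_ofReal (contDiffOn_christoffel hU hh _ _ _)).mul (hT _)

lemma contDiffOn_gerochHansen {φ : Pt → ℂ} (hU : IsOpen U) (hh : IsSmoothMetricOn U h)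
    (hφ : ContDiffOn ℝ ∞ φ U) (n : ℕ) :
    ∀ a, ContDiffOn ℝ ∞ (fun p => gerochHansen h φ n p a) U := by
  induction n using Nat.twoStepInduction with
  | zero => exact fun _ => hφ
  | one => exact contDiffOn_stf hh (contDiffOn_covD hU hh fun _ => hφ)
  | more n h0 h1 =>
    refine contDiffOn_stf hh fun a => (contDiffOn_covD hU hh h1 a).sub ?_
    exact (contDiffOn_const.mul (contDiffOn_ofReal (contDiffOn_ricci hU hh _ _))).mul (h0 _)

lemma isSymm_gerochHansen {p : Pt} (hp : (h p).PosDef) (φ : Pt → ℂ) :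
    ∀ n, IsSymm (gerochHansen h φ n p)
  | 0 => fun _ _ => rfl
  | 1 => (isSTFPart_stf hp _).1
  | _ + 2 => (isSTFPart_stf hp _).1

lemma isTraceFree_gerochHansen {p : Pt} (hp : (h p).PosDef) (φ : Pt → ℂ) :
    ∀ n, IsTraceFree (h p) (gerochHansen h φ n p)
  | 0 => fun i => i.elim0
  | 1 => (isSTFPart_stf hp _).2.1
  | _ + 2 => (isSTFPart_stf hp _).2.1

end Smooth

/-! ### The recursion contracted with a null vector -/

section Contraction

open Function

variable {n : ℕ} {v : Fin 3 → ℂ} {p : Pt}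

lemma contract_zero (T : Tensor 0) (v : Fin 3 → ℂ) : contract T v = T ![] := by
  simp [contract, Subsingleton.elim default ![]]

/-- The tensor `T_{m a₁ … aₙ}` in the indices `a₁, …, aₙ`. -/
def fixFirst (T : Tensor (n + 1)) (m : Fin 3) : Tensor n := fun b => T (Fin.cons m b)

lemma contract_succ (T : Tensor (n + 1)) (v : Fin 3 → ℂ) :
    contract T v = ∑ m, v m * contract (fixFirst T m) v := by
  simp only [contract, fixFirst, Finset.mul_sum, ← (Fin.consEquiv fun _ => Fin 3).sum_comp,
    Fintype.sum_prod_type]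
  simp [Fin.consEquiv, Fin.prod_univ_succ, mul_assoc]

lemma contract_sub (T X : Tensor n) (v : Fin 3 → ℂ) :
    contract (T - X) v = contract T v - contract X v := by
  simp only [contract_eq_dotProduct, sub_dotProduct]

lemma contract_smul (c : ℂ) (T : Tensor n) (v : Fin 3 → ℂ) :
    contract (c • T) v = c * contract T v := by
  simp only [contract_eq_dotProduct, smul_dotProduct, smul_eq_mul]

lemma contract_sum_mul_update (i : Fin n) (T : Tensor n) {G : Fin 3 → Fin 3 → ℂ} {c : ℂ}
    (hG : ∀ k, ∑ j, G k j * v j = c * v k) :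
    contract (fun b => ∑ k, G k (b i) * T (update b i k)) v = c * contract T v := by
  have prod_update : ∀ (b : Fin n → Fin 3) k,
      ∏ m, v (update b i k m) = v k * ∏ m ∈ Finset.univ.erase i, v (b m) := fun b k => by
    rw [← Finset.mul_prod_erase _ _ (Finset.mem_univ i), update_self]
    refine congrArg _ (Finset.prod_congr rfl fun m hm => ?_)
    rw [update_of_ne (Finset.mem_erase.1 hm).1]
  refine mul_left_cancel₀ (three_ne_zero (α := ℂ)) ?_
  have average := fun F => sum_sum_update (κ := Fin 3) (R := ℂ) i F
  simp only [Fintype.card_fin, Nat.cast_ofNat] at average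
  rw [mul_left_comm, contract, contract, ← average, ← average, Finset.mul_sum]
  refine Finset.sum_congr rfl fun b _ => ?_
  simp only [prod_update, update_idem, update_self, Finset.mul_sum]
  rw [Finset.sum_comm]
  refine Finset.sum_congr rfl fun k _ => ?_
  calc ∑ j, v j * (∏ m ∈ Finset.univ.erase i, v (b m)) * (G k j * T (update b i k))
      = (∑ j, G k j * v j) * ((∏ m ∈ Finset.univ.erase i, v (b m)) * T (update b i k)) := by
        rw [Finset.sum_mul]
        exact Finset.sum_congr rfl fun j _ => by ring
    _ = c * (v k * (∏ m ∈ Finset.univ.erase i, v (b m)) * T (update b i k)) := by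
        rw [hG]
        ring

/-- The derivative `v^i ∂_i g` of a function along a complex tangent vector. -/
def dirDeriv (v : Fin 3 → ℂ) (g : Pt → ℂ) (p : Pt) : ℂ := ∑ i, v i * pderiv i g p

lemma pderiv_contract {T : Pt → Tensor n} (hT : ∀ a, DifferentiableAt ℝ (fun q => T q a) p)
    (v : Fin 3 → ℂ) (i : Fin 3) :
    pderiv i (fun q => contract (T q) v) p
      = contract (fun a => pderiv i (fun q => T q a) p) v := by
  simp only [contract, pderiv]
  rw [fderiv_fun_sum fun a _ => (hT a).const_mul _]
  simp [fderiv_const_mul (hT _)]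

lemma contract_covD {h : Pt → Matrix (Fin 3) (Fin 3) ℝ} {T : Pt → Tensor n}
    (hT : ∀ a, DifferentiableAt ℝ (fun q => T q a) p) {c : ℂ}
    (hv : ∀ k, ∑ i, ∑ j, (christoffel h k i j p : ℂ) * v i * v j = c * v k) :
    contract (covD h T p) v
      = dirDeriv v (fun q => contract (T q) v) p - n * c * contract (T p) v := by
  let slot (i : Fin n) (G : Fin 3 → Fin 3 → ℂ) : Tensor n := fun b =>
    ∑ k, G k (b i) * T p (update b i k)
  have contract_slot : ∀ i, ∑ m, v m * contract (slot i fun k j => christoffel h k m j p) v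
      = c * contract (T p) v := fun i => by
    rw [← contract_sum_mul_update i (T p) (G := fun k j => ∑ m, v m * christoffel h k m j p)]
    · simp only [contract_eq_dotProduct, ← smul_eq_mul, ← smul_dotProduct, ← sum_dotProduct]
      congr 1
      ext b
      simp only [slot, Finset.sum_apply, Pi.smul_apply, smul_eq_mul, Finset.mul_sum,
        Finset.sum_mul, mul_assoc]
      exact Finset.sum_comm
    · intro k
      rw [← hv k, Finset.sum_comm]
      simp only [Finset.sum_mul, mul_comm (v _)]
  have contract_fixFirst : ∀ m, contract (fixFirst (covD h T p) m) v
      = pderiv m (fun q => contract (T q) v) p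
        - ∑ i, contract (slot i fun k j => christoffel h k m j p) v := fun m => by
    rw [pderiv_contract hT]
    simp only [contract_eq_dotProduct, ← sum_dotProduct, ← sub_dotProduct]
    congr 1
    ext b
    simp [fixFirst, covD, slot]
  simp only [contract_succ, contract_fixFirst, mul_sub, Finset.sum_sub_distrib, Finset.mul_sum]
  rw [Finset.sum_comm, Finset.sum_congr rfl fun i _ => contract_slot i]
  simp [dirDeriv, mul_assoc]

lemma contract_mul_mul_succ_succ (R : Fin 3 → Fin 3 → ℂ) (P : Tensor n) (v : Fin 3 → ℂ) :
    contract (n := n + 2) (fun a => R (a 0) (a 1) * P fun i => a i.succ.succ) v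
      = (∑ i, ∑ j, R i j * v i * v j) * contract P v := by
  simp only [contract_succ, Finset.mul_sum, Finset.sum_mul]
  refine Finset.sum_congr rfl fun i _ => Finset.sum_congr rfl fun j _ => ?_
  refine (congrArg (fun t => v i * (v j * t)) (contract_smul (R i j) P v)).trans ?_
  ring

-- The subtraction `n - 1` is truncated only for `n = 0`, where its coefficient vanishes.
lemma contract_gerochHansen_succ {U : Set Pt} {h : Pt → Matrix (Fin 3) (Fin 3) ℝ} {φ : Pt → ℂ}
    (hU : IsOpen U) (hh : IsSmoothMetricOn U h) (hφ : ContDiffOn ℝ ∞ φ U) (hp : p ∈ U) {c : ℂ}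
    (hnull : ∑ k, ∑ l, (h p k l : ℂ) * v k * v l = 0)
    (hv : ∀ k, ∑ i, ∑ j, (christoffel h k i j p : ℂ) * v i * v j = c * v k) (n : ℕ) :
    contract (gerochHansen h φ (n + 1) p) v
      = dirDeriv v (fun q => contract (gerochHansen h φ n q) v) p
        - n * c * contract (gerochHansen h φ n p) v
        - n * (2 * n - 1) / 2 * (∑ i, ∑ j, (ricci h i j p : ℂ) * v i * v j)
          * contract (gerochHansen h φ (n - 1) p) v := by
  have differentiable := fun a => ((contDiffOn_gerochHansen hU hh hφ n a).contDiffAt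
    (hU.mem_nhds hp)).differentiableAt (by simp)
  rw [← contract_covD differentiable hv]
  match n with
  | 0 => simpa [gerochHansen] using (isSTFPart_stf (hh.2 p hp) _).contract_eq hnull
  | n + 1 =>
    rw [mul_assoc, Nat.add_sub_cancel, ← contract_mul_mul_succ_succ fun i j => (ricci h i j p : ℂ),
      ← contract_smul, ← contract_sub]
    refine ((isSTFPart_stf (hh.2 p hp) _).contract_eq hnull).trans (congrArg (contract · v) ?_)
    ext a
    simp only [Pi.sub_apply, Pi.smul_apply, smul_eq_mul]
    push_cast
    ring

end Contraction

/-! ### The Raychaudhuri equation -/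

section Pderiv

variable {E : Type*} [NormedAddCommGroup E] [NormedSpace ℝ E] {f g : Pt → E} {p : Pt}

lemma pderiv_congr (hfg : f =ᶠ[nhds p] g) (i : Fin 3) : pderiv i f p = pderiv i g p := by
  rw [pderiv, pderiv, hfg.fderiv_eq]

lemma pderiv_ofReal {g : Pt → ℝ} (hg : DifferentiableAt ℝ g p) (i : Fin 3) :
    pderiv i (fun q => (g q : ℂ)) p = pderiv i g p := by
  have ofReal_deriv : HasFDerivAt (fun q => (g q : ℂ)) _ p :=
    Complex.ofRealCLM.hasFDerivAt.comp p hg.hasFDerivAt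
  rw [pderiv, ofReal_deriv.fderiv]
  rfl

lemma differentiableAt_ofReal {g : Pt → ℝ} (hg : DifferentiableAt ℝ g p) :
    DifferentiableAt ℝ (fun q => (g q : ℂ)) p :=
  Complex.ofRealCLM.differentiableAt.comp p hg

lemma pderiv_add (hf : DifferentiableAt ℝ f p) (hg : DifferentiableAt ℝ g p) (i : Fin 3) :
    pderiv i (fun q => f q + g q) p = pderiv i f p + pderiv i g p := by
  rw [pderiv, fderiv_fun_add hf hg]
  rfl

lemma pderiv_mul {A : Type*} [NormedCommRing A] [NormedAlgebra ℝ A] {f g : Pt → A}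
    (hf : DifferentiableAt ℝ f p) (hg : DifferentiableAt ℝ g p) (i : Fin 3) :
    pderiv i (fun q => f q * g q) p = pderiv i f p * g p + f p * pderiv i g p := by
  rw [pderiv, fderiv_fun_mul hf hg, add_comm]
  simp [pderiv, mul_comm]

lemma pderiv_sum {ι : Type*} {s : Finset ι} {g : ι → Pt → E}
    (hg : ∀ a ∈ s, DifferentiableAt ℝ (g a) p) (i : Fin 3) :
    pderiv i (fun q => ∑ a ∈ s, g a q) p = ∑ a ∈ s, pderiv i (g a) p := by
  rw [pderiv, fderiv_fun_sum hg]
  simp [pderiv]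

lemma pderiv_pderiv_comm (hg : ContDiffAt ℝ 2 g p) (i j : Fin 3) :
    pderiv i (pderiv j g) p = pderiv j (pderiv i g) p := by
  have differentiable : DifferentiableAt ℝ (fderiv ℝ g) p :=
    (hg.fderiv_right (m := 1) le_rfl).differentiableAt one_ne_zero
  have pderiv_pderiv : ∀ i j, pderiv i (pderiv j g) p
      = fderiv ℝ (fderiv ℝ g) p (Pi.single i 1) (Pi.single j 1) := fun i j => by
    change fderiv ℝ (fun q => fderiv ℝ g q (Pi.single j 1)) p _ = _
    rw [fderiv_clm_apply differentiable (differentiableAt_const _)]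
    simp
  rw [pderiv_pderiv, pderiv_pderiv]
  exact hg.isSymmSndFDerivAt (by simp) _ _

end Pderiv

section VectorFields

variable {U : Set Pt} {h : Pt → Matrix (Fin 3) (Fin 3) ℝ} {N : Pt → Fin 3 → ℂ} {p : Pt}

lemma christoffel_comm (hU : IsOpen U) (hh : IsSmoothMetricOn U h) (hp : p ∈ U) (k i j : Fin 3) :
    christoffel h k i j p = christoffel h k j i p := by
  have comm : ∀ l, pderiv l (fun q => h q i j) p = pderiv l (fun q => h q j i) p := fun l =>
    pderiv_congr (by filter_upwards [hU.mem_nhds hp] with q hq using (hh.2 q hq).1.apply j i) l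
  simp only [christoffel, comm, add_comm (pderiv i _ p)]

/-- The covariant derivative `D_i N^k` of a complex vector field. -/
def covDVec (h : Pt → Matrix (Fin 3) (Fin 3) ℝ) (N : Pt → Fin 3 → ℂ) (k i : Fin 3) (q : Pt) : ℂ :=
  pderiv i (fun x => N x k) q + ∑ j, christoffel h k i j q * N q j

lemma differentiableAt_pderiv {g : Pt → ℂ} (hg : ContDiffAt ℝ 2 g p) (i : Fin 3) :
    DifferentiableAt ℝ (pderiv i g) p :=
  ((hg.fderiv_right (m := 1) le_rfl).differentiableAt one_ne_zero).clm_apply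
    (differentiableAt_const _)

lemma differentiableAt_christoffel (hU : IsOpen U) (hh : IsSmoothMetricOn U h) (hp : p ∈ U)
    (k i j : Fin 3) : DifferentiableAt ℝ (christoffel h k i j) p :=
  ((contDiffOn_christoffel hU hh k i j).contDiffAt (hU.mem_nhds hp)).differentiableAt (by simp)

lemma differentiableAt_covDVec (hU : IsOpen U) (hh : IsSmoothMetricOn U h) (hp : p ∈ U)
    (hN : ∀ k, ContDiffAt ℝ 2 (fun q => N q k) p) (k i : Fin 3) :
    DifferentiableAt ℝ (covDVec h N k i) p :=
  (differentiableAt_pderiv (hN k) i).add <| DifferentiableAt.fun_sum fun j _ =>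
    (differentiableAt_ofReal (differentiableAt_christoffel hU hh hp k i j)).mul
      ((hN j).differentiableAt two_ne_zero)

lemma pderiv_covDVec (hU : IsOpen U) (hh : IsSmoothMetricOn U h) (hp : p ∈ U)
    (hN : ∀ k, ContDiffAt ℝ 2 (fun q => N q k) p) (l k i : Fin 3) :
    pderiv l (covDVec h N k i) p = pderiv l (pderiv i fun q => N q k) p
      + ∑ j, (pderiv l (christoffel h k i j) p * N p j
        + christoffel h k i j p * pderiv l (fun q => N q j) p) := by
  have hΓ := fun k i j => differentiableAt_ofReal (differentiableAt_christoffel hU hh hp k i j)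
  have hN' := fun j => (hN j).differentiableAt two_ne_zero
  have hΓN := fun j => (hΓ k i j).fun_mul (hN' j)
  refine (pderiv_add (differentiableAt_pderiv (hN k) i)
    (DifferentiableAt.fun_sum fun j _ => hΓN j) l).trans ?_
  rw [pderiv_sum fun j _ => hΓN j]
  simp only [pderiv_mul (hΓ k i _) (hN' _),
    pderiv_ofReal (differentiableAt_christoffel hU hh hp k i _)]

lemma sum_ricci_mul (hU : IsOpen U) (hh : IsSmoothMetricOn U h) (hp : p ∈ U)
    (hN : ∀ k, ContDiffAt ℝ 2 (fun q => N q k) p) (i : Fin 3) :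
    ∑ j, (ricci h j i p : ℂ) * N p j
      = ∑ k, (pderiv k (covDVec h N k i) p - pderiv i (covDVec h N k k) p)
        + ∑ k, ∑ l, (christoffel h k k l p * covDVec h N l i p
          - christoffel h l k i p * covDVec h N k l p) := by
  have Γ_comm := christoffel_comm hU hh hp
  have dΓ_comm : ∀ l k i j, pderiv l (christoffel h k i j) p = pderiv l (christoffel h k j i) p :=
    fun l k i j => pderiv_congr
      (by filter_upwards [hU.mem_nhds hp] with q hq using christoffel_comm hU hh hq k i j) l
  simp only [pderiv_covDVec hU hh hp hN, covDVec, ricci, pderiv_pderiv_comm (hN _) i,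
    Fin.sum_univ_three]
  push_cast
  simp only [Γ_comm, dΓ_comm]
  ring

/-- The contraction `D_k N^k` of the covariant derivative. -/
def divergence (h : Pt → Matrix (Fin 3) (Fin 3) ℝ) (N : Pt → Fin 3 → ℂ) (q : Pt) : ℂ :=
  ∑ k, covDVec h N k k q

theorem raychaudhuri (hU : IsOpen U) (hh : IsSmoothMetricOn U h) (hp : p ∈ U)
    (hN : ∀ k, ContDiffAt ℝ 2 (fun q => N q k) p) {c : Pt → ℂ} (hc : DifferentiableAt ℝ c p)
    (geodesic : ∀ᶠ q in nhds p, ∀ k, ∑ i, covDVec h N k i q * N q i = c q * N q k) :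
    ∑ i, ∑ j, (ricci h i j p : ℂ) * N p i * N p j
      = dirDeriv (N p) c p + c p * divergence h N p
        - ∑ k, ∑ i, covDVec h N k i p * covDVec h N i k p
        - dirDeriv (N p) (divergence h N) p := by
  have hN' := fun j => (hN j).differentiableAt two_ne_zero
  have hD := differentiableAt_covDVec hU hh hp hN
  have dgeodesic : ∀ k, ∑ i, (pderiv k (covDVec h N k i) p * N p i
      + covDVec h N k i p * pderiv k (fun q => N q i) p)
      = pderiv k c p * N p k + c p * pderiv k (fun q => N q k) p := fun k => by
    have := pderiv_congr (geodesic.mono fun q hq => hq k) k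
    rw [pderiv_sum fun i _ => (hD k i).fun_mul (hN' i), pderiv_mul hc (hN' k)] at this
    simpa only [pderiv_mul (hD k _) (hN' _)] using this
  have ddivergence : ∀ i, pderiv i (divergence h N) p = ∑ k, pderiv i (covDVec h N k k) p :=
    fun i => pderiv_sum (fun k _ => hD k k) i
  have christoffel_mul_geodesic : ∑ k, ∑ l, christoffel h k k l p * ∑ i, covDVec h N l i p * N p i
      = ∑ k, ∑ l, christoffel h k k l p * (c p * N p l) := by
    simp only [geodesic.self_of_nhds]
  have christoffel_mul_covDVec :
      ∑ k, ∑ l, (∑ i, christoffel h l k i p * N p i) * covDVec h N k l p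
        = ∑ k, ∑ l, (covDVec h N l k p - pderiv k (fun q => N q l) p) * covDVec h N k l p := by
    simp only [covDVec, add_sub_cancel_left]
  have mul_divergence : c p * divergence h N p
      = c p * ∑ k, (pderiv k (fun q => N q k) p + ∑ l, christoffel h k k l p * N p l) := rfl
  have ricci_mul := sum_ricci_mul hU hh hp hN
  simp only [mul_divergence]
  simp only [dirDeriv, ddivergence, Fin.sum_univ_three] at *
  linear_combination N p 0 * ricci_mul 0 + N p 1 * ricci_mul 1 + N p 2 * ricci_mul 2
    + dgeodesic 0 + dgeodesic 1 + dgeodesic 2 + christoffel_mul_geodesic - christoffel_mul_covDVec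

end VectorFields

/-! ### Axisymmetric metrics off the axis -/

/-- The unit covector `ρ dφ`, which with `dρ` and `dz` forms an orthonormal frame of the flat
metric. -/
def unitPhi (p : Pt) : Fin 3 → ℝ := ![-dRho p 1, dRho p 0, 0]

/-- The points of `U` that do not lie on the axis. -/
def offAxis (U : Set Pt) : Set Pt := {p ∈ U | rho p ≠ 0}

section Frame

variable {p : Pt}

lemma rho_sq (p : Pt) : rho p ^ 2 = p 0 ^ 2 + p 1 ^ 2 := Real.sq_sqrt (by positivity)

lemma isOpen_offAxis {U : Set Pt} (hU : IsOpen U) : IsOpen (offAxis U) := by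
  have continuous_rho : Continuous rho := by unfold rho; fun_prop
  exact hU.inter (isOpen_ne_fun continuous_rho continuous_const)

lemma frame_completeness (hp : rho p ≠ 0) (i j : Fin 3) :
    unitPhi p i * unitPhi p j + dRho p i * dRho p j + dZ i * dZ j
      = (1 : Matrix (Fin 3) (Fin 3) ℝ) i j := by
  fin_cases i <;> fin_cases j <;> simp [unitPhi, dRho, dZ] <;> field_simp <;>
    simp [rho_sq, add_comm]

lemma unitPhi_dotProduct_self (hp : rho p ≠ 0) : unitPhi p ⬝ᵥ unitPhi p = 1 := by
  simp only [unitPhi, dRho, dotProduct, Fin.sum_univ_three, Matrix.cons_val]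
  field_simp
  rw [rho_sq]
  ring

lemma unitPhi_dotProduct_dRho (p : Pt) : unitPhi p ⬝ᵥ dRho p = 0 := by
  simp only [unitPhi, dotProduct, Fin.sum_univ_three, Matrix.cons_val]
  ring

lemma rho_mul_dPhi (hp : rho p ≠ 0) (i : Fin 3) : rho p * dPhi p i = unitPhi p i := by
  fin_cases i <;> simp [dPhi, unitPhi, dRho] <;> field_simp

lemma contDiffAt_rho (hp : rho p ≠ 0) {n : ℕ∞} : ContDiffAt ℝ n rho p := by
  have : p 0 ^ 2 + p 1 ^ 2 ≠ 0 := by rwa [← rho_sq, ne_eq, sq_eq_zero_iff]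
  unfold rho
  exact ContDiffAt.sqrt (by fun_prop) this

lemma contDiffAt_dRho (hp : rho p ≠ 0) {n : ℕ∞} (k : Fin 3) :
    ContDiffAt ℝ n (fun q => dRho q k) p := by
  have := contDiffAt_rho hp (n := n)
  fin_cases k
  · exact ContDiffAt.div (by fun_prop) this hp
  · exact ContDiffAt.div (by fun_prop) this hp
  · exact contDiffAt_const

lemma pderiv_coord (i k : Fin 3) :
    pderiv i (fun q : Pt => q k) p = (1 : Matrix (Fin 3) (Fin 3) ℝ) i k := by
  rw [pderiv, (hasFDerivAt_apply k p).fderiv]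
  simp [Matrix.one_apply, Pi.single_apply, eq_comm]

lemma pderiv_rho (hp : rho p ≠ 0) (i : Fin 3) : pderiv i rho p = dRho p i := by
  have differentiable := (contDiffAt_rho hp (n := 1)).differentiableAt one_ne_zero
  have : pderiv i (fun q => rho q * rho q) p = pderiv i (fun q => q 0 * q 0 + q 1 * q 1) p := by
    simp only [← sq, rho_sq]
  rw [pderiv_mul differentiable differentiable, pderiv_add (by fun_prop) (by fun_prop),
    pderiv_mul (by fun_prop) (by fun_prop), pderiv_mul (by fun_prop) (by fun_prop)] at this
  simp only [pderiv_coord] at this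
  have rho_mul_dRho : rho p * dRho p i = (1 : Matrix (Fin 3) (Fin 3) ℝ) i 0 * p 0
      + (1 : Matrix (Fin 3) (Fin 3) ℝ) i 1 * p 1 := by
    match i with
    | 0 | 1 | 2 => simp [dRho, mul_div_cancel₀ _ hp]
  exact mul_left_cancel₀ hp (by linarith)

lemma pderiv_coord_div_rho (hp : rho p ≠ 0) (i k : Fin 3) :
    pderiv i (fun q => q k / rho q) p
      = ((1 : Matrix (Fin 3) (Fin 3) ℝ) i k - p k / rho p * dRho p i) / rho p := by
  have differentiable := (contDiffAt_rho hp (n := 1)).differentiableAt one_ne_zero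
  have mul_rho : (fun q : Pt => q k / rho q * rho q) =ᶠ[nhds p] fun q => q k := by
    filter_upwards [(isOpen_offAxis isOpen_univ).mem_nhds ⟨trivial, hp⟩] with q hq
      using div_mul_cancel₀ _ hq.2
  have := pderiv_congr mul_rho i
  rw [pderiv_mul (by fun_prop (disch := assumption)) differentiable, pderiv_rho hp,
    pderiv_coord] at this
  rw [eq_div_iff hp, ← this]
  ring

lemma pderiv_dRho (hp : rho p ≠ 0) (i k : Fin 3) :
    pderiv i (fun q => dRho q k) p = unitPhi p i * unitPhi p k / rho p := by
  match k with
  | 0 =>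
    refine (pderiv_coord_div_rho hp i 0).trans (congrArg (· / rho p) ?_)
    have frame : unitPhi p i * unitPhi p 0 + dRho p i * (p 0 / rho p) + dZ i * 0 = _ :=
      frame_completeness hp i 0
    linarith
  | 1 =>
    refine (pderiv_coord_div_rho hp i 1).trans (congrArg (· / rho p) ?_)
    have frame : unitPhi p i * unitPhi p 1 + dRho p i * (p 1 / rho p) + dZ i * 0 = _ :=
      frame_completeness hp i 1
    linarith
  | 2 => simp [pderiv, dRho, unitPhi]

lemma pderiv_unitPhi (hp : rho p ≠ 0) (i k : Fin 3) :
    pderiv i (fun q => unitPhi q k) p = -(unitPhi p i * dRho p k / rho p) := by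
  fin_cases k
  · refine (show _ = -pderiv i (fun q => dRho q 1) p from ?_).trans ?_
    · simp [pderiv, unitPhi, fderiv_fun_neg]
    · simp [pderiv_dRho hp, unitPhi]
  · refine (pderiv_dRho hp i 0).trans ?_
    simp [unitPhi, neg_div]
  · simp [pderiv, dRho, unitPhi]

end Frame

section Metric

open Matrix

variable {U : Set Pt} {h : Pt → Matrix (Fin 3) (Fin 3) ℝ} {β κ : Pt → ℝ} {p : Pt}

lemma fderiv_apply_eq_sum_pderiv {E : Type*} [NormedAddCommGroup E] [NormedSpace ℝ E]
    (g : Pt → E) (v : Pt) : fderiv ℝ g p v = ∑ i, v i • pderiv i g p := by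
  conv_lhs => rw [pi_eq_sum_univ' v]
  simp [pderiv]

lemma IsAxisymmetricOn.unitPhi_dotProduct_pderiv {g : Pt → ℝ} (hgs : IsAxisymmetricOn U g)
    (hU : IsOpen U) (hp : p ∈ offAxis U) (hg : DifferentiableAt ℝ g p) :
    unitPhi p ⬝ᵥ (fun i => pderiv i g p) = 0 := by
  let orbit : ℝ → Pt := fun t =>
    ![p 0 * Real.cos t - p 1 * Real.sin t, p 0 * Real.sin t + p 1 * Real.cos t, p 2]
  have orbit_zero : orbit 0 = p := by
    ext i
    fin_cases i <;> simp [orbit]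
  have deriv_orbit : HasDerivAt orbit ![-p 1, p 0, 0] 0 := by
    refine hasDerivAt_pi.2 fun i => ?_
    have cos := Real.hasDerivAt_cos 0
    have sin := Real.hasDerivAt_sin 0
    match i with
    | 0 => simpa [orbit] using (cos.const_mul (p 0)).fun_sub (sin.const_mul (p 1))
    | 1 => simpa [orbit] using (sin.const_mul (p 0)).fun_add (cos.const_mul (p 1))
    | 2 => exact hasDerivAt_const 0 (p 2)
  have rho_orbit : ∀ t, rho (orbit t) = rho p := fun t => by
    refine congrArg Real.sqrt ?_
    simp only [orbit, cons_val_zero, cons_val_one]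
    linear_combination (p 0 ^ 2 + p 1 ^ 2) * Real.sin_sq_add_cos_sq t
  have constant : g ∘ orbit =ᶠ[nhds 0] fun _ => g p := by
    have orbit_mem : ∀ᶠ t in nhds 0, orbit t ∈ U :=
      deriv_orbit.continuousAt.eventually_mem (by simpa only [orbit_zero] using hU.mem_nhds hp.1)
    filter_upwards [orbit_mem] with t ht using hgs _ ht _ hp.1 rfl (rho_orbit t)
  rw [← orbit_zero] at hg
  have deriv_zero := (hg.hasFDerivAt.comp_hasDerivAt 0 deriv_orbit).unique
    ((hasDerivAt_const 0 (g p)).congr_of_eventuallyEq constant)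
  have rotation : (![-p 1, p 0, 0] : Pt) = rho p • unitPhi p := by
    ext i
    fin_cases i <;> simp [unitPhi, dRho, mul_div_cancel₀ _ hp.2]
  rw [orbit_zero, rotation, map_smul, fderiv_apply_eq_sum_pderiv] at deriv_zero
  exact (smul_eq_zero.1 deriv_zero).resolve_left hp.2

lemma HasAxisymmetricForm.eq_smul (hform : HasAxisymmetricForm U h β κ) (hp : p ∈ offAxis U) :
    h p = Real.exp (2 * κ p) •
      (1 + (Real.exp (-2 * β p) - 1) • vecMulVec (unitPhi p) (unitPhi p)) := by
  ext i j
  rw [hform p hp.1 hp.2]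
  simp only [Matrix.smul_apply, Matrix.add_apply, vecMulVec_apply, smul_eq_mul, ← rho_mul_dPhi hp.2,
    ← frame_completeness hp.2 i j]
  ring

lemma pderiv_exp {g : Pt → ℝ} (hg : DifferentiableAt ℝ g p) (i : Fin 3) :
    pderiv i (fun q => Real.exp (g q)) p = Real.exp (g p) * pderiv i g p := by
  rw [pderiv, hg.hasFDerivAt.exp.fderiv]
  rfl

lemma pderiv_const_mul {A : Type*} [NormedRing A] [NormedAlgebra ℝ A] {g : Pt → A}
    (hg : DifferentiableAt ℝ g p) (c : A) (i : Fin 3) :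
    pderiv i (fun q => c * g q) p = c * pderiv i g p := by
  rw [pderiv, fderiv_const_mul hg]
  rfl

lemma pderiv_const_add {E : Type*} [NormedAddCommGroup E] [NormedSpace ℝ E] (c : E) (g : Pt → E)
    (i : Fin 3) : pderiv i (fun q => c + g q) p = pderiv i g p := by
  rw [pderiv, fderiv_const_add]
  rfl

lemma differentiableAt_dRho (hp : rho p ≠ 0) (k : Fin 3) :
    DifferentiableAt ℝ (fun q => dRho q k) p :=
  (contDiffAt_dRho hp (n := 1) k).differentiableAt one_ne_zero

lemma differentiableAt_unitPhi (hp : rho p ≠ 0) (k : Fin 3) :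
    DifferentiableAt ℝ (fun q => unitPhi q k) p := by
  fin_cases k
  · exact (differentiableAt_dRho hp 1).neg
  · exact differentiableAt_dRho hp 0
  · exact differentiableAt_const _

lemma pderiv_metric (hU : IsOpen U) (hform : HasAxisymmetricForm U h β κ) (hp : p ∈ offAxis U)
    (hβ : DifferentiableAt ℝ β p) (hκ : DifferentiableAt ℝ κ p) (l i j : Fin 3) :
    pderiv l (fun q => h q i j) p
      = 2 * pderiv l κ p * h p i j
        - Real.exp (2 * κ p) *
          (2 * pderiv l β p * Real.exp (-2 * β p) * unitPhi p i * unitPhi p j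
            + (Real.exp (-2 * β p) - 1) / rho p * unitPhi p l
              * (dRho p i * unitPhi p j + unitPhi p i * dRho p j)) := by
  have metric_eq : (fun q => h q i j) =ᶠ[nhds p] fun q => Real.exp (2 * κ q) *
      ((1 : Matrix (Fin 3) (Fin 3) ℝ) i j
        + (-1 + Real.exp (-2 * β q)) * (unitPhi q i * unitPhi q j)) := by
    filter_upwards [(isOpen_offAxis hU).mem_nhds hp] with q hq
    rw [hform.eq_smul hq, Matrix.smul_apply, Matrix.add_apply, Matrix.smul_apply, smul_eq_mul,
      smul_eq_mul, sub_eq_neg_add, vecMulVec_apply]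
  have hν := differentiableAt_unitPhi hp.2
  rw [pderiv_congr metric_eq, pderiv_mul (by fun_prop) (by fun_prop), pderiv_exp (by fun_prop),
    pderiv_const_mul hκ, pderiv_const_add, pderiv_mul (by fun_prop) (by fun_prop),
    pderiv_const_add, pderiv_exp (by fun_prop), pderiv_const_mul hβ, pderiv_mul (hν i) (hν j),
    pderiv_unitPhi hp.2, pderiv_unitPhi hp.2, show h p i j = _ from metric_eq.self_of_nhds]
  ring

lemma christoffel_eq_of_mulVec_eq (hp : (h p).PosDef) {i j : Fin 3} {C : Fin 3 → ℝ}
    (hC : h p *ᵥ C = fun l => 1 / 2 * (pderiv i (fun q => h q j l) p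
      + pderiv j (fun q => h q i l) p - pderiv l (fun q => h q i j) p)) (k : Fin 3) :
    christoffel h k i j p = C k := by
  have inv_mulVec : (h p)⁻¹ *ᵥ (h p *ᵥ C) = C := by
    rw [mulVec_mulVec, nonsing_inv_mul _ ((isUnit_iff_isUnit_det _).1 hp.isUnit), one_mulVec]
  rw [← inv_mulVec, hC, christoffel, mulVec, dotProduct, Finset.mul_sum]
  exact Finset.sum_congr rfl fun l _ => by ring

theorem christoffel_eq (hU : IsOpen U) (hh : IsSmoothMetricOn U h)
    (hform : HasAxisymmetricForm U h β κ) (hβs : IsAxisymmetricOn U β)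
    (hκs : IsAxisymmetricOn U κ) (hp : p ∈ offAxis U) (hβ : DifferentiableAt ℝ β p)
    (hκ : DifferentiableAt ℝ κ p) (k i j : Fin 3) :
    christoffel h k i j p
      = (pderiv i κ p • Pi.single j (1 : ℝ) + pderiv j κ p • Pi.single i (1 : ℝ)
        - ((1 : Matrix (Fin 3) (Fin 3) ℝ) i j
            + (Real.exp (-2 * β p) - 1) * unitPhi p i * unitPhi p j) • (fun k => pderiv k κ p)
        - (pderiv i β p * unitPhi p j + pderiv j β p * unitPhi p i) • unitPhi p
        + (unitPhi p i * unitPhi p j) • (Real.exp (-2 * β p) • (fun k => pderiv k β p)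
          - ((Real.exp (-2 * β p) - 1) / rho p) • dRho p) : Fin 3 → ℝ) k := by
  refine christoffel_eq_of_mulVec_eq (hh.2 p hp.1) ?_ k
  have hνκ := hκs.unitPhi_dotProduct_pderiv hU hp hκ
  have hνβ := hβs.unitPhi_dotProduct_pderiv hU hp hβ
  have single_eq : ∀ j l, (Pi.single j 1 : Fin 3 → ℝ) l = (1 : Matrix (Fin 3) (Fin 3) ℝ) j l :=
    fun j l => by rw [Matrix.one_apply, Pi.single_apply, if_congr eq_comm rfl rfl]
  ext l
  simp only [pderiv_metric hU hform hp hβ hκ, hform.eq_smul hp, smul_mulVec, add_mulVec,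
    vecMulVec_mulVec, one_mulVec, dotProduct_add, dotProduct_sub, dotProduct_smul, hνκ, hνβ,
    unitPhi_dotProduct_self hp.2, unitPhi_dotProduct_dRho, dotProduct_single, Pi.add_apply,
    Pi.sub_apply, Pi.smul_apply, Matrix.smul_apply, Matrix.add_apply, vecMulVec_apply, single_eq,
    smul_eq_mul, op_smul_eq_mul]
  ring

end Metric

section NullField

/-- An open set with a smooth metric of the axisymmetric form `e^{2κ} (ρ² e^{-2β} dφ² + dρ² + dz²)`
for axisymmetric `C²` functions `β` and `κ`. -/
structure IsAxisymmetricMetricOn (U : Set Pt) (h : Pt → Matrix (Fin 3) (Fin 3) ℝ)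
    (β κ : Pt → ℝ) : Prop where
  isOpen : IsOpen U
  isSmoothMetricOn : IsSmoothMetricOn U h
  hasAxisymmetricForm : HasAxisymmetricForm U h β κ
  contDiffOn_beta : ContDiffOn ℝ 2 β U
  contDiffOn_kappa : ContDiffOn ℝ 2 κ U
  beta_axisymmetric : IsAxisymmetricOn U β
  kappa_axisymmetric : IsAxisymmetricOn U κ

variable {U : Set Pt} {h : Pt → Matrix (Fin 3) (Fin 3) ℝ} {β κ : Pt → ℝ} {p : Pt}

lemma IsAxisymmetricMetricOn.contDiffAt_beta (H : IsAxisymmetricMetricOn U h β κ) (hp : p ∈ U) :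
    ContDiffAt ℝ 2 (fun q => (β q : ℂ)) p :=
  Complex.ofRealCLM.contDiff.contDiffAt.comp p
    (H.contDiffOn_beta.contDiffAt (H.isOpen.mem_nhds hp))

lemma IsAxisymmetricMetricOn.contDiffAt_kappa (H : IsAxisymmetricMetricOn U h β κ) (hp : p ∈ U) :
    ContDiffAt ℝ 2 (fun q => (κ q : ℂ)) p :=
  Complex.ofRealCLM.contDiff.contDiffAt.comp p
    (H.contDiffOn_kappa.contDiffAt (H.isOpen.mem_nhds hp))

lemma IsAxisymmetricMetricOn.differentiableAt_beta (H : IsAxisymmetricMetricOn U h β κ)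
    (hp : p ∈ U) : DifferentiableAt ℝ β p :=
  (H.contDiffOn_beta.contDiffAt (H.isOpen.mem_nhds hp)).differentiableAt two_ne_zero

lemma IsAxisymmetricMetricOn.differentiableAt_kappa (H : IsAxisymmetricMetricOn U h β κ)
    (hp : p ∈ U) : DifferentiableAt ℝ κ p :=
  (H.contDiffOn_kappa.contDiffAt (H.isOpen.mem_nhds hp)).differentiableAt two_ne_zero

lemma dirDeriv_ofReal {g : Pt → ℝ} (hg : DifferentiableAt ℝ g p) (v : Fin 3 → ℂ) :
    dirDeriv v (fun q => (g q : ℂ)) p = ∑ i, v i * pderiv i g p := by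
  simp only [dirDeriv, pderiv_ofReal hg]

lemma sum_christoffel_mul (H : IsAxisymmetricMetricOn U h β κ) (hp : p ∈ offAxis U)
    {v : Fin 3 → ℂ} (hv : ∑ j, unitPhi p j * v j = 0) (k i : Fin 3) :
    ∑ j, christoffel h k i j p * v j
      = pderiv i κ p * v k + dirDeriv v (fun q => (κ q : ℂ)) p * (1 : Matrix (Fin 3) (Fin 3) ℂ) k i
        - pderiv k κ p * v i - dirDeriv v (fun q => (β q : ℂ)) p * (unitPhi p i * unitPhi p k) := by
  have expand : ∀ j, (christoffel h k i j p * v j : ℂ)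
      = pderiv i κ p * (if k = j then v j else 0)
        + v j * pderiv j κ p * (if k = i then 1 else 0)
        - pderiv k κ p * (if i = j then v j else 0)
        - v j * pderiv j β p * (unitPhi p i * unitPhi p k)
        + (unitPhi p i * (Real.exp (-2 * β p) * pderiv k β p
            - (Real.exp (-2 * β p) - 1) / rho p * dRho p k
            - (Real.exp (-2 * β p) - 1) * pderiv k κ p)
          - pderiv i β p * unitPhi p k) * (unitPhi p j * v j) := fun j => by
    rw [christoffel_eq H.isOpen H.isSmoothMetricOn H.hasAxisymmetricForm H.beta_axisymmetric
      H.kappa_axisymmetric hp (H.differentiableAt_beta hp.1) (H.differentiableAt_kappa hp.1)]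
    simp only [Pi.add_apply, Pi.sub_apply, Pi.smul_apply, smul_eq_mul, Pi.single_apply,
      Matrix.one_apply]
    split_ifs <;> push_cast <;> ring
  simp only [expand, Finset.sum_add_distrib, Finset.sum_sub_distrib, ← Finset.mul_sum,
    ← Finset.sum_mul, Finset.sum_ite_eq, Finset.mem_univ, if_true, hv, mul_zero, add_zero,
    dirDeriv_ofReal (H.differentiableAt_beta hp.1),
    dirDeriv_ofReal (H.differentiableAt_kappa hp.1), Matrix.one_apply]

/-- The null vector field `∂_z - iσ ∂_ρ`, for `σ = ±1`. On the part `σρ > 0` of a meridian plane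
whose coordinate `ρ` may be negative it is constant. -/
def nullField (σ : ℝ) (p : Pt) : Fin 3 → ℂ := fun k => dZ k - Complex.I * σ * dRho p k

/-- The derivative along `nullField σ`. -/
def nullDeriv (σ : ℝ) (g : Pt → ℂ) (p : Pt) : ℂ := dirDeriv (nullField σ p) g p

variable {σ : ℝ}

lemma nullDeriv_ofReal {g : Pt → ℝ} (hg : DifferentiableAt ℝ g p) :
    nullDeriv σ (fun q => (g q : ℂ)) p = ∑ i, nullField σ p i * pderiv i g p :=
  dirDeriv_ofReal hg _

lemma sum_unitPhi_mul_nullField (σ : ℝ) (p : Pt) : ∑ j, unitPhi p j * nullField σ p j = 0 := by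
  simp only [nullField, unitPhi, dZ, Fin.sum_univ_three, Matrix.cons_val]
  push_cast
  ring

lemma sum_unitPhi_mul_self (hp : rho p ≠ 0) : ∑ j, (unitPhi p j * unitPhi p j : ℂ) = 1 := by
  exact_mod_cast unitPhi_dotProduct_self hp

lemma sum_nullField_mul_self (hσ : σ ^ 2 = 1) (hp : rho p ≠ 0) :
    ∑ j, nullField σ p j * nullField σ p j = 0 := by
  have norm_dRho : (dRho p 0 ^ 2 + dRho p 1 ^ 2 : ℂ) = 1 := by
    have := unitPhi_dotProduct_self hp
    simp only [unitPhi, dotProduct, Fin.sum_univ_three, Matrix.cons_val] at this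
    exact_mod_cast (by linarith : dRho p 0 ^ 2 + dRho p 1 ^ 2 = 1)
  have dRho_two : dRho p 2 = 0 := rfl
  have hσ' : (σ : ℂ) ^ 2 = 1 := mod_cast hσ
  simp only [nullField, dZ, dRho_two, Fin.sum_univ_three, Matrix.cons_val]
  push_cast
  linear_combination Complex.I ^ 2 * σ ^ 2 * norm_dRho + σ ^ 2 * Complex.I_sq - hσ'

lemma pderiv_nullField (hp : rho p ≠ 0) (i k : Fin 3) :
    pderiv i (fun q => nullField σ q k) p
      = -(Complex.I * σ / rho p) * (unitPhi p i * unitPhi p k) := by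
  have : (fun q => nullField σ q k) = fun q => dZ k + -(Complex.I * σ) * (dRho q k : ℂ) := by
    ext q
    rw [nullField]
    ring
  rw [this, pderiv_const_add,
    pderiv_const_mul (differentiableAt_ofReal (differentiableAt_dRho hp k)),
    pderiv_ofReal (differentiableAt_dRho hp k), pderiv_dRho hp]
  push_cast
  ring

lemma contDiffAt_nullField (hp : rho p ≠ 0) (k : Fin 3) :
    ContDiffAt ℝ 2 (fun q => nullField σ q k) p :=
  contDiffAt_const.sub (contDiffAt_const.mul
    (Complex.ofRealCLM.contDiff.contDiffAt.comp p (contDiffAt_dRho hp k)))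

theorem covDVec_nullField (H : IsAxisymmetricMetricOn U h β κ) (hp : p ∈ offAxis U) (k i : Fin 3) :
    covDVec h (nullField σ) k i p
      = pderiv i κ p * nullField σ p k - pderiv k κ p * nullField σ p i
        + nullDeriv σ (fun q => (κ q : ℂ)) p * (1 : Matrix (Fin 3) (Fin 3) ℂ) k i
        - (nullDeriv σ (fun q => (β q : ℂ)) p + Complex.I * σ / rho p)
          * (unitPhi p i * unitPhi p k) := by
  rw [covDVec, pderiv_nullField hp.2, sum_christoffel_mul H hp
    (sum_unitPhi_mul_nullField σ p), ← nullDeriv, ← nullDeriv]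
  ring

lemma sum_covDVec_nullField_mul (hσ : σ ^ 2 = 1) (H : IsAxisymmetricMetricOn U h β κ)
    (hp : p ∈ offAxis U) (k : Fin 3) :
    ∑ i, covDVec h (nullField σ) k i p * nullField σ p i
      = 2 * nullDeriv σ (fun q => (κ q : ℂ)) p * nullField σ p k := by
  have null := sum_nullField_mul_self hσ hp.2
  have orth := sum_unitPhi_mul_nullField σ p
  have one_mul_N : ∑ i, (1 : Matrix (Fin 3) (Fin 3) ℂ) k i * nullField σ p i = nullField σ p k :=
    congrFun (Matrix.one_mulVec (nullField σ p)) k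
  simp only [covDVec_nullField H hp]
  set x := nullDeriv σ (fun q => (κ q : ℂ)) p with hx
  rw [nullDeriv_ofReal (H.differentiableAt_kappa hp.1)] at hx
  simp only [Fin.sum_univ_three] at *
  linear_combination x * one_mul_N - (pderiv k κ p : ℝ) * null - nullField σ p k * hx
    - (nullDeriv σ (fun q => (β q : ℂ)) p + Complex.I * σ / rho p) * unitPhi p k * orth

lemma divergence_nullField (H : IsAxisymmetricMetricOn U h β κ) (hp : p ∈ offAxis U) :
    divergence h (nullField σ) p
      = 3 * nullDeriv σ (fun q => (κ q : ℂ)) p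
        - (nullDeriv σ (fun q => (β q : ℂ)) p + Complex.I * σ / rho p) := by
  have norm := sum_unitPhi_mul_self hp.2
  rw [Fin.sum_univ_three] at norm
  simp only [divergence, covDVec_nullField H hp, Fin.sum_univ_three,
    Matrix.one_apply_eq]
  linear_combination
    -(nullDeriv σ (fun q => (β q : ℂ)) p + Complex.I * σ / rho p) * norm

lemma sum_sq_of_null_of_unit {u N ν : Fin 3 → ℂ} {x t : ℂ} (null : ∑ i, N i * N i = 0)
    (unit : ∑ i, ν i * ν i = 1) (hx : ∑ i, N i * u i = x) {B : Fin 3 → Fin 3 → ℂ}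
    (hB : ∀ k i, B k i = u i * N k - u k * N i + x * (1 : Matrix (Fin 3) (Fin 3) ℂ) k i
      - t * (ν i * ν k)) :
    ∑ k, ∑ i, B k i * B i k = 5 * x ^ 2 - 2 * x * t + t ^ 2 := by
  simp only [hB, Fin.sum_univ_three, Matrix.one_apply_eq, Matrix.one_apply_ne, ne_eq,
    Fin.isValue, Fin.reduceEq, not_false_eq_true] at *
  linear_combination -2 * (u 0 ^ 2 + u 1 ^ 2 + u 2 ^ 2) * null
    + 2 * (x + (N 0 * u 0 + N 1 * u 1 + N 2 * u 2)) * hx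
    + (t ^ 2 * (ν 0 * ν 0 + ν 1 * ν 1 + ν 2 * ν 2 + 1) - 2 * x * t) * unit

section NullDeriv

variable {f g : Pt → ℂ}

lemma differentiableAt_nullDeriv (hg : ContDiffAt ℝ 2 g p) (hp : rho p ≠ 0) :
    DifferentiableAt ℝ (nullDeriv σ g) p :=
  DifferentiableAt.fun_sum (u := Finset.univ)
    (A := fun i q => nullField σ q i * pderiv i g q) fun i _ =>
    ((contDiffAt_nullField hp i).differentiableAt two_ne_zero).mul (differentiableAt_pderiv hg i)

lemma nullDeriv_congr (hfg : f =ᶠ[nhds p] g) : nullDeriv σ f p = nullDeriv σ g p := by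
  simp only [nullDeriv, dirDeriv, pderiv_congr hfg]

lemma nullDeriv_const_mul (hg : DifferentiableAt ℝ g p) (c : ℂ) :
    nullDeriv σ (fun q => c * g q) p = c * nullDeriv σ g p := by
  simp only [nullDeriv, dirDeriv, pderiv_const_mul hg, mul_left_comm, Finset.mul_sum]

lemma nullDeriv_sub (hf : DifferentiableAt ℝ f p) (hg : DifferentiableAt ℝ g p) :
    nullDeriv σ (fun q => f q - g q) p = nullDeriv σ f p - nullDeriv σ g p := by
  simp only [nullDeriv, dirDeriv, pderiv, fderiv_fun_sub hf hg, sub_apply,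
    mul_sub, Finset.sum_sub_distrib]

lemma nullDeriv_add (hf : DifferentiableAt ℝ f p) (hg : DifferentiableAt ℝ g p) :
    nullDeriv σ (fun q => f q + g q) p = nullDeriv σ f p + nullDeriv σ g p := by
  simp only [nullDeriv, dirDeriv, pderiv_add hf hg, mul_add, Finset.sum_add_distrib]

lemma nullDeriv_mul (hf : DifferentiableAt ℝ f p) (hg : DifferentiableAt ℝ g p) :
    nullDeriv σ (fun q => f q * g q) p = nullDeriv σ f p * g p + f p * nullDeriv σ g p := by
  simp only [nullDeriv, dirDeriv, pderiv_mul hf hg, mul_add, Finset.sum_add_distrib,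
    Finset.sum_mul, Finset.mul_sum, mul_assoc, mul_left_comm]

lemma nullDeriv_const (c : ℂ) : nullDeriv σ (fun _ => c) p = 0 := by
  simp [nullDeriv, dirDeriv, pderiv]

lemma nullDeriv_rho (σ : ℝ) (hp : rho p ≠ 0) :
    nullDeriv σ (fun q => (rho q : ℂ)) p = -(Complex.I * σ) := by
  have norm := sum_unitPhi_mul_self hp
  rw [nullDeriv_ofReal ((contDiffAt_rho hp (n := 1)).differentiableAt one_ne_zero)]
  simp only [pderiv_rho hp, nullField, unitPhi, dZ, dRho, Fin.sum_univ_three, Matrix.cons_val]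
    at norm ⊢
  push_cast at norm ⊢
  linear_combination -(Complex.I * σ) * norm

lemma differentiableAt_ofReal_rho (hp : rho p ≠ 0) : DifferentiableAt ℝ (fun q => (rho q : ℂ)) p :=
  differentiableAt_ofReal ((contDiffAt_rho hp (n := 1)).differentiableAt one_ne_zero)

lemma differentiableAt_const_div_rho (c : ℂ) (hp : rho p ≠ 0) :
    DifferentiableAt ℝ (fun q => c / rho q) p := by
  simpa only [div_eq_mul_inv] using ((differentiableAt_ofReal_rho hp).fun_inv
    (Complex.ofReal_ne_zero.2 hp)).const_mul c

lemma nullDeriv_div_rho (hσ : σ ^ 2 = 1) (hp : rho p ≠ 0) :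
    nullDeriv σ (fun q => Complex.I * σ / rho q) p = -(1 / (rho p : ℂ) ^ 2) := by
  have hρ : (rho p : ℂ) ≠ 0 := Complex.ofReal_ne_zero.2 hp
  have hσ' : (σ : ℂ) ^ 2 = 1 := mod_cast hσ
  have div_mul : (fun q => Complex.I * σ / rho q * rho q) =ᶠ[nhds p] fun _ => Complex.I * σ := by
    filter_upwards [(isOpen_offAxis isOpen_univ).mem_nhds ⟨trivial, hp⟩] with q hq
      using div_mul_cancel₀ _ (Complex.ofReal_ne_zero.2 hq.2)
  have := nullDeriv_congr (σ := σ) div_mul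
  rw [nullDeriv_mul (differentiableAt_const_div_rho _ hp) (differentiableAt_ofReal_rho hp),
    nullDeriv_rho σ hp,
    nullDeriv_const] at this
  field_simp at this ⊢
  linear_combination this + Complex.I ^ 2 * hσ' + Complex.I_sq

end NullDeriv

theorem sum_ricci_mul_nullField (hσ : σ ^ 2 = 1) (H : IsAxisymmetricMetricOn U h β κ)
    (hp : p ∈ offAxis U) :
    ∑ i, ∑ j, (ricci h i j p : ℂ) * nullField σ p i * nullField σ p j
      = nullDeriv σ (nullDeriv σ fun q => (β q : ℂ)) p - nullDeriv σ (fun q => (β q : ℂ)) p ^ 2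
        - 2 * (Complex.I * σ / rho p) * nullDeriv σ (fun q => (β q : ℂ)) p
        - nullDeriv σ (nullDeriv σ fun q => (κ q : ℂ)) p
        + nullDeriv σ (fun q => (κ q : ℂ)) p ^ 2 := by
  have dβ := differentiableAt_nullDeriv (σ := σ) (H.contDiffAt_beta hp.1) hp.2
  have dκ := differentiableAt_nullDeriv (σ := σ) (H.contDiffAt_kappa hp.1) hp.2
  have dρ := differentiableAt_const_div_rho (Complex.I * σ) hp.2
  have off_axis : ∀ᶠ q in nhds p, q ∈ offAxis U := (isOpen_offAxis H.isOpen).mem_nhds hp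
  have sum_sq := sum_sq_of_null_of_unit (sum_nullField_mul_self hσ hp.2)
    (sum_unitPhi_mul_self hp.2) (nullDeriv_ofReal (H.differentiableAt_kappa hp.1)).symm
    (covDVec_nullField (σ := σ) H hp)
  have nullDeriv_divergence : nullDeriv σ (divergence h (nullField σ)) p = _ :=
    nullDeriv_congr (off_axis.mono fun q hq => divergence_nullField H hq)
  rw [nullDeriv_sub (dκ.const_mul 3) (dβ.fun_add dρ), nullDeriv_const_mul dκ, nullDeriv_add dβ dρ,
    nullDeriv_div_rho hσ hp.2] at nullDeriv_divergence
  have := raychaudhuri H.isOpen H.isSmoothMetricOn hp.1 (contDiffAt_nullField hp.2)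
    (dκ.const_mul 2) (off_axis.mono fun q hq => sum_covDVec_nullField_mul hσ H hq)
  rw [this, sum_sq, divergence_nullField H hp]
  change nullDeriv σ _ p + _ - _ - nullDeriv σ _ p = _
  rw [nullDeriv_divergence, nullDeriv_const_mul dκ]
  have hρ : (rho p : ℂ) ≠ 0 := Complex.ofReal_ne_zero.2 hp.2
  have hσ' : (σ : ℂ) ^ 2 = 1 := mod_cast hσ
  field_simp
  linear_combination -Complex.I ^ 2 * hσ' - Complex.I_sq

lemma sum_metric_mul_nullField (hσ : σ ^ 2 = 1) (H : IsAxisymmetricMetricOn U h β κ)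
    (hp : p ∈ offAxis U) :
    ∑ k, ∑ l, (h p k l : ℂ) * nullField σ p k * nullField σ p l = 0 := by
  have null := sum_nullField_mul_self hσ hp.2
  have orth := sum_unitPhi_mul_nullField σ p
  simp only [H.hasAxisymmetricForm.eq_smul hp, Fin.sum_univ_three, Matrix.smul_apply,
    Matrix.add_apply, Matrix.vecMulVec_apply, smul_eq_mul, Matrix.one_apply_eq,
    Matrix.one_apply_ne, ne_eq, Fin.isValue, Fin.reduceEq, not_false_eq_true] at *
  push_cast
  linear_combination Complex.exp (2 * κ p) * null
    + Complex.exp (2 * κ p) * (Complex.exp (-2 * β p) - 1)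
      * (unitPhi p 0 * nullField σ p 0 + unitPhi p 1 * nullField σ p 1
        + unitPhi p 2 * nullField σ p 2) * orth

lemma sum_christoffel_mul_nullField (hσ : σ ^ 2 = 1) (H : IsAxisymmetricMetricOn U h β κ)
    (hp : p ∈ offAxis U) (k : Fin 3) :
    ∑ i, ∑ j, (christoffel h k i j p : ℂ) * nullField σ p i * nullField σ p j
      = 2 * nullDeriv σ (fun q => (κ q : ℂ)) p * nullField σ p k := by
  have geodesic := sum_covDVec_nullField_mul hσ H hp k
  have orth := sum_unitPhi_mul_nullField σ p
  simp only [covDVec, pderiv_nullField hp.2, Fin.sum_univ_three] at *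
  linear_combination geodesic + Complex.I * σ / rho p * unitPhi p k * orth

end NullField

/-! ### Hadamard's lemma for real-analytic functions -/

section Hadamard

open scoped ENNReal
open Set Topology

variable {E F : Type*} [NormedAddCommGroup E] [NormedSpace ℝ E] [NormedAddCommGroup F]
  [NormedSpace ℝ F]

lemma continuous_compContinuousLinearMap {n : ℕ} (p : E [×n]→L[ℝ] F) {A : ℝ → E →L[ℝ] E}
    (hA : Continuous A) : Continuous fun t => p.compContinuousLinearMap fun _ => A t :=
  ((ContinuousMultilinearMap.compContinuousLinearMapContinuousMultilinear ℝ
    (fun _ : Fin n => E) (fun _ : Fin n => E) F).cont.comp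
      (continuous_pi fun _ => hA)).clm_apply continuous_const

lemma norm_compContinuousLinearMap_le_of_norm_le_one {n : ℕ} (p : E [×n]→L[ℝ] F)
    {A : E →L[ℝ] E} (hA : ‖A‖ ≤ 1) : ‖p.compContinuousLinearMap fun _ => A‖ ≤ ‖p‖ :=
  (p.norm_compContinuousLinearMap_le _).trans <| mul_le_of_le_one_right (norm_nonneg _) <|
    Finset.prod_le_one (fun _ _ => norm_nonneg _) fun _ _ => hA

/-- The Taylor series at `0` of `x ↦ ∫₀¹ f (A t x) dt`, where `p` is the Taylor series of `f`. -/
def integralSeries (p : FormalMultilinearSeries ℝ E F) (A : ℝ → E →L[ℝ] E) :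
    FormalMultilinearSeries ℝ E F := fun n =>
  ∫ t in (0 : ℝ)..1, (p n).compContinuousLinearMap fun _ => A t

variable {A : ℝ → E →L[ℝ] E}

lemma norm_integralSeries_le (p : FormalMultilinearSeries ℝ E F)
    (hA : ∀ t ∈ Icc (0 : ℝ) 1, ‖A t‖ ≤ 1) (n : ℕ) : ‖integralSeries p A n‖ ≤ ‖p n‖ := by
  simpa [integralSeries] using
    intervalIntegral.norm_integral_le_of_norm_le_const (a := (0 : ℝ)) (b := 1) <|
    fun t ht => norm_compContinuousLinearMap_le_of_norm_le_one (p n)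
      (hA t (Ioc_subset_Icc_self (uIoc_of_le (zero_le_one' ℝ) ▸ ht)))

lemma radius_le_radius_integralSeries (p : FormalMultilinearSeries ℝ E F)
    (hA : ∀ t ∈ Icc (0 : ℝ) 1, ‖A t‖ ≤ 1) : p.radius ≤ (integralSeries p A).radius := by
  refine ENNReal.le_of_forall_nnreal_lt fun r hr => ?_
  obtain ⟨C, -, hC⟩ := p.norm_mul_pow_le_of_lt_radius hr
  exact (integralSeries p A).le_radius_of_bound C fun n =>
    (mul_le_mul_of_nonneg_right (norm_integralSeries_le p hA n) (by positivity)).trans (hC n)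

variable [CompleteSpace F]

lemma integralSeries_apply (p : FormalMultilinearSeries ℝ E F) (hA : Continuous A) (n : ℕ)
    (v : Fin n → E) : integralSeries p A n v = ∫ t in (0 : ℝ)..1, p n fun i => A t (v i) :=
  ((ContinuousMultilinearMap.apply ℝ (fun _ : Fin n => E) F v).intervalIntegral_comp_comm
    ((continuous_compContinuousLinearMap (p n) hA).intervalIntegrable 0 1)).symm

lemma analyticAt_integral_comp {f : E → F} (hf : AnalyticAt ℝ f 0) (hA : Continuous A)
    (hA1 : ∀ t ∈ Icc (0 : ℝ) 1, ‖A t‖ ≤ 1) :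
    AnalyticAt ℝ (fun x => ∫ t in (0 : ℝ)..1, f (A t x)) 0 := by
  obtain ⟨p, R, hp⟩ := hf
  refine ⟨integralSeries p A, R, hp.r_le.trans (radius_le_radius_integralSeries p hA1), hp.r_pos,
    fun {x} hx => ?_⟩
  simp only [zero_add, integralSeries_apply p hA]
  have norm_le : ∀ t ∈ uIoc (0 : ℝ) 1, ‖A t x‖ ≤ ‖x‖ := fun t ht =>
    ((A t).le_of_opNorm_le
      (hA1 t (Ioc_subset_Icc_self (uIoc_of_le (zero_le_one' ℝ) ▸ ht))) x).trans_eq (one_mul _)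
  refine intervalIntegral.hasSum_integral_of_dominated_convergence
    (fun n _ => ‖p n‖ * ‖x‖ ^ n) (fun n => ?_) (fun n => ?_) ?_ ?_ ?_
  · exact Continuous.aestronglyMeasurable <| (p n).cont.comp <|
      continuous_pi fun _ => hA.clm_apply continuous_const
  · refine Filter.Eventually.of_forall fun t ht => ((p n).le_opNorm _).trans ?_
    rw [Finset.prod_const, Finset.card_univ, Fintype.card_fin]
    gcongr
    exact norm_le t ht
  · refine Filter.Eventually.of_forall fun t _ => p.summable_norm_mul_pow (r := ‖x‖₊) ?_
    exact (by simpa [enorm] using hx : (‖x‖₊ : ℝ≥0∞) < R).trans_le hp.r_le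
  · exact continuous_const.intervalIntegrable _ _
  · refine Filter.Eventually.of_forall fun t ht => ?_
    have hmem : A t x ∈ Metric.eball (0 : E) R := by
      rw [Metric.mem_eball, edist_zero_right] at hx ⊢
      exact (enorm_le_iff_norm_le.2 (norm_le t ht)).trans_lt hx
    simpa using hp.hasSum hmem

/-- The linear map `(x, t) ↦ (x, s t)`. -/
def scaleSnd (E : Type*) [NormedAddCommGroup E] [NormedSpace ℝ E] (s : ℝ) :
    E × ℝ →L[ℝ] E × ℝ :=
  (ContinuousLinearMap.inl ℝ E ℝ).comp (ContinuousLinearMap.fst ℝ E ℝ) +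
    s • (ContinuousLinearMap.inr ℝ E ℝ).comp (ContinuousLinearMap.snd ℝ E ℝ)

@[simp] lemma scaleSnd_apply (s : ℝ) (w : E × ℝ) : scaleSnd E s w = (w.1, s * w.2) := by
  simp [scaleSnd]

lemma continuous_scaleSnd : Continuous (scaleSnd E) := by
  unfold scaleSnd
  fun_prop

lemma norm_scaleSnd_apply_le {s : ℝ} (hs : s ∈ Icc (0 : ℝ) 1) (w : E × ℝ) :
    ‖scaleSnd E s w‖ ≤ ‖w‖ := by
  rw [scaleSnd_apply, Prod.norm_def, Prod.norm_def, norm_mul, Real.norm_of_nonneg hs.1]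
  exact max_le_max le_rfl (mul_le_of_le_one_left (norm_nonneg _) hs.2)

lemma norm_scaleSnd_le {s : ℝ} (hs : s ∈ Icc (0 : ℝ) 1) : ‖scaleSnd E s‖ ≤ 1 :=
  ContinuousLinearMap.opNorm_le_bound _ zero_le_one fun w =>
    (norm_scaleSnd_apply_le hs w).trans_eq (one_mul _).symm

lemma hasDerivAt_scaleSnd (w : E × ℝ) (s : ℝ) :
    HasDerivAt (fun s => scaleSnd E s w) (w.2 • ((0 : E), (1 : ℝ))) s := by
  simpa using (hasDerivAt_const s w.1).prodMk ((hasDerivAt_id s).mul_const w.2)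

lemma smul_integral_fderiv_scaleSnd {g : E × ℝ → F} {w : E × ℝ}
    (hg : ∀ s ∈ Icc (0 : ℝ) 1, AnalyticAt ℝ g (scaleSnd E s w)) :
    w.2 • ∫ s in (0 : ℝ)..1, fderiv ℝ g (scaleSnd E s w) (0, 1) = g w - g (w.1, 0) := by
  rw [← uIcc_of_le (zero_le_one' ℝ)] at hg
  have g_deriv : ∀ s ∈ uIcc (0 : ℝ) 1, HasDerivAt (fun s => g (scaleSnd E s w))
      (w.2 • fderiv ℝ g (scaleSnd E s w) (0, 1)) s := fun s hs => by
    rw [← map_smul]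
    exact (hg s hs).differentiableAt.hasFDerivAt.comp_hasDerivAt s (hasDerivAt_scaleSnd w s)
  have deriv_continuous : ContinuousOn
      (fun s => w.2 • fderiv ℝ g (scaleSnd E s w) (0, 1)) (uIcc (0 : ℝ) 1) := fun s hs => by
    have := (hg s hs).fderiv.continuousAt.comp (f := fun s => scaleSnd E s w)
      (hasDerivAt_scaleSnd w s).continuousAt
    exact ((this.clm_apply continuousAt_const).const_smul w.2).continuousWithinAt
  rw [← intervalIntegral.integral_smul, intervalIntegral.integral_eq_sub_of_hasDerivAt g_deriv
    deriv_continuous.intervalIntegrable]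
  simp

/-- Hadamard's lemma: the quotient is `∫₀¹ ∂ₜ g (x, s t) ds`. -/
lemma exists_analyticAt_eq_smul_of_axis_eq_zero {g : E × ℝ → F} (hg : AnalyticAt ℝ g 0)
    (hg0 : ∀ᶠ x in 𝓝 (0 : E), g (x, 0) = 0) :
    ∃ q : E × ℝ → F, AnalyticAt ℝ q 0 ∧ ∀ᶠ w in 𝓝 0, g w = w.2 • q w := by
  have dg : AnalyticAt ℝ (fun w => fderiv ℝ g w (0, 1)) 0 :=
    ((ContinuousLinearMap.apply ℝ F ((0 : E), (1 : ℝ))).analyticAt _).comp hg.fderiv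
  refine ⟨_, analyticAt_integral_comp dg continuous_scaleSnd fun s hs => norm_scaleSnd_le hs, ?_⟩
  obtain ⟨ε, hε, hball⟩ := Metric.eventually_nhds_iff_ball.1 hg.eventually_analyticAt
  filter_upwards [Metric.ball_mem_nhds 0 hε,
    (continuous_fst.tendsto' (0 : E × ℝ) 0 rfl).eventually hg0] with w hw hw0
  rw [smul_integral_fderiv_scaleSnd fun s hs => hball _ ?_, hw0, sub_zero]
  exact mem_ball_zero_iff.2
    ((norm_scaleSnd_apply_le hs w).trans_lt (mem_ball_zero_iff.1 hw))

end Hadamard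

/-! ### Complexification -/

section Complexification

open Set Topology
open scoped NNReal ENNReal

/-- The complex-multilinear extension to `ℂ × ℂ` of a power series on `ℝ × ℝ`: each term is
expanded over the two coordinate directions in every argument. -/
def complexifySeries (p : FormalMultilinearSeries ℝ (ℝ × ℝ) ℂ) :
    FormalMultilinearSeries ℂ (ℂ × ℂ) ℂ := fun n => ∑ s : Finset (Fin n),
  ((ContinuousMultilinearMap.mkPiAlgebra ℂ (Fin n) ℂ).compContinuousLinearMap fun i =>
    if i ∈ s then ContinuousLinearMap.fst ℂ ℂ ℂ else ContinuousLinearMap.snd ℂ ℂ ℂ).smulRight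
      (p n (s.piecewise (fun _ => (1, 0)) fun _ => (0, 1)))

lemma complexifySeries_apply (p : FormalMultilinearSeries ℝ (ℝ × ℝ) ℂ) (n : ℕ)
    (v : Fin n → ℂ × ℂ) : complexifySeries p n v = ∑ s : Finset (Fin n),
      (∏ i, if i ∈ s then (v i).1 else (v i).2) *
        p n (s.piecewise (fun _ => (1, 0)) fun _ => (0, 1)) := by
  simp only [complexifySeries, sum_apply,
    ContinuousMultilinearMap.smulRight_apply,
    ContinuousMultilinearMap.compContinuousLinearMap_apply,
    ContinuousMultilinearMap.mkPiAlgebra_apply, smul_eq_mul]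
  refine Finset.sum_congr rfl fun s _ => congrArg (· * _) <| Finset.prod_congr rfl fun i _ => ?_
  split_ifs <;> rfl

lemma complexifySeries_ofReal (p : FormalMultilinearSeries ℝ (ℝ × ℝ) ℂ) (n : ℕ)
    (w : ℝ × ℝ) : complexifySeries p n (fun _ => ((w.1 : ℂ), (w.2 : ℂ))) = p n fun _ => w := by
  have expand : (fun _ : Fin n => w) =
      (fun _ => w.1 • ((1 : ℝ), (0 : ℝ))) + fun _ => w.2 • ((0 : ℝ), (1 : ℝ)) := by
    ext <;> simp
  rw [complexifySeries_apply, expand, ContinuousMultilinearMap.map_add_univ]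
  refine Finset.sum_congr rfl fun s _ => ?_
  have smul_basis : s.piecewise (fun _ => w.1 • ((1 : ℝ), (0 : ℝ)))
      (fun _ => w.2 • ((0 : ℝ), (1 : ℝ))) = fun i => (if i ∈ s then w.1 else w.2) •
        s.piecewise (fun _ => ((1 : ℝ), (0 : ℝ))) (fun _ => (0, 1)) i := by
    ext i <;> by_cases hi : i ∈ s <;> simp [hi]
  rw [smul_basis, ContinuousMultilinearMap.map_smul_univ, Complex.real_smul]
  simp [apply_ite Complex.ofReal]

lemma norm_complexifySeries_le (p : FormalMultilinearSeries ℝ (ℝ × ℝ) ℂ) (n : ℕ) :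
    ‖complexifySeries p n‖ ≤ 2 ^ n * ‖p n‖ := by
  refine ContinuousMultilinearMap.opNorm_le_bound (by positivity) fun v => ?_
  have norm_term : ∀ s : Finset (Fin n), ‖(∏ i, if i ∈ s then (v i).1 else (v i).2) *
      p n (s.piecewise (fun _ => (1, 0)) fun _ => (0, 1))‖ ≤ ‖p n‖ * ∏ i, ‖v i‖ := fun s => by
    rw [norm_mul, norm_prod, mul_comm]
    refine mul_le_mul ?_ (Finset.prod_le_prod (fun _ _ => norm_nonneg _) fun i _ => ?_)
      (by positivity) (norm_nonneg _)
    · refine ((p n).le_opNorm _).trans (mul_le_of_le_one_right (norm_nonneg _) ?_)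
      refine Finset.prod_le_one (fun _ _ => norm_nonneg _) fun i _ => ?_
      by_cases hi : i ∈ s <;> simp [hi, Prod.norm_def]
    · split_ifs
      exacts [norm_fst_le _, norm_snd_le _]
  rw [complexifySeries_apply]
  refine (norm_sum_le_of_le _ fun s _ => norm_term s).trans_eq ?_
  rw [Finset.sum_const, Finset.card_univ, Fintype.card_finset, Fintype.card_fin, nsmul_eq_mul]
  push_cast
  ring

lemma half_radius_le_radius_complexifySeries (p : FormalMultilinearSeries ℝ (ℝ × ℝ) ℂ) :
    p.radius / 2 ≤ (complexifySeries p).radius := by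
  refine ENNReal.le_of_forall_nnreal_lt fun r hr => ?_
  have two_mul_lt : ((2 * r : ℝ≥0) : ℝ≥0∞) < p.radius := by
    rw [ENNReal.lt_div_iff_mul_lt (by simp) (by simp)] at hr
    rwa [mul_comm, ENNReal.coe_mul, ENNReal.coe_ofNat]
  obtain ⟨C, -, hC⟩ := p.norm_mul_pow_le_of_lt_radius two_mul_lt
  refine (complexifySeries p).le_radius_of_bound C fun n => ?_
  calc ‖complexifySeries p n‖ * (r : ℝ) ^ n
      ≤ 2 ^ n * ‖p n‖ * (r : ℝ) ^ n := by gcongr; exact norm_complexifySeries_le p n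
    _ = ‖p n‖ * ((2 * r : ℝ≥0) : ℝ) ^ n := by push_cast; ring
    _ ≤ C := hC n

lemma mem_ball_zero_prod_iff {E : Type*} [SeminormedAddCommGroup E] {w : E × E} {δ : ℝ} :
    w ∈ Metric.ball 0 δ ↔ ‖w.1‖ < δ ∧ ‖w.2‖ < δ := by
  rw [mem_ball_zero_iff, Prod.norm_def, max_lt_iff]

lemma ofReal_mem_ball {w : ℝ × ℝ} {δ : ℝ} (hw : w ∈ Metric.ball 0 δ) :
    ((w.1 : ℂ), (w.2 : ℂ)) ∈ Metric.ball (0 : ℂ × ℂ) δ := by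
  rw [mem_ball_zero_prod_iff] at hw ⊢
  simpa using hw

lemma null_mem_ball {r δ : ℝ} (hr : |r| < δ) :
    ((r : ℂ), -Complex.I * (r : ℂ)) ∈ Metric.ball (0 : ℂ × ℂ) δ := by
  simp [hr]

/-- The function `g` extends holomorphically to the polydisc of radius `δ`. -/
def IsComplexifiable (δ : ℝ) (g : ℝ × ℝ → ℂ) : Prop :=
  ∃ G, IsComplexification δ g G

variable {δ ε r : ℝ} {f g : ℝ × ℝ → ℂ} {F G : ℂ × ℂ → ℂ}

lemma IsComplexification.mono (hG : IsComplexification δ g G) (hε : ε ≤ δ) :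
    IsComplexification ε g G :=
  ⟨hG.1.mono (Metric.ball_subset_ball hε), fun w hw => hG.2 w (Metric.ball_subset_ball hε hw)⟩

lemma IsComplexifiable.mono (hg : IsComplexifiable δ g) (hε : ε ≤ δ) : IsComplexifiable ε g :=
  hg.imp fun _ hG => hG.mono hε

lemma eventually_isComplexifiable (hg : AnalyticAt ℝ g 0) :
    ∀ᶠ δ in 𝓝 (0 : ℝ), IsComplexifiable δ g := by
  obtain ⟨p, R, hp⟩ := hg
  have radius_pos : 0 < (complexifySeries p).radius :=
    (ENNReal.div_pos hp.radius_pos.ne' (by simp)).trans_le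
      (half_radius_le_radius_complexifySeries p)
  obtain ⟨δ, hδ, hδ_lt⟩ := ENNReal.lt_iff_exists_nnreal_btwn.1 (lt_min radius_pos hp.r_pos)
  rw [lt_min_iff] at hδ_lt
  have hG := (complexifySeries p).hasFPowerSeriesOnBall radius_pos
  refine (eventually_le_nhds (by exact_mod_cast hδ : (0 : ℝ) < δ)).mono fun _ =>
    IsComplexifiable.mono ⟨(complexifySeries p).sum, fun w hw => ?_, fun w hw => ?_⟩
  · refine hG.analyticAt_of_mem (Metric.eball_subset_eball hδ_lt.1.le ?_)
    rwa [Metric.eball_coe]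
  · have sum_real := hp.hasSum (Metric.eball_subset_eball hδ_lt.2.le (by rwa [Metric.eball_coe]))
    have sum_complex := hG.hasSum (Metric.eball_subset_eball hδ_lt.1.le
      (by rw [Metric.eball_coe]; exact ofReal_mem_ball hw))
    simp only [complexifySeries_ofReal, zero_add] at sum_complex sum_real
    exact sum_complex.unique sum_real

lemma eqOn_zero_of_ofReal_eq_zero {f : ℂ → ℂ} (hf : AnalyticOnNhd ℂ f (Metric.ball 0 δ))
    (hf0 : ∀ x : ℝ, |x| < δ → f x = 0) : EqOn f 0 (Metric.ball 0 δ) := by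
  intro z hz
  have hδ : 0 < δ := Metric.pos_of_mem_ball hz
  have tendsto_ofReal : Filter.Tendsto ((↑) : ℝ → ℂ) (𝓝[≠] 0) (𝓝[≠] 0) :=
    (Complex.continuous_ofReal.tendsto' 0 0 rfl).inf <| by simp
  refine hf.eqOn_of_preconnected_of_frequently_eq analyticOnNhd_const
    (convex_ball 0 δ).isPreconnected (Metric.mem_ball_self hδ)
    (tendsto_ofReal.frequently (Filter.Eventually.frequently ?_)) hz
  filter_upwards [nhdsWithin_le_nhds (Metric.ball_mem_nhds (0 : ℝ) hδ)] with x hx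
  exact hf0 x (by simpa using hx)

lemma eqOn_zero_of_prod_ofReal_eq_zero (hG : AnalyticOnNhd ℂ G (Metric.ball 0 δ))
    (hG0 : ∀ w ∈ Metric.ball (0 : ℝ × ℝ) δ, G ((w.1 : ℂ), (w.2 : ℂ)) = 0) :
    EqOn G 0 (Metric.ball 0 δ) := by
  rintro ⟨z, ζ⟩ hw
  rw [mem_ball_zero_prod_iff] at hw
  refine eqOn_zero_of_ofReal_eq_zero (f := fun z => G (z, ζ)) (fun z hz => ?_) (fun x hx => ?_)
    (mem_ball_zero_iff.2 hw.1)
  · exact AnalyticAt.comp (f := fun z : ℂ => (z, ζ))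
      (hG (z, ζ) (mem_ball_zero_prod_iff.2 ⟨mem_ball_zero_iff.1 hz, hw.2⟩))
      (analyticAt_id.prod analyticAt_const)
  have norm_x : ‖(x : ℂ)‖ < δ := by simpa using hx
  refine eqOn_zero_of_ofReal_eq_zero (f := fun ζ => G (x, ζ)) (fun ζ hζ => ?_) (fun t ht => ?_)
    (mem_ball_zero_iff.2 hw.2)
  · exact AnalyticAt.comp (f := fun ζ : ℂ => ((x : ℂ), ζ))
      (hG (x, ζ) (mem_ball_zero_prod_iff.2 ⟨norm_x, mem_ball_zero_iff.1 hζ⟩))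
      (analyticAt_const.prod analyticAt_id)
  · exact hG0 (x, t) (mem_ball_zero_prod_iff.2 ⟨hx, ht⟩)

lemma IsComplexification.eqOn (hF : IsComplexification δ g F) (hG : IsComplexification δ g G) :
    EqOn F G (Metric.ball 0 δ) := fun _ hw =>
  sub_eq_zero.1 <| eqOn_zero_of_prod_ofReal_eq_zero (hF.1.sub hG.1)
    (fun x hx => sub_eq_zero.2 ((hF.2 x hx).trans (hG.2 x hx).symm)) hw

lemma IsComplexification.leadingOrder_eq (hG : IsComplexification δ g G) (hr : |r| < δ) :
    leadingOrder g r = G ((r : ℂ), -Complex.I * (r : ℂ)) := by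
  have H : ∃ G : ℂ × ℂ → ℂ, ∃ δ : ℝ, |r| < δ ∧ IsComplexification δ g G := ⟨G, δ, hr, hG⟩
  rw [leadingOrder, dif_pos H]
  obtain ⟨ε, hε, hF⟩ := H.choose_spec
  exact (hF.mono (min_le_left ε δ)).eqOn (hG.mono (min_le_right ε δ))
    (null_mem_ball (lt_min hε hr))

lemma IsComplexification.congr (hG : IsComplexification δ g G)
    (hfg : EqOn f g (Metric.ball 0 δ)) : IsComplexification δ f G :=
  ⟨hG.1, fun w hw => (hG.2 w hw).trans (hfg hw).symm⟩

lemma isComplexification_const (c : ℂ) : IsComplexification δ (fun _ => c) fun _ => c :=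
  ⟨analyticOnNhd_const, fun _ _ => rfl⟩

lemma isComplexification_snd : IsComplexification δ (fun w => (w.2 : ℂ)) Prod.snd :=
  ⟨fun _ _ => analyticAt_snd, fun _ _ => rfl⟩

lemma IsComplexification.sub (hF : IsComplexification δ f F) (hG : IsComplexification δ g G) :
    IsComplexification δ (f - g) (F - G) :=
  ⟨hF.1.sub hG.1, fun w hw => congrArg₂ (· - ·) (hF.2 w hw) (hG.2 w hw)⟩

lemma IsComplexification.mul (hF : IsComplexification δ f F) (hG : IsComplexification δ g G) :
    IsComplexification δ (f * g) (F * G) :=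
  ⟨hF.1.mul hG.1, fun w hw => congrArg₂ (· * ·) (hF.2 w hw) (hG.2 w hw)⟩

/-- The derivative `(∂_z - i ∂_ρ) g` on the meridian plane. -/
def etaDeriv (g : ℝ × ℝ → ℂ) (w : ℝ × ℝ) : ℂ :=
  fderiv ℝ g w (1, 0) - Complex.I * fderiv ℝ g w (0, 1)

lemma etaDeriv_congr {w : ℝ × ℝ} (hfg : f =ᶠ[𝓝 w] g) : etaDeriv f w = etaDeriv g w := by
  rw [etaDeriv, etaDeriv, hfg.fderiv_eq]

lemma IsComplexification.etaDeriv (hG : IsComplexification δ g G) :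
    IsComplexification δ (etaDeriv g) fun w => fderiv ℂ G w (1, -Complex.I) := by
  refine ⟨fun w hw => ((ContinuousLinearMap.apply ℂ ℂ ((1 : ℂ), -Complex.I)).analyticAt _).comp
    (hG.1 w hw).fderiv, fun w hw => ?_⟩
  let L : ℝ × ℝ →L[ℝ] ℂ × ℂ := Complex.ofRealCLM.prodMap Complex.ofRealCLM
  have hasFDerivAt_real :
      HasFDerivAt (fun x => G (L x)) (((fderiv ℂ G (L w)).restrictScalars ℝ).comp L) w :=
    ((hG.1 (L w) (ofReal_mem_ball hw)).differentiableAt.hasFDerivAt.restrictScalars ℝ).comp w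
      L.hasFDerivAt
  have eventuallyEq : g =ᶠ[𝓝 w] fun x => G (L x) := by
    filter_upwards [Metric.isOpen_ball.mem_nhds hw] with x hx using (hG.2 x hx).symm
  have eta_eq : ((1 : ℂ), -Complex.I) = L (1, 0) - Complex.I • L (0, 1) := by simp [L]
  rw [Multipole.etaDeriv, eventuallyEq.fderiv_eq, hasFDerivAt_real.fderiv, eta_eq]
  simp only [map_sub, map_smul]
  rfl

lemma IsComplexification.hasDerivAt_null (hG : IsComplexification δ g G) (hr : |r| < δ) :
    HasDerivAt (fun r : ℝ => G ((r : ℂ), -Complex.I * (r : ℂ)))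
      (leadingOrder (Multipole.etaDeriv g) r) r := by
  have null_deriv : HasDerivAt (fun t : ℂ => (t, -Complex.I * t)) (1, -Complex.I) (r : ℂ) := by
    simpa using (hasDerivAt_id (r : ℂ)).prodMk ((hasDerivAt_id (r : ℂ)).const_mul (-Complex.I))
  rw [hG.etaDeriv.leadingOrder_eq hr]
  exact ((hG.1 _ (null_mem_ball hr)).differentiableAt.hasFDerivAt.comp_hasDerivAt
    (r : ℂ) null_deriv).comp_ofReal

lemma IsComplexification.leadingOrder_eventuallyEq (hG : IsComplexification δ g G)
    (hr : r ∈ Ioo (-δ) δ) :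
    leadingOrder g =ᶠ[𝓝 r] fun r : ℝ => G ((r : ℂ), -Complex.I * (r : ℂ)) := by
  filter_upwards [isOpen_Ioo.mem_nhds hr] with t ht using hG.leadingOrder_eq (abs_lt.2 ht)

namespace IsComplexifiable

lemma congr (hg : IsComplexifiable δ g) (hfg : EqOn f g (Metric.ball 0 δ)) :
    IsComplexifiable δ f :=
  hg.imp fun _ hG => hG.congr hfg

lemma const (c : ℂ) : IsComplexifiable δ fun _ => c := ⟨_, isComplexification_const c⟩

lemma sub (hf : IsComplexifiable δ f) (hg : IsComplexifiable δ g) : IsComplexifiable δ (f - g) :=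
  let ⟨_, hF⟩ := hf; let ⟨_, hG⟩ := hg; ⟨_, hF.sub hG⟩

lemma mul (hf : IsComplexifiable δ f) (hg : IsComplexifiable δ g) : IsComplexifiable δ (f * g) :=
  let ⟨_, hF⟩ := hf; let ⟨_, hG⟩ := hg; ⟨_, hF.mul hG⟩

lemma etaDeriv (hg : IsComplexifiable δ g) : IsComplexifiable δ (etaDeriv g) :=
  let ⟨_, hG⟩ := hg; ⟨_, hG.etaDeriv⟩

lemma leadingOrder_congr (hg : IsComplexifiable δ g) (hfg : EqOn f g (Metric.ball 0 δ))
    (hr : r ∈ Ioo (-δ) δ) : leadingOrder f r = leadingOrder g r := by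
  obtain ⟨G, hG⟩ := hg
  rw [hG.leadingOrder_eq (abs_lt.2 hr), (hG.congr hfg).leadingOrder_eq (abs_lt.2 hr)]

lemma leadingOrder_sub (hf : IsComplexifiable δ f) (hg : IsComplexifiable δ g)
    (hr : r ∈ Ioo (-δ) δ) : leadingOrder (f - g) r = leadingOrder f r - leadingOrder g r := by
  obtain ⟨F, hF⟩ := hf
  obtain ⟨G, hG⟩ := hg
  rw [hF.leadingOrder_eq (abs_lt.2 hr), hG.leadingOrder_eq (abs_lt.2 hr),
    (hF.sub hG).leadingOrder_eq (abs_lt.2 hr), Pi.sub_apply]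

lemma leadingOrder_mul (hf : IsComplexifiable δ f) (hg : IsComplexifiable δ g)
    (hr : r ∈ Ioo (-δ) δ) : leadingOrder (f * g) r = leadingOrder f r * leadingOrder g r := by
  obtain ⟨F, hF⟩ := hf
  obtain ⟨G, hG⟩ := hg
  rw [hF.leadingOrder_eq (abs_lt.2 hr), hG.leadingOrder_eq (abs_lt.2 hr),
    (hF.mul hG).leadingOrder_eq (abs_lt.2 hr), Pi.mul_apply]

lemma deriv_leadingOrder (hg : IsComplexifiable δ g) (hr : r ∈ Ioo (-δ) δ) :
    deriv (leadingOrder g) r = leadingOrder (Multipole.etaDeriv g) r := by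
  obtain ⟨G, hG⟩ := hg
  rw [(hG.leadingOrder_eventuallyEq hr).deriv_eq]
  exact (hG.hasDerivAt_null (abs_lt.2 hr)).deriv

lemma deriv_deriv_leadingOrder (hg : IsComplexifiable δ g) (hr : r ∈ Ioo (-δ) δ) :
    deriv (deriv (leadingOrder g)) r
      = leadingOrder (Multipole.etaDeriv (Multipole.etaDeriv g)) r := by
  have eventuallyEq : deriv (leadingOrder g) =ᶠ[𝓝 r] leadingOrder (Multipole.etaDeriv g) := by
    filter_upwards [isOpen_Ioo.mem_nhds hr] with t ht using hg.deriv_leadingOrder ht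
  rw [eventuallyEq.deriv_eq, hg.etaDeriv.deriv_leadingOrder hr]

lemma analyticOnNhd_leadingOrder (hg : IsComplexifiable δ g) :
    AnalyticOnNhd ℝ (leadingOrder g) (Ioo (-δ) δ) := by
  obtain ⟨G, hG⟩ := hg
  intro r hr
  refine AnalyticAt.congr ?_ (hG.leadingOrder_eventuallyEq hr).symm
  exact AnalyticAt.comp (f := fun r : ℝ => ((r : ℂ), -Complex.I * (r : ℂ)))
    ((hG.1 _ (null_mem_ball (abs_lt.2 hr))).restrictScalars (𝕜 := ℝ))
    ((Complex.ofRealCLM.analyticAt r).prod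
      (analyticAt_const.mul (Complex.ofRealCLM.analyticAt r)))

end IsComplexifiable

lemma leadingOrder_const (c : ℂ) (r : ℝ) : leadingOrder (fun _ => c) r = c :=
  (isComplexification_const c).leadingOrder_eq (lt_add_one |r|)

lemma leadingOrder_snd (r : ℝ) : leadingOrder (fun w => (w.2 : ℂ)) r = -Complex.I * r :=
  isComplexification_snd.leadingOrder_eq (lt_add_one |r|)

lemma leadingOrder_zero (hg : IsComplexifiable δ g) (hδ : 0 < δ) :
    leadingOrder g 0 = g 0 := by
  obtain ⟨G, hG⟩ := hg
  rw [hG.leadingOrder_eq (by simpa using hδ)]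
  simpa using hG.2 0 (Metric.mem_ball_self hδ)

end Complexification

/-! ### Meridian planes -/

section MeridianPlane

open Set Matrix

/-- The half-planes `(ρ cos φ, ρ sin φ, z)` with `c = cos φ` and `s = sin φ`, where also `ρ < 0` is
allowed. -/
def planePt (c s : ℝ) : ℝ × ℝ →L[ℝ] Pt :=
  ContinuousLinearMap.pi ![c • ContinuousLinearMap.snd ℝ ℝ ℝ, s • ContinuousLinearMap.snd ℝ ℝ ℝ,
    ContinuousLinearMap.fst ℝ ℝ ℝ]

/-- The null vector `∂_z - i ∂_ρ` in the plane parametrized by `planePt c s`. -/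
def planeVec (c s : ℝ) : Fin 3 → ℂ := ![-Complex.I * c, -Complex.I * s, 1]

variable {c s R σ : ℝ} {w : ℝ × ℝ}

lemma planePt_apply (c s : ℝ) (w : ℝ × ℝ) : planePt c s w = ![c * w.2, s * w.2, w.1] := by
  ext i
  fin_cases i <;> rfl

lemma planePt_one_zero : ⇑(planePt 1 0) = meridian := by
  ext w i
  simp [planePt_apply, meridian]

lemma planeVec_one_zero : planeVec 1 0 = eta := by
  ext i
  fin_cases i <;> simp [planeVec, eta]

lemma rho_planePt (hcs : c ^ 2 + s ^ 2 = 1) (w : ℝ × ℝ) : rho (planePt c s w) = |w.2| := by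
  rw [← Real.sqrt_sq_eq_abs, rho]
  congr 1
  simp only [planePt_apply, cons_val_zero, cons_val_one]
  linear_combination w.2 ^ 2 * hcs

lemma planePt_mem_ball (hcs : c ^ 2 + s ^ 2 = 1) (hw : w ∈ Metric.ball 0 R) :
    planePt c s w ∈ Metric.ball (0 : Pt) R := by
  have hR : 0 < R := Metric.pos_of_mem_ball hw
  rw [mem_ball_zero_iff, Prod.norm_def, max_lt_iff] at hw
  have hc : |c| ≤ 1 := abs_le_one_iff_mul_self_le_one.2 (by nlinarith)
  have hs : |s| ≤ 1 := abs_le_one_iff_mul_self_le_one.2 (by nlinarith)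
  have norm_mul_le : ∀ a : ℝ, |a| ≤ 1 → ‖a * w.2‖ < R := fun a ha =>
    (norm_mul a w.2).trans_lt ((mul_le_of_le_one_left (norm_nonneg _) ha).trans_lt hw.2)
  rw [mem_ball_zero_iff, pi_norm_lt_iff hR, planePt_apply, Fin.forall_fin_succ,
    Fin.forall_fin_two]
  exact ⟨norm_mul_le c hc, norm_mul_le s hs, hw.1⟩

lemma planePt_mem_offAxis (hcs : c ^ 2 + s ^ 2 = 1) (hw : w ∈ Metric.ball 0 R) (hw' : w.2 ≠ 0) :
    planePt c s w ∈ offAxis (Metric.ball 0 R) :=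
  ⟨planePt_mem_ball hcs hw, by rwa [rho_planePt hcs, abs_ne_zero]⟩

lemma IsAxisymmetricOn.comp_planePt {E : Type*} {g : Pt → E}
    (hg : IsAxisymmetricOn (Metric.ball 0 R) g) (hcs : c ^ 2 + s ^ 2 = 1) :
    EqOn (g ∘ planePt c s) (g ∘ meridian) (Metric.ball 0 R) := by
  have h10 : (1 : ℝ) ^ 2 + 0 ^ 2 = 1 := by norm_num
  rw [← planePt_one_zero]
  exact fun w hw => hg _ (planePt_mem_ball hcs hw) _ (planePt_mem_ball h10 hw) rfl
    (by rw [rho_planePt hcs, rho_planePt h10])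

lemma abs_snd_eq (hσ : σ ^ 2 = 1) (hw : 0 < σ * w.2) : |w.2| = σ * w.2 :=
  (sq_eq_sq₀ (abs_nonneg _) hw.le).1 (by rw [sq_abs, mul_pow, hσ, one_mul])

lemma nullField_planePt (hcs : c ^ 2 + s ^ 2 = 1) (hσ : σ ^ 2 = 1) (hw : 0 < σ * w.2) :
    nullField σ (planePt c s w) = planeVec c s := by
  have cancel (a : ℝ) : σ * (a * w.2 / rho (planePt c s w)) = a := by
    rw [rho_planePt hcs, abs_snd_eq hσ hw, ← mul_div_assoc, mul_left_comm,
      mul_div_cancel_right₀ _ hw.ne']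
  have sigma_mul_dRho : ∀ k, σ * dRho (planePt c s w) k = ![c, s, 0] k := by
    have cancel_zero : σ * (planePt c s w 0 / rho (planePt c s w)) = c := cancel c
    have cancel_one : σ * (planePt c s w 1 / rho (planePt c s w)) = s := cancel s
    simp [Fin.forall_fin_succ, dRho, cancel_zero, cancel_one]
  ext k
  rw [nullField, mul_assoc, ← Complex.ofReal_mul, sigma_mul_dRho]
  fin_cases k <;> simp [dZ, planeVec]

lemma etaDeriv_comp_planePt {g : Pt → ℂ} (hg : DifferentiableAt ℝ g (planePt c s w)) :
    etaDeriv (g ∘ planePt c s) w = dirDeriv (planeVec c s) g (planePt c s w) := by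
  rw [etaDeriv, fderiv_comp w hg (planePt c s).differentiableAt, (planePt c s).fderiv]
  simp only [ContinuousLinearMap.comp_apply, fderiv_apply_eq_sum_pderiv, dirDeriv, planePt_apply,
    Fin.sum_univ_three, planeVec, cons_val_zero, cons_val_one, cons_val, mul_zero, mul_one,
    Complex.real_smul, Complex.ofReal_zero, Complex.ofReal_one]
  ring

lemma nullDeriv_planePt {g : Pt → ℂ} (hg : DifferentiableAt ℝ g (planePt c s w))
    (hcs : c ^ 2 + s ^ 2 = 1) (hσ : σ ^ 2 = 1) (hw : 0 < σ * w.2) :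
    nullDeriv σ g (planePt c s w) = etaDeriv (g ∘ planePt c s) w := by
  rw [nullDeriv, nullField_planePt hcs hσ hw, etaDeriv_comp_planePt hg]

lemma nullDeriv_nullDeriv_planePt {g : Pt → ℂ} (hg : ContDiffAt ℝ 2 g (planePt c s w))
    (hcs : c ^ 2 + s ^ 2 = 1) (hσ : σ ^ 2 = 1) (hw : 0 < σ * w.2) :
    nullDeriv σ (nullDeriv σ g) (planePt c s w) = etaDeriv (etaDeriv (g ∘ planePt c s)) w := by
  have hρ : rho (planePt c s w) ≠ 0 := by
    rw [rho_planePt hcs, abs_snd_eq hσ hw]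
    exact hw.ne'
  have eventually_pos : ∀ᶠ w' in 𝓝 w, 0 < σ * w'.2 :=
    (by fun_prop : Continuous fun w' : ℝ × ℝ => σ * w'.2).continuousAt.eventually_const_lt hw
  have eventually_differentiable : ∀ᶠ w' in 𝓝 w, DifferentiableAt ℝ g (planePt c s w') :=
    (planePt c s).continuous.continuousAt.eventually
      ((hg.eventually (by simp)).mono fun q hq => hq.differentiableAt two_ne_zero)
  rw [nullDeriv_planePt (differentiableAt_nullDeriv hg hρ) hcs hσ hw]
  refine etaDeriv_congr ?_
  filter_upwards [eventually_pos, eventually_differentiable] with w' hw' hg'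
    using nullDeriv_planePt hg' hcs hσ hw'

end MeridianPlane

section MeridianRecursion

open Set Matrix

variable {h : Pt → Matrix (Fin 3) (Fin 3) ℝ} {β κ : Pt → ℝ} {φ : Pt → ℂ} {c s R σ : ℝ}
  {w : ℝ × ℝ} {f g q : ℝ × ℝ → ℂ}

lemma etaDeriv_eqOn (hfg : EqOn f g (Metric.ball 0 R)) :
    EqOn (etaDeriv f) (etaDeriv g) (Metric.ball 0 R) := fun _ hw =>
  etaDeriv_congr (hfg.eventuallyEq_of_mem (Metric.isOpen_ball.mem_nhds hw))

lemma eqOn_ball_of_eqOn_off_axis {F : Type*} [TopologicalSpace F] [T2Space F] {f g : ℝ × ℝ → F}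
    (hf : ContinuousOn f (Metric.ball 0 R)) (hg : ContinuousOn g (Metric.ball 0 R))
    (hfg : ∀ w ∈ Metric.ball (0 : ℝ × ℝ) R, w.2 ≠ 0 → f w = g w) :
    EqOn f g (Metric.ball 0 R) := by
  have dense_off_axis : Dense {w : ℝ × ℝ | w.2 ≠ 0} := by
    have := dense_univ.prod (dense_compl_singleton (0 : ℝ)) (s := (univ : Set ℝ))
    rwa [univ_prod] at this
  refine EqOn.of_subset_closure (s := Metric.ball 0 R ∩ {w : ℝ × ℝ | w.2 ≠ 0})
    (fun w hw => hfg w hw.1 hw.2) hf hg inter_subset_left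
    (dense_off_axis.open_subset_closure_inter Metric.isOpen_ball)

lemma IsComplexifiable.continuousOn (hg : IsComplexifiable R g) :
    ContinuousOn g (Metric.ball 0 R) := by
  obtain ⟨G, hG⟩ := hg
  have continuous_ofReal : Continuous fun w : ℝ × ℝ => ((w.1 : ℂ), (w.2 : ℂ)) := by fun_prop
  exact (hG.1.continuousOn.comp continuous_ofReal.continuousOn fun w hw =>
    ofReal_mem_ball hw).congr fun w hw => (hG.2 w hw).symm

lemma contDiffOn_etaDeriv (hg : ContDiffOn ℝ ∞ g (Metric.ball 0 R)) :
    ContDiffOn ℝ ∞ (etaDeriv g) (Metric.ball 0 R) := by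
  have hg' := hg.fderiv_of_isOpen (m := ∞) Metric.isOpen_ball le_rfl
  exact (hg'.clm_apply contDiffOn_const).sub
    (contDiffOn_const.mul (hg'.clm_apply contDiffOn_const))

lemma IsAxisymmetricOn.comp_planePt_ofReal {g : Pt → ℝ}
    (hg : IsAxisymmetricOn (Metric.ball 0 R) g) (hcs : c ^ 2 + s ^ 2 = 1) :
    EqOn ((fun q => (g q : ℂ)) ∘ planePt c s) (onMeridian g) (Metric.ball 0 R) := fun _ hw =>
  congrArg Complex.ofReal (hg.comp_planePt hcs hw)

/-- The contraction `N^{a₁} ⋯ N^{aₙ} P_{a₁…aₙ}` with the null vector `N = ∂_z - i ∂_ρ` of an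
arbitrary meridian plane, as a function of `(z, ρ)`. -/
def planeFun (h : Pt → Matrix (Fin 3) (Fin 3) ℝ) (φ : Pt → ℂ) (c s : ℝ) (n : ℕ) (w : ℝ × ℝ) : ℂ :=
  contract (gerochHansen h φ n (planePt c s w)) (planeVec c s)

lemma planeFun_one_zero (n : ℕ) : planeFun h φ 1 0 n = fFun h φ n := by
  ext w
  rw [planeFun, planePt_one_zero, planeVec_one_zero, contract, fFun]

lemma contDiffOn_contract_gerochHansen {U : Set Pt} (hU : IsOpen U) (hh : IsSmoothMetricOn U h)
    (hφ : ContDiffOn ℝ ∞ φ U) (n : ℕ) (v : Fin 3 → ℂ) :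
    ContDiffOn ℝ ∞ (fun p => contract (gerochHansen h φ n p) v) U :=
  ContDiffOn.sum fun a _ => contDiffOn_const.mul (contDiffOn_gerochHansen hU hh hφ n a)

lemma contDiffOn_planeFun (hh : IsSmoothMetricOn (Metric.ball 0 R) h)
    (hφ : ContDiffOn ℝ ∞ φ (Metric.ball 0 R)) (hcs : c ^ 2 + s ^ 2 = 1) (n : ℕ) :
    ContDiffOn ℝ ∞ (planeFun h φ c s n) (Metric.ball 0 R) :=
  (contDiffOn_contract_gerochHansen Metric.isOpen_ball hh hφ n _).comp
    (planePt c s).contDiff.contDiffOn fun _ hw => planePt_mem_ball hcs hw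

/-- The null component `R_{ab} N^a N^b` of the Ricci tensor as a function of `(z, ρ)`, where `b` and
`k` stand for `β` and `κ` on the meridian plane and `q` for the quotient `(∂_z b - i ∂_ρ b) / ρ`. -/
def nullRicci (b k q : ℝ × ℝ → ℂ) : ℝ × ℝ → ℂ :=
  etaDeriv (etaDeriv b) - etaDeriv b * etaDeriv b - (fun _ => 2 * Complex.I) * q
    - (etaDeriv (etaDeriv k) - etaDeriv k * etaDeriv k)

lemma IsComplexifiable.nullRicci {b k : ℝ × ℝ → ℂ} (hb : IsComplexifiable R b)
    (hk : IsComplexifiable R k) (hq : IsComplexifiable R q) :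
    IsComplexifiable R (nullRicci b k q) :=
  ((hb.etaDeriv.etaDeriv.sub (hb.etaDeriv.mul hb.etaDeriv)).sub ((const _).mul hq)).sub
    (hk.etaDeriv.etaDeriv.sub (hk.etaDeriv.mul hk.etaDeriv))

lemma exists_sq_eq_one_mul_pos {x : ℝ} (hx : x ≠ 0) : ∃ σ : ℝ, σ ^ 2 = 1 ∧ 0 < σ * x :=
  hx.lt_or_gt.elim (fun h => ⟨-1, by norm_num, by linarith⟩) fun h => ⟨1, by norm_num, by linarith⟩

lemma IsAxisymmetricMetricOn.nullDeriv_kappa_planePt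
    (H : IsAxisymmetricMetricOn (Metric.ball 0 R) h β κ) (hcs : c ^ 2 + s ^ 2 = 1)
    (hw : w ∈ Metric.ball 0 R) (hσ : σ ^ 2 = 1) (hσw : 0 < σ * w.2) :
    nullDeriv σ (fun q => (κ q : ℂ)) (planePt c s w) = etaDeriv (onMeridian κ) w := by
  rw [nullDeriv_planePt ((H.contDiffAt_kappa (planePt_mem_ball hcs hw)).differentiableAt
    two_ne_zero) hcs hσ hσw]
  exact etaDeriv_eqOn (H.kappa_axisymmetric.comp_planePt_ofReal hcs) hw

lemma sum_ricci_mul_planeVec (H : IsAxisymmetricMetricOn (Metric.ball 0 R) h β κ)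
    (hcs : c ^ 2 + s ^ 2 = 1) (hw : w ∈ Metric.ball 0 R) (hw' : w.2 ≠ 0)
    (hq : etaDeriv (onMeridian β) w = w.2 * q w) :
    ∑ i, ∑ j, (ricci h i j (planePt c s w) : ℂ) * planeVec c s i * planeVec c s j
      = nullRicci (onMeridian β) (onMeridian κ) q w := by
  obtain ⟨σ, hσ, hσw⟩ := exists_sq_eq_one_mul_pos hw'
  have hp := planePt_mem_ball hcs hw
  have beta_eqOn := H.beta_axisymmetric.comp_planePt_ofReal hcs
  have kappa_eqOn := H.kappa_axisymmetric.comp_planePt_ofReal hcs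
  have div_rho_mul : Complex.I * σ / rho (planePt c s w) * etaDeriv (onMeridian β) w
      = Complex.I * q w := by
    have hσ0 : (σ : ℂ) ≠ 0 := mod_cast left_ne_zero_of_mul hσw.ne'
    have hw0 : (w.2 : ℂ) ≠ 0 := mod_cast hw'
    rw [rho_planePt hcs, abs_snd_eq hσ hσw, hq, Complex.ofReal_mul]
    field_simp
  have ricci_eq := sum_ricci_mul_nullField hσ H (planePt_mem_offAxis hcs hw hw')
  rw [nullField_planePt hcs hσ hσw, nullDeriv_nullDeriv_planePt (H.contDiffAt_beta hp) hcs hσ hσw,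
    nullDeriv_nullDeriv_planePt (H.contDiffAt_kappa hp) hcs hσ hσw,
    nullDeriv_planePt ((H.contDiffAt_beta hp).differentiableAt two_ne_zero) hcs hσ hσw,
    H.nullDeriv_kappa_planePt hcs hw hσ hσw, etaDeriv_eqOn (etaDeriv_eqOn beta_eqOn) hw,
    etaDeriv_eqOn beta_eqOn hw, etaDeriv_eqOn (etaDeriv_eqOn kappa_eqOn) hw] at ricci_eq
  rw [ricci_eq, nullRicci]
  simp only [Pi.sub_apply, Pi.mul_apply]
  linear_combination -2 * div_rho_mul

lemma planeFun_succ_of_ne_zero (H : IsAxisymmetricMetricOn (Metric.ball 0 R) h β κ)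
    (hφ : ContDiffOn ℝ ∞ φ (Metric.ball 0 R)) (hcs : c ^ 2 + s ^ 2 = 1)
    (hw : w ∈ Metric.ball 0 R) (hw' : w.2 ≠ 0) (hq : etaDeriv (onMeridian β) w = w.2 * q w)
    (n : ℕ) :
    planeFun h φ c s (n + 1) w = etaDeriv (planeFun h φ c s n) w
      - n * (2 * etaDeriv (onMeridian κ) w) * planeFun h φ c s n w
      - n * (2 * n - 1) / 2 * nullRicci (onMeridian β) (onMeridian κ) q w
        * planeFun h φ c s (n - 1) w := by
  obtain ⟨σ, hσ, hσw⟩ := exists_sq_eq_one_mul_pos hw'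
  have hp := planePt_mem_ball hcs hw
  have hp' := planePt_mem_offAxis hcs hw hw'
  have metric_eq := sum_metric_mul_nullField hσ H hp'
  have christoffel_eq := sum_christoffel_mul_nullField hσ H hp'
  simp only [nullField_planePt hcs hσ hσw, H.nullDeriv_kappa_planePt hcs hw hσ hσw]
    at metric_eq christoffel_eq
  have differentiableAt_contract := ((contDiffOn_contract_gerochHansen H.isOpen H.isSmoothMetricOn
    hφ n (planeVec c s)).contDiffAt (H.isOpen.mem_nhds hp)).differentiableAt (by simp)
  have dirDeriv_eq := etaDeriv_comp_planePt differentiableAt_contract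
  rw [planeFun, contract_gerochHansen_succ H.isOpen H.isSmoothMetricOn hφ hp metric_eq
    christoffel_eq, sum_ricci_mul_planeVec H hcs hw hw' hq, ← dirDeriv_eq]
  rfl

/-- The recursion of the contractions `f_n` on the disc of radius `R`, with `k'` in the place of
`∂_z κ - i ∂_ρ κ` and `M` in the place of the null component of the Ricci tensor. -/
def SatisfiesNullRecursion (R : ℝ) (k' M : ℝ × ℝ → ℂ) (f : ℕ → ℝ × ℝ → ℂ) : Prop :=
  ∀ n, EqOn (f (n + 1))
    (etaDeriv (f n) - (fun _ => 2 * (n : ℂ)) * (k' * f n)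
      - (fun _ => (n : ℂ) * (2 * n - 1) / 2) * (M * f (n - 1))) (Metric.ball 0 R)

lemma satisfiesNullRecursion_planeFun (H : IsAxisymmetricMetricOn (Metric.ball 0 R) h β κ)
    (hφ : ContDiffOn ℝ ∞ φ (Metric.ball 0 R)) (hb : IsComplexifiable R (onMeridian β))
    (hk : IsComplexifiable R (onMeridian κ)) (hq : IsComplexifiable R q)
    (hbq : ∀ w ∈ Metric.ball 0 R, etaDeriv (onMeridian β) w = w.2 * q w)
    (hcs : c ^ 2 + s ^ 2 = 1) :
    SatisfiesNullRecursion R (etaDeriv (onMeridian κ)) (nullRicci (onMeridian β) (onMeridian κ) q)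
      (planeFun h φ c s) := fun n => by
  have smooth := contDiffOn_planeFun H.isSmoothMetricOn hφ hcs
  refine eqOn_ball_of_eqOn_off_axis (smooth _).continuousOn ?_ fun w hw hw' => ?_
  · exact ((contDiffOn_etaDeriv (smooth n)).continuousOn.sub (continuousOn_const.mul
      (hk.etaDeriv.continuousOn.mul (smooth n).continuousOn))).sub (continuousOn_const.mul
        ((hb.nullRicci hk hq).continuousOn.mul (smooth (n - 1)).continuousOn))
  · rw [planeFun_succ_of_ne_zero H hφ hcs hw hw' (hbq w hw)]
    simp only [Pi.sub_apply, Pi.mul_apply]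
    ring

namespace SatisfiesNullRecursion

variable {k' M : ℝ × ℝ → ℂ} {f g : ℕ → ℝ × ℝ → ℂ}

lemma eqOn (hf : SatisfiesNullRecursion R k' M f) (hg : SatisfiesNullRecursion R k' M g)
    (h0 : EqOn (f 0) (g 0) (Metric.ball 0 R)) (n : ℕ) : EqOn (f n) (g n) (Metric.ball 0 R) := by
  induction n using Nat.strong_induction_on with
  | _ n ih =>
    cases n with
    | zero => exact h0
    | succ n =>
      intro w hw
      rw [hf n hw, hg n hw]
      simp only [Pi.sub_apply, Pi.mul_apply, etaDeriv_eqOn (ih n n.lt_succ_self) hw,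
        ih n n.lt_succ_self hw, ih (n - 1) (by omega) hw]

lemma isComplexifiable (hf : SatisfiesNullRecursion R k' M f) (hk : IsComplexifiable R k')
    (hM : IsComplexifiable R M) (h0 : IsComplexifiable R (f 0)) (n : ℕ) :
    IsComplexifiable R (f n) := by
  induction n using Nat.strong_induction_on with
  | _ n ih =>
    cases n with
    | zero => exact h0
    | succ n =>
      have hn := ih n n.lt_succ_self
      exact ((hn.etaDeriv.sub ((IsComplexifiable.const _).mul (hk.mul hn))).sub
        ((IsComplexifiable.const _).mul (hM.mul (ih (n - 1) (by omega))))).congr (hf n)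

lemma leadingOrder_succ (hf : SatisfiesNullRecursion R k' M f) (hk : IsComplexifiable R k')
    (hM : IsComplexifiable R M) (h0 : IsComplexifiable R (f 0)) (n : ℕ) {r : ℝ}
    (hr : r ∈ Ioo (-R) R) :
    leadingOrder (f (n + 1)) r
      = deriv (leadingOrder (f n)) r - 2 * n * (leadingOrder k' r * leadingOrder (f n) r)
        - n * (2 * n - 1) / 2 * (leadingOrder M r * leadingOrder (f (n - 1)) r) := by
  have hn := hf.isComplexifiable hk hM h0
  have const := IsComplexifiable.const (δ := R)
  have hkn := hk.mul (hn n)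
  have hMn := hM.mul (hn (n - 1))
  have main := (hn n).etaDeriv.sub ((const (2 * n)).mul hkn)
  rw [(main.sub ((const _).mul hMn)).leadingOrder_congr (hf n) hr,
    main.leadingOrder_sub ((const _).mul hMn) hr,
    (hn n).etaDeriv.leadingOrder_sub ((const _).mul hkn) hr, (const _).leadingOrder_mul hkn hr,
    (const _).leadingOrder_mul hMn hr, hk.leadingOrder_mul (hn n) hr,
    hM.leadingOrder_mul (hn (n - 1)) hr, leadingOrder_const, leadingOrder_const,
    (hn n).deriv_leadingOrder hr]

end SatisfiesNullRecursion

lemma leadingOrder_nullRicci {b k : ℝ × ℝ → ℂ} (hb : IsComplexifiable R b)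
    (hk : IsComplexifiable R k) (hq : IsComplexifiable R q)
    (hbq : ∀ w ∈ Metric.ball 0 R, etaDeriv b w = w.2 * q w) {r : ℝ} (hr : r ∈ Ioo (-R) R)
    (hr0 : r ≠ 0) :
    leadingOrder (nullRicci b k q) r
      = deriv (deriv (leadingOrder b)) r - deriv (leadingOrder b) r ^ 2
        + 2 / (r : ℂ) * deriv (leadingOrder b) r - deriv (deriv (leadingOrder k)) r
        + deriv (leadingOrder k) r ^ 2 := by
  have const := IsComplexifiable.const (δ := R) (2 * Complex.I)
  have hbb := hb.etaDeriv.mul hb.etaDeriv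
  have hkk := hk.etaDeriv.mul hk.etaDeriv
  have deriv_eq : deriv (leadingOrder b) r = -Complex.I * r * leadingOrder q r := by
    have hsnd : IsComplexifiable R fun w => (w.2 : ℂ) := ⟨_, isComplexification_snd⟩
    rw [hb.deriv_leadingOrder hr, (hsnd.mul hq).leadingOrder_congr hbq hr,
      hsnd.leadingOrder_mul hq hr, leadingOrder_snd]
  have div_mul_deriv : 2 / (r : ℂ) * deriv (leadingOrder b) r
      = -(2 * Complex.I) * leadingOrder q r := by
    have : (r : ℂ) ≠ 0 := mod_cast hr0
    rw [deriv_eq]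
    field_simp
  rw [div_mul_deriv, hb.deriv_deriv_leadingOrder hr, hk.deriv_deriv_leadingOrder hr,
    hb.deriv_leadingOrder hr, hk.deriv_leadingOrder hr, nullRicci,
    ((hb.etaDeriv.etaDeriv.sub hbb).sub (const.mul hq)).leadingOrder_sub
      (hk.etaDeriv.etaDeriv.sub hkk) hr,
    (hb.etaDeriv.etaDeriv.sub hbb).leadingOrder_sub (const.mul hq) hr,
    hb.etaDeriv.etaDeriv.leadingOrder_sub hbb hr, hk.etaDeriv.etaDeriv.leadingOrder_sub hkk hr,
    const.leadingOrder_mul hq hr, hb.etaDeriv.leadingOrder_mul hb.etaDeriv hr,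
    hk.etaDeriv.leadingOrder_mul hk.etaDeriv hr, leadingOrder_const]
  ring

end MeridianRecursion

/-! ### The symmetry axis -/

section Axis

open Set Matrix

variable {h : Pt → Matrix (Fin 3) (Fin 3) ℝ} {β κ : Pt → ℝ} {c s R z : ℝ} {w : ℝ × ℝ}

lemma vecMulVec_unitPhi_planePt (hcs : c ^ 2 + s ^ 2 = 1) (hw : w.2 ≠ 0) :
    vecMulVec (unitPhi (planePt c s w)) (unitPhi (planePt c s w))
      = vecMulVec ![-s, c, 0] ![-s, c, 0] := by
  obtain ⟨σ, hσ, hσw⟩ := exists_sq_eq_one_mul_pos hw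
  have unitPhi_eq : unitPhi (planePt c s w) = σ • ![-s, c, 0] := by
    have cancel (a : ℝ) : a * w.2 / rho (planePt c s w) = σ * a := by
      rw [rho_planePt hcs, abs_snd_eq hσ hσw, div_eq_iff hσw.ne']
      linear_combination -(a * w.2) * hσ
    have cancel_zero : planePt c s w 0 / rho (planePt c s w) = σ * c := cancel c
    have cancel_one : planePt c s w 1 / rho (planePt c s w) = σ * s := cancel s
    simp [unitPhi, dRho, cancel_zero, cancel_one]
  rw [unitPhi_eq, smul_vecMulVec, vecMulVec_smul, smul_smul, ← sq, hσ, one_smul]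

namespace IsAxisymmetricMetricOn

variable (H : IsAxisymmetricMetricOn (Metric.ball 0 R) h β κ)
include H

lemma metric_planePt (hcs : c ^ 2 + s ^ 2 = 1) :
    EqOn (h ∘ planePt c s) (fun w => Real.exp (2 * κ (planePt c s w)) •
      (1 + (Real.exp (-2 * β (planePt c s w)) - 1) • vecMulVec ![-s, c, 0] ![-s, c, 0]))
      (Metric.ball 0 R) := by
  have mapsTo : MapsTo (planePt c s) (Metric.ball 0 R) (Metric.ball 0 R) := fun _ hw =>
    planePt_mem_ball hcs hw
  have continuousOn_plane := (planePt c s).continuous.continuousOn (s := Metric.ball 0 R)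
  refine eqOn_ball_of_eqOn_off_axis ?_ ?_ fun w hw hw' => ?_
  · refine ContinuousOn.comp ?_ continuousOn_plane mapsTo
    exact continuousOn_pi.2 fun i => continuousOn_pi.2 fun j =>
      (H.isSmoothMetricOn.1 i j).continuousOn
  · have continuousOn_beta := H.contDiffOn_beta.continuousOn.comp continuousOn_plane mapsTo
    have continuousOn_kappa := H.contDiffOn_kappa.continuousOn.comp continuousOn_plane mapsTo
    exact (continuousOn_const.mul continuousOn_kappa).rexp.smul (continuousOn_const.add
      (((continuousOn_const.mul continuousOn_beta).rexp.sub continuousOn_const).smul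
        continuousOn_const))
  · rw [Function.comp_apply, H.hasAxisymmetricForm.eq_smul (planePt_mem_offAxis hcs hw hw'),
      vecMulVec_unitPhi_planePt hcs hw']

/-- On the axis all the meridian planes meet, so the metric coefficient along `∂_φ` in one plane is
the coefficient along `∂_ρ` in another one. -/
lemma beta_axis (hz : |z| < R) : β (meridian (z, 0)) = 0 := by
  have hw : ((z, 0) : ℝ × ℝ) ∈ Metric.ball 0 R := by simpa [Prod.norm_def] using hz
  have plane_zero := congrFun₂ (H.metric_planePt (c := 1) (s := 0) (by norm_num) hw) 0 0
  have plane_one := congrFun₂ (H.metric_planePt (c := 0) (s := 1) (by norm_num) hw) 0 0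
  have apply_eq : ∀ c s, planePt c s (z, 0) = meridian (z, 0) := fun c s => by
    simp [planePt_apply, meridian]
  simp only [Function.comp_apply, apply_eq] at plane_zero plane_one
  simpa [plane_zero] using plane_one

lemma metric_zero (hR : 0 < R) (hκ0 : κ 0 = 0) : h 0 = 1 := by
  have hβ0 := H.beta_axis (abs_zero.trans_lt hR)
  have := H.metric_planePt (c := 1) (s := 0) (by norm_num) (Metric.mem_ball_self hR)
  rw [← planePt_one_zero, Prod.mk_zero_zero, map_zero] at hβ0
  simpa [hκ0, hβ0] using this

/-- The null vectors of opposite half-planes have the sum `2 ∂_z`, which is tangent to the axis. -/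
lemma etaDeriv_onMeridian_beta_axis (hz : |z| < R) : etaDeriv (onMeridian β) (z, 0) = 0 := by
  have hw : ((z, 0) : ℝ × ℝ) ∈ Metric.ball 0 R := by simpa [Prod.norm_def] using hz
  have apply_eq : ∀ c w, planePt c 0 (w, 0) = meridian (w, 0) := fun c w => by
    simp [planePt_apply, meridian]
  have differentiableAt_beta : ∀ c, DifferentiableAt ℝ (fun q => (β q : ℂ)) (planePt c 0 (z, 0)) :=
    fun c => by
      rw [apply_eq, ← apply_eq 1]
      exact (H.contDiffAt_beta (planePt_mem_ball (by norm_num) hw)).differentiableAt two_ne_zero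
  have dirDeriv_planeVec : ∀ c, c ^ 2 + 0 ^ 2 = (1 : ℝ) →
      dirDeriv (planeVec c 0) (fun q => (β q : ℂ)) (meridian (z, 0))
        = etaDeriv (onMeridian β) (z, 0) := fun c hc => by
    rw [← apply_eq c, ← etaDeriv_comp_planePt (differentiableAt_beta c)]
    exact etaDeriv_eqOn (H.beta_axisymmetric.comp_planePt_ofReal hc) hw
  have dirDeriv_axis : dirDeriv (planeVec 0 0) (fun q => (β q : ℂ)) (meridian (z, 0)) = 0 := by
    have beta_eqOn : EqOn ((fun q => (β q : ℂ)) ∘ planePt 0 0) (fun _ => 0) (Metric.ball 0 R) := by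
      intro w hw
      have hw1 : |w.1| < R := (norm_fst_le w).trans_lt (mem_ball_zero_iff.1 hw)
      have : planePt 0 0 w = meridian (w.1, 0) := by simp [planePt_apply, meridian]
      rw [Function.comp_apply, this, H.beta_axis hw1, Complex.ofReal_zero]
    rw [← apply_eq 0, ← etaDeriv_comp_planePt (differentiableAt_beta 0),
      etaDeriv_eqOn beta_eqOn hw]
    simp [etaDeriv]
  have opposite := dirDeriv_planeVec (-1) (by norm_num)
  rw [← dirDeriv_planeVec 1 (by norm_num)] at opposite ⊢
  simp only [dirDeriv, planeVec, Fin.sum_univ_three, cons_val, Complex.ofReal_zero,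
    Complex.ofReal_one, Complex.ofReal_neg] at opposite dirDeriv_axis ⊢
  linear_combination dirDeriv_axis - opposite / 2

end IsAxisymmetricMetricOn

end Axis

/-! ### Trace-free tensors on null vectors -/

section NullVectors

open Matrix

variable {n : ℕ} {h : Matrix (Fin 3) (Fin 3) ℝ} {t : ℝ}

protected lemma IsSymm.fixFirst {T : Tensor (n + 1)} (hT : IsSymm T) (m : Fin 3) :
    IsSymm (fixFirst T m) :=
  fun σ b => by
    rw [fixFirst, fixFirst,
      ← hT (Equiv.Perm.decomposeFin.symm (0, σ)) (Fin.cons m b)]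
    congr 1
    ext i
    refine Fin.cases ?_ (fun i => ?_) i <;> simp

lemma IsSymm.fixFirst_comm {T : Tensor (n + 2)} (hT : IsSymm T) (k m : Fin 3) :
    fixFirst (fixFirst T k) m = fixFirst (fixFirst T m) k := by
  ext b
  refine (congrArg T (funext fun i => ?_)).trans (hT (Equiv.swap 0 1) (Fin.cons m (Fin.cons k b)))
  refine Fin.cases ?_ (Fin.cases ?_ fun i => ?_) i
  · rw [Equiv.swap_apply_left]
    rfl
  · rw [Fin.succ_zero_eq_one, Equiv.swap_apply_right]
    rfl
  · rw [Equiv.swap_apply_of_ne_of_ne (Fin.succ_ne_zero _) (Fin.succ_succ_ne_one i)]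
    rfl

protected lemma IsTraceFree.fixFirst {T : Tensor (n + 1)} (hT : IsTraceFree h T) (m : Fin 3) :
    IsTraceFree h (fixFirst T m) := fun i j hij b => by
  simpa only [fixFirst, Fin.cons_update] using
    hT i.succ j.succ ((Fin.succ_injective _).ne hij) (Fin.cons m b)

lemma IsTraceFree.sum_fixFirst {T : Tensor (n + 2)} (hT : IsTraceFree 1 T) :
    ∑ k, fixFirst (fixFirst T k) k = 0 := by
  ext b
  have trace := hT 0 (Fin.succ 0) (Fin.succ_ne_zero 0).symm (Fin.cons 0 (Fin.cons 0 b))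
  simp only [Fin.update_cons_zero, ← Fin.cons_update] at trace
  simpa [one_apply, fixFirst, apply_ite Complex.ofReal] using trace

lemma hasDerivAt_contract {T : Tensor (n + 1)} (hT : IsSymm T) {v : ℝ → Fin 3 → ℂ}
    {v' : Fin 3 → ℂ} (hv : ∀ m, HasDerivAt (fun t => v t m) (v' m) t) :
    HasDerivAt (fun t => contract T (v t))
      ((n + 1) * (v' ⬝ᵥ fun m => contract (fixFirst T m) (v t))) t := by
  induction n with
  | zero =>
    have contract_eq : ∀ m u, contract (fixFirst T m) u = contract (fixFirst T m) (v t) := by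
      simp [contract]
    simpa [contract_succ T, contract_eq, dotProduct] using
      HasDerivAt.fun_sum (u := Finset.univ) fun m _ =>
        (hv m).mul_const (contract (fixFirst T m) (v t))
  | succ n ih =>
    have swap : ∑ m, v t m * (v' ⬝ᵥ fun k => contract (fixFirst (fixFirst T m) k) (v t))
        = v' ⬝ᵥ fun k => contract (fixFirst T k) (v t) := by
      simp only [dotProduct, contract_succ (fixFirst T _), Finset.mul_sum]
      rw [Finset.sum_comm]
      refine Finset.sum_congr rfl fun k _ => Finset.sum_congr rfl fun m _ => ?_
      rw [hT.fixFirst_comm m k, mul_left_comm]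
    simp only [contract_succ T]
    refine (HasDerivAt.fun_sum (u := Finset.univ) fun m _ =>
      (hv m).fun_mul (ih (hT.fixFirst m))).congr_deriv ?_
    simp only [Finset.sum_add_distrib, mul_left_comm (v t _), ← Finset.mul_sum, swap]
    rw [← dotProduct]
    push_cast
    ring

/-- The null vectors `∂_z - i ∂_ρ` at the axis, parametrized by the azimuth of the half-plane. -/
def nullVec (t : ℝ) : Fin 3 → ℂ := planeVec (Real.cos t) (Real.sin t)

/-- The derivative of `nullVec`. -/
def nullVec' (t : ℝ) : Fin 3 → ℂ := ![Complex.I * Real.sin t, -Complex.I * Real.cos t, 0]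

/-- The second derivative of `nullVec`. -/
def nullVec'' (t : ℝ) : Fin 3 → ℂ := ![Complex.I * Real.cos t, Complex.I * Real.sin t, 0]

lemma hasDerivAt_nullVec (t : ℝ) (m : Fin 3) :
    HasDerivAt (fun t => nullVec t m) (nullVec' t m) t := by
  fin_cases m
  · simpa [nullVec, nullVec', planeVec] using
      (Real.hasDerivAt_cos t).ofReal_comp.const_mul (-Complex.I)
  · simpa [nullVec, nullVec', planeVec] using
      (Real.hasDerivAt_sin t).ofReal_comp.const_mul (-Complex.I)
  · simpa [nullVec, nullVec', planeVec] using hasDerivAt_const t (1 : ℂ)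

lemma hasDerivAt_nullVec' (t : ℝ) (m : Fin 3) :
    HasDerivAt (fun t => nullVec' t m) (nullVec'' t m) t := by
  fin_cases m
  · simpa [nullVec', nullVec''] using (Real.hasDerivAt_sin t).ofReal_comp.const_mul Complex.I
  · simpa [nullVec', nullVec''] using (Real.hasDerivAt_cos t).ofReal_comp.const_mul (-Complex.I)
  · simpa [nullVec', nullVec''] using hasDerivAt_const t (0 : ℂ)

lemma nullVec'_add_pi_div_two (t : ℝ) : nullVec' (t + Real.pi / 2) = nullVec'' t := by
  simp [nullVec', nullVec'', Real.sin_add_pi_div_two, Real.cos_add_pi_div_two]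

lemma frame_completeness_nullVec (t : ℝ) :
    vecMulVec (nullVec t) (nullVec t) + vecMulVec (nullVec t) (nullVec'' t)
      + vecMulVec (nullVec'' t) (nullVec t) - vecMulVec (nullVec' t) (nullVec' t) = 1 := by
  have hcs : (Real.cos t : ℂ) ^ 2 + (Real.sin t : ℂ) ^ 2 = 1 := mod_cast Real.cos_sq_add_sin_sq t
  ext k m
  simp only [Matrix.sub_apply, Matrix.add_apply, vecMulVec_apply]
  fin_cases k <;> fin_cases m <;>
    simp [nullVec, nullVec', nullVec'', planeVec, -Complex.ofReal_cos, -Complex.ofReal_sin] <;>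
    grind [Complex.I_sq]

lemma eq_zero_of_dotProduct_nullVec {L : Fin 3 → ℂ} (h0 : nullVec t ⬝ᵥ L = 0)
    (h1 : nullVec' t ⬝ᵥ L = 0) (h2 : nullVec'' t ⬝ᵥ L = 0) : L = 0 := by
  rw [← one_mulVec L, ← frame_completeness_nullVec t, sub_mulVec, add_mulVec, add_mulVec]
  simp only [vecMulVec_mulVec, h0, h1, h2, MulOpposite.op_zero, zero_smul, add_zero, sub_zero]

lemma trace_eq_dotProduct_nullVec {B : Matrix (Fin 3) (Fin 3) ℂ} (hB : B.IsSymm) (t : ℝ) :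
    B.trace = nullVec t ⬝ᵥ B *ᵥ nullVec t + 2 * (nullVec'' t ⬝ᵥ B *ᵥ nullVec t)
      - nullVec' t ⬝ᵥ B *ᵥ nullVec' t := by
  have swap : nullVec t ⬝ᵥ B *ᵥ nullVec'' t = nullVec'' t ⬝ᵥ B *ᵥ nullVec t := by
    rw [dotProduct_mulVec, dotProduct_comm, ← mulVec_transpose, hB.eq]
  rw [← congrArg trace (mul_one B), ← frame_completeness_nullVec t]
  simp only [mul_sub, mul_add, trace_sub, trace_add, mul_vecMulVec, trace_vecMulVec,
    dotProduct_comm (B *ᵥ _), swap]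
  ring

lemma nullVec'_dotProduct_eq_zero {Q : Tensor (n + 1)} (hs : IsSymm Q)
    (hQ : ∀ t, contract Q (nullVec t) = 0) (t : ℝ) :
    nullVec' t ⬝ᵥ (fun m => contract (fixFirst Q m) (nullVec t)) = 0 := by
  have derivative := hasDerivAt_contract hs (hasDerivAt_nullVec t)
  simp only [hQ] at derivative
  exact (mul_eq_zero.1 (derivative.unique (hasDerivAt_const t 0))).resolve_left
    n.cast_add_one_ne_zero

/-- The second derivative of `contract Q (nullVec t) = 0` and the trace condition are two
independent linear relations between the contractions with `nullVec''` and twice `nullVec'`. -/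
lemma nullVec''_dotProduct_eq_zero {Q : Tensor (n + 2)} (hs : IsSymm Q) (ht : IsTraceFree 1 Q)
    (hQ : ∀ t, contract Q (nullVec t) = 0) (t : ℝ) :
    nullVec'' t ⬝ᵥ (fun m => contract (fixFirst Q m) (nullVec t)) = 0 := by
  let B : Matrix (Fin 3) (Fin 3) ℂ :=
    .of fun m k => contract (fixFirst (fixFirst Q m) k) (nullVec t)
  have mulVec_nullVec : B *ᵥ nullVec t = fun m => contract (fixFirst Q m) (nullVec t) :=
    funext fun m => (dotProduct_comm _ _).trans (contract_succ _ _).symm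
  have isSymm : B.IsSymm := by
    ext m k
    simp only [B, transpose_apply, of_apply, hs.fixFirst_comm m k]
  have trace_eq_zero : B.trace = 0 := by
    simpa only [B, trace, diag_apply, of_apply, contract_eq_dotProduct, sum_dotProduct,
      zero_dotProduct] using
      congrArg (contract · (nullVec t)) ht.sum_fixFirst
  have second_derivative : nullVec'' t ⬝ᵥ B *ᵥ nullVec t
      + (n + 1) * (nullVec' t ⬝ᵥ B *ᵥ nullVec' t) = 0 := by
    have derivative := HasDerivAt.fun_sum (u := Finset.univ) fun m _ =>
      (hasDerivAt_nullVec' t m).fun_mul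
        (hasDerivAt_contract (hs.fixFirst m) (hasDerivAt_nullVec t))
    have constant := derivative.unique ((hasDerivAt_const t (0 : ℂ)).congr_of_eventuallyEq
      (.of_forall (nullVec'_dotProduct_eq_zero hs hQ)))
    simp only [Finset.sum_add_distrib, mul_left_comm _ ((n : ℂ) + 1), ← Finset.mul_sum] at constant
    rw [mulVec_nullVec, show B *ᵥ nullVec' t = _ from funext fun m => dotProduct_comm _ _]
    exact constant
  have trace := trace_eq_dotProduct_nullVec isSymm t
  have null : nullVec t ⬝ᵥ B *ᵥ nullVec t = 0 := by
    rw [mulVec_nullVec, ← hQ t, contract_succ Q]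
    rfl
  rw [trace_eq_zero, null, zero_add] at trace
  rw [← mulVec_nullVec]
  have : ((2 * n + 3 : ℕ) : ℂ) * (nullVec'' t ⬝ᵥ B *ᵥ nullVec t) = 0 := by
    push_cast
    linear_combination second_derivative - (n + 1) * trace
  exact (mul_eq_zero.1 this).resolve_left (Nat.cast_ne_zero.2 (by omega))

lemma eq_zero_of_contract_nullVec {Q : Tensor n} (hs : IsSymm Q) (ht : IsTraceFree 1 Q)
    (hQ : ∀ t, contract Q (nullVec t) = 0) : Q = 0 := by
  induction n with
  | zero =>
    ext a
    rw [Subsingleton.elim a ![], ← contract_zero Q (nullVec 0), hQ, Pi.zero_apply]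
  | succ n ih =>
    have second : ∀ t, nullVec'' t ⬝ᵥ (fun m => contract (fixFirst Q m) (nullVec t)) = 0 := by
      cases n with
      | zero =>
        intro t
        rw [← nullVec'_add_pi_div_two, ← nullVec'_dotProduct_eq_zero hs hQ (t + Real.pi / 2)]
        simp only [contract_zero]
      | succ n => exact nullVec''_dotProduct_eq_zero hs ht hQ
    have contract_fixFirst : ∀ m t, contract (fixFirst Q m) (nullVec t) = 0 := fun m t =>
      congrFun (eq_zero_of_dotProduct_nullVec ((contract_succ Q _).symm.trans (hQ t))
        (nullVec'_dotProduct_eq_zero hs hQ t) (second t)) m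
    ext a
    have := congrFun (ih (hs.fixFirst (a 0)) (ht.fixFirst (a 0)) (contract_fixFirst (a 0)))
      (Fin.tail a)
    simpa [fixFirst] using this

end NullVectors

/-! ### Moments -/

section Moments

open Set Matrix

variable {h : Pt → Matrix (Fin 3) (Fin 3) ℝ} {φ : Pt → ℂ} {n : ℕ}

lemma sum_one_mul_nullVec_mul_nullVec (t : ℝ) :
    ∑ k, ∑ l, ((1 : Matrix (Fin 3) (Fin 3) ℝ) k l : ℂ) * nullVec t k * nullVec t l = 0 := by
  have hcs : (Real.cos t : ℂ) ^ 2 + (Real.sin t : ℂ) ^ 2 = 1 := mod_cast Real.cos_sq_add_sin_sq t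
  simp only [one_apply, apply_ite Complex.ofReal, Complex.ofReal_one, Complex.ofReal_zero, ite_mul,
    one_mul, zero_mul, Finset.sum_ite_eq, Finset.mem_univ, if_true, nullVec, planeVec,
    Fin.sum_univ_three, cons_val]
  linear_combination -hcs + ((Real.cos t : ℂ) ^ 2 + (Real.sin t : ℂ) ^ 2) * Complex.I_sq

lemma contract_prod_dz (v : Fin 3 → ℂ) :
    contract (fun a : Fin n → Fin 3 => ∏ i, if a i = 2 then (1 : ℂ) else 0) v = v 2 ^ n := by
  simp only [contract, ← Finset.prod_mul_distrib, mul_ite, mul_one, mul_zero]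
  rw [← Fintype.prod_sum fun (_ : Fin n) k => if k = 2 then v k else 0]
  simp

lemma contract_stf_dz_nullVec (t : ℝ) :
    contract (stf 1 (fun a : Fin n → Fin 3 => ∏ i, if a i = 2 then (1 : ℂ) else 0)) (nullVec t)
      = 1 := by
  rw [(isSTFPart_stf_one _).contract_eq (sum_one_mul_nullVec_mul_nullVec t), contract_prod_dz,
    show nullVec t 2 = 1 from rfl, one_pow]

lemma isMoment_iff (h0 : h 0 = 1) {y : ℂ}
    (hy : ∀ t, contract (gerochHansen h φ n 0) (nullVec t) = y) (m : ℂ) :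
    IsMoment h φ n m ↔ m = y := by
  set C : Tensor n := stf 1 fun a => ∏ i, if a i = 2 then (1 : ℂ) else 0 with C_def
  have contract_smul_C (t : ℝ) : contract (m • C) (nullVec t) = m := by
    rw [contract_smul, contract_stf_dz_nullVec, mul_one]
  rw [IsMoment, h0, ← C_def]
  refine ⟨fun hm => by rw [← hy 0, hm, contract_smul_C], fun hm => sub_eq_zero.1 ?_⟩
  have posDef : (h 0).PosDef := h0 ▸ PosDef.one
  have hC : IsSymm C ∧ IsTraceFree 1 C := ⟨(isSTFPart_stf_one _).1, (isSTFPart_stf_one _).2.1⟩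
  have isSymm := (isSymm_gerochHansen posDef φ n).add (hC.1.smul (-m))
  have isTraceFree := (h0 ▸ isTraceFree_gerochHansen posDef φ n).add (hC.2.smul (-m))
  rw [neg_smul, ← sub_eq_add_neg] at isSymm isTraceFree
  exact eq_zero_of_contract_nullVec isSymm isTraceFree fun t => by
    rw [contract_sub, hy, contract_smul_C, hm, sub_self]

end Moments

/-! ### The disc of analyticity -/

section Disc

open Set Matrix

variable {U V : Set Pt} {h : Pt → Matrix (Fin 3) (Fin 3) ℝ} {β κ : Pt → ℝ} {φ : Pt → ℂ} {R : ℝ}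

protected lemma IsAxisymmetricOn.mono {E : Type*} {g : Pt → E} (hg : IsAxisymmetricOn U g)
    (hVU : V ⊆ U) : IsAxisymmetricOn V g := fun p hp p' hp' => hg p (hVU hp) p' (hVU hp')

lemma IsAxisymmetricMetricOn.mono (H : IsAxisymmetricMetricOn U h β κ)
    (hV : IsOpen V) (hVU : V ⊆ U) : IsAxisymmetricMetricOn V h β κ where
  isOpen := hV
  isSmoothMetricOn := ⟨fun i j => (H.isSmoothMetricOn.1 i j).mono hVU,
    fun p hp => H.isSmoothMetricOn.2 p (hVU hp)⟩
  hasAxisymmetricForm p hp := H.hasAxisymmetricForm p (hVU hp)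
  contDiffOn_beta := H.contDiffOn_beta.mono hVU
  contDiffOn_kappa := H.contDiffOn_kappa.mono hVU
  beta_axisymmetric := H.beta_axisymmetric.mono hVU
  kappa_axisymmetric := H.kappa_axisymmetric.mono hVU

lemma analyticAt_comp_meridian {g : Pt → ℂ} (hg : AnalyticAt ℝ g 0) :
    AnalyticAt ℝ (g ∘ meridian) 0 := by
  rw [← planePt_one_zero]
  exact hg.comp_of_eq ((planePt 1 0).analyticAt 0) (map_zero _)

lemma analyticAt_onMeridian {g : Pt → ℝ} (hg : AnalyticAt ℝ g 0) :
    AnalyticAt ℝ (onMeridian g) 0 :=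
  analyticAt_comp_meridian ((Complex.ofRealCLM.analyticAt _).comp hg)

lemma analyticAt_etaDeriv {g : ℝ × ℝ → ℂ} {w : ℝ × ℝ} (hg : AnalyticAt ℝ g w) :
    AnalyticAt ℝ (etaDeriv g) w := by
  have analyticAt_apply (v : ℝ × ℝ) : AnalyticAt ℝ (fun x => fderiv ℝ g x v) w :=
    ((ContinuousLinearMap.apply ℝ ℂ v).analyticAt _).comp hg.fderiv
  exact (analyticAt_apply _).sub (analyticAt_const.mul (analyticAt_apply _))

/-- `β` vanishes on the axis because `h` is smooth there, so `∂_z β - i ∂_ρ β` is divisible by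
`ρ`. -/
lemma IsAxisymmetricMetricOn.exists_etaDeriv_onMeridian_beta_eq_mul
    (H : IsAxisymmetricMetricOn (Metric.ball 0 R) h β κ) (hR : 0 < R) (hβ : AnalyticAt ℝ β 0) :
    ∃ q, AnalyticAt ℝ q 0 ∧ ∀ᶠ w in 𝓝 0, etaDeriv (onMeridian β) w = w.2 * q w := by
  simp only [← Complex.real_smul]
  refine exists_analyticAt_eq_smul_of_axis_eq_zero
    (analyticAt_etaDeriv (analyticAt_onMeridian hβ)) ?_
  filter_upwards [Metric.ball_mem_nhds (0 : ℝ) hR] with z hz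
  exact H.etaDeriv_onMeridian_beta_axis (mem_ball_zero_iff.1 hz)

lemma IsAxisymmetricMetricOn.exists_isComplexifiable (H : IsAxisymmetricMetricOn U h β κ)
    (h0 : 0 ∈ U) (hβ : AnalyticAt ℝ β 0) (hκ : AnalyticAt ℝ κ 0) (hφ : AnalyticAt ℝ φ 0) :
    ∃ δ > 0, Metric.ball 0 δ ⊆ U ∧ IsComplexifiable δ (onMeridian β) ∧
      IsComplexifiable δ (onMeridian κ) ∧ IsComplexifiable δ (φ ∘ meridian) ∧
      ∃ q, IsComplexifiable δ q ∧
        ∀ w ∈ Metric.ball 0 δ, etaDeriv (onMeridian β) w = w.2 * q w := by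
  obtain ⟨R, hR, hRU⟩ := Metric.isOpen_iff.1 H.isOpen 0 h0
  obtain ⟨q, hq, hbq⟩ :=
    (H.mono Metric.isOpen_ball hRU).exists_etaDeriv_onMeridian_beta_eq_mul hR hβ
  obtain ⟨δ, hδ, hδU, hδb, hδk, hδφ, hδq, hδbq⟩ :=
    ((eventually_ball_subset (H.isOpen.mem_nhds h0)).and <|
      (eventually_isComplexifiable (analyticAt_onMeridian hβ)).and <|
      (eventually_isComplexifiable (analyticAt_onMeridian hκ)).and <|
      (eventually_isComplexifiable (analyticAt_comp_meridian hφ)).and <|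
      (eventually_isComplexifiable hq).and <| eventually_ball_subset hbq).exists_gt
  exact ⟨δ, hδ, hδU, hδb, hδk, hδφ, q, hδq, hδbq⟩

end Disc

section Recursion

open Set Matrix

variable {h : Pt → Matrix (Fin 3) (Fin 3) ℝ} {β κ : Pt → ℝ} {φ : Pt → ℂ} {R : ℝ}
  {k M q : ℝ × ℝ → ℂ} {f : ℕ → ℝ × ℝ → ℂ}

lemma SatisfiesNullRecursion.leadingOrder_of_one_le (hf : SatisfiesNullRecursion R (etaDeriv k) M f)
    (hk : IsComplexifiable R k) (hM : IsComplexifiable R M) (h0 : IsComplexifiable R (f 0)) {n : ℕ}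
    (hn : 1 ≤ n) {r : ℝ} (hr : r ∈ Ioo (-R) R) :
    leadingOrder (f n) r = deriv (leadingOrder (f (n - 1))) r
      - 2 * ((n : ℂ) - 1) * deriv (leadingOrder k) r * leadingOrder (f (n - 1)) r
      - ((n : ℂ) - 1) * (2 * (n : ℂ) - 3) / 2 * leadingOrder M r
        * leadingOrder (f (n - 2)) r := by
  obtain ⟨n, rfl⟩ := Nat.exists_eq_add_of_le' hn
  rw [hf.leadingOrder_succ hk.etaDeriv hM h0 n hr, hk.deriv_leadingOrder hr,
    Nat.add_sub_cancel, Nat.add_sub_add_right]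
  push_cast
  ring

lemma planeFun_zero (c s : ℝ) : planeFun h φ c s 0 = φ ∘ planePt c s :=
  funext fun _ => contract_zero _ _

lemma fFun_zero : fFun h φ 0 = φ ∘ meridian := by
  rw [← planeFun_one_zero, planeFun_zero, planePt_one_zero]

variable (H : IsAxisymmetricMetricOn (Metric.ball 0 R) h β κ)
  (hφ : ContDiffOn ℝ ∞ φ (Metric.ball 0 R)) (hb : IsComplexifiable R (onMeridian β))
  (hk : IsComplexifiable R (onMeridian κ)) (hq : IsComplexifiable R q)
  (hbq : ∀ w ∈ Metric.ball 0 R, etaDeriv (onMeridian β) w = w.2 * q w)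
include H hφ hb hk hq hbq

lemma satisfiesNullRecursion_fFun :
    SatisfiesNullRecursion R (etaDeriv (onMeridian κ)) (nullRicci (onMeridian β) (onMeridian κ) q)
      (fFun h φ) := by
  rw [← funext planeFun_one_zero]
  exact satisfiesNullRecursion_planeFun H hφ hb hk hq hbq (by norm_num)

lemma contract_gerochHansen_nullVec (hR : 0 < R) (hφs : IsAxisymmetricOn (Metric.ball 0 R) φ)
    (n : ℕ) (t : ℝ) : contract (gerochHansen h φ n 0) (nullVec t) = fFun h φ n 0 := by
  have hcs := Real.cos_sq_add_sin_sq t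
  have planeFun_eqOn := (satisfiesNullRecursion_planeFun H hφ hb hk hq hbq hcs).eqOn
    (satisfiesNullRecursion_fFun H hφ hb hk hq hbq)
    (by simpa only [planeFun_zero, fFun_zero] using hφs.comp_planePt hcs) n
  rw [← planeFun_eqOn (Metric.mem_ball_self hR), planeFun, map_zero, nullVec]

end Recursion

end Multipole

end

open Multipole in
theorem mainTheorem2
    (U : Set Multipole.Pt) (hU : IsOpen U) (h0 : (0 : Multipole.Pt) ∈ U)
    (h : Multipole.Pt → Matrix (Fin 3) (Fin 3) ℝ) (β κ : Multipole.Pt → ℝ)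
    (φ : Multipole.Pt → ℂ)
    (hh : Multipole.IsSmoothMetricOn U h)
    (hform : Multipole.HasAxisymmetricForm U h β κ)
    (hβ : AnalyticOnNhd ℝ β U) (hκ : AnalyticOnNhd ℝ κ U) (hφ : AnalyticOnNhd ℝ φ U)
    (hβs : Multipole.IsAxisymmetricOn U β) (hκs : Multipole.IsAxisymmetricOn U κ)
    (hφs : Multipole.IsAxisymmetricOn U φ)
    (hκ0 : κ 0 = 0)
    (βL κL : ℝ → ℂ) (y : ℕ → ℝ → ℂ)
    (hβL : βL = Multipole.leadingOrder (Multipole.onMeridian β))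
    (hκL : κL = Multipole.leadingOrder (Multipole.onMeridian κ))
    (hy : ∀ n, y n = Multipole.leadingOrder (Multipole.fFun h φ n)) :
    (∃ δ : ℝ, 0 < δ ∧
      -- the leading order functions are well defined and analytic on `(-δ, δ)`
      (∃ B, Multipole.IsComplexification δ (Multipole.onMeridian β) B) ∧
      (∃ K, Multipole.IsComplexification δ (Multipole.onMeridian κ) K) ∧
      (∀ n, ∃ F, Multipole.IsComplexification δ (Multipole.fFun h φ n) F) ∧
      AnalyticOnNhd ℝ βL (Set.Ioo (-δ) δ) ∧
      AnalyticOnNhd ℝ κL (Set.Ioo (-δ) δ) ∧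
      (∀ n, AnalyticOnNhd ℝ (y n) (Set.Ioo (-δ) δ)) ∧
      -- `M` is the analytic function given by the formula for `r ≠ 0`
      ∃ M : ℝ → ℂ, AnalyticOnNhd ℝ M (Set.Ioo (-δ) δ) ∧
        (∀ r ∈ Set.Ioo (-δ) δ, r ≠ 0 →
          M r = deriv (deriv βL) r - (deriv βL r) ^ 2 + 2 / (r : ℂ) * deriv βL r
            - deriv (deriv κL) r + (deriv κL r) ^ 2) ∧
        -- for `n = 1` the last term has coefficient `0`
        ∀ n : ℕ, 1 ≤ n → ∀ r ∈ Set.Ioo (-δ) δ,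
          y n r = deriv (y (n - 1)) r
            - 2 * ((n : ℂ) - 1) * deriv κL r * y (n - 1) r
            - ((n : ℂ) - 1) * (2 * (n : ℂ) - 3) / 2 * M r * y (n - 2) r) ∧
    -- the `n`-th moment exists, is unique, and equals `y n 0`
    ∀ (n : ℕ) (m : ℂ), Multipole.IsMoment h φ n m ↔ m = y n 0 := by
  subst hβL hκL
  simp only [hy]
  have H : IsAxisymmetricMetricOn U h β κ :=
    ⟨hU, hh, hform, hβ.contDiffOn hU.uniqueDiffOn, hκ.contDiffOn hU.uniqueDiffOn, hβs, hκs⟩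
  obtain ⟨δ, hδ, hδU, hb, hk, hφ0, q, hq, hbq⟩ :=
    H.exists_isComplexifiable h0 (hβ 0 h0) (hκ 0 h0) (hφ 0 h0)
  replace H := H.mono Metric.isOpen_ball hδU
  replace hφ := (hφ.contDiffOn hU.uniqueDiffOn (n := ∞)).mono hδU
  have hM := hb.nullRicci hk hq
  have hf := satisfiesNullRecursion_fFun H hφ hb hk hq hbq
  replace hφ0 : IsComplexifiable δ (fFun h φ 0) := by rwa [fFun_zero]
  have hfn := hf.isComplexifiable hk.etaDeriv hM hφ0
  refine ⟨⟨δ, hδ, hb, hk, hfn, hb.analyticOnNhd_leadingOrder, hk.analyticOnNhd_leadingOrder,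
    fun n => (hfn n).analyticOnNhd_leadingOrder, _, hM.analyticOnNhd_leadingOrder,
    fun r hr hr0 => leadingOrder_nullRicci hb hk hq hbq hr hr0,
    fun n hn r hr => hf.leadingOrder_of_one_le hk hM hφ0 hn hr⟩, fun n => ?_⟩
  rw [leadingOrder_zero (hfn n) hδ]
  exact isMoment_iff (H.metric_zero hδ hκ0)
    (contract_gerochHansen_nullVec H hφ hb hk hq hbq hδ (hφs.mono hδU) n)
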